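/- **Setting.** All alphabets are finite and all information quantities are in bits. A two-user MAC $P(y|x,w)$ has input alphabets $\mathcal X,\mathcal W$ and output alphabet $\mathcal Y$. For an input law $p=p(q)p(x|q)p(w|q)$ with finite time-sharing alphabet, $\mathscr R_Y(p)$ is the set of pairs $(R_1,R_2)$, $R_1,R_2\ge 0$, with $R_1\le I(X;Y,W|Q)$, $R_2\le I(W;Y,X|Q)$, $R_1+R_2\le I(X,W;Y|Q)$. For a compound MAC consisting of $P_Y(y|x,w)$ and $P_Z(z|x,w)$ the capacity region is $\bigcup_p(\mathscr R_Y(p)\cap\mathscr R_Z(p))$. **Aligned polar schemes.** Let $\ell$ be a prime ($\ell=2$ is the binary case), and let $P_Y,P_Z$ be MACs with both inputs in $\mathbb F_\ell$. Fix $\beta<1/2$, $N=2^n$, and let $G_N=\left[\begin{smallmatrix}1&0\\1&1\end{smallmatrix}\right]^{\otimes n}B_N$ with $B_N$ the bit-reversal permutation. A scheme of length $M=2^kN$ consists of transforms of the two input words, with values $U^M$ and $V^M$, and of two permutations $S^{2M},T^{2M}$ of the $2M$ symbols of $U^MV^M$, used by receiver $Y$ and receiver $Z$. With $X^M,W^M$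 independent and uniform and the outputs produced by $M$ independent channel uses, put for $j=1,2$ $$R_j^s=\frac1M\sum_{i} I(S_i;Y^M|S^{i-1}),\qquad R_j^t=\frac1M\sum_{i} I(T_i;Z^M|T^{i-1}),$$ summed over the positions $i$ that hold symbols of sender $j$. A symbol $S_i$ is *good for $Y$* if $I(S_i;Y^M|S^{i-1})>(1-2^{-N^\beta})\log_2\ell$ and *bad for $Y$* if $I(S_i;Y^M|S^{i-1})<2^{-N^\beta}\log_2\ell$; similarly for $Z$ with $T$. Let $\mathcal G_Y^{(j)},\mathcal G_Z^{(j)}$ be the sets of symbols of sender $j$ that are good for $Y$, respectively $Z$. The *aligned* schemes are those built as follows. * $k=0$ (polar splitting): $U^N=X^NG_N$, $V^N=W^NG_N$, $S^{2N}=(U^i,V^N,U_{i+1}^N)$ and $T^{2N}=(U^{i'},V^N,U_{i'+1}^N)$ for some $0\le i,i'\le N$. * $k\to k+1$ (alignment): take two independent copies of an aligned scheme of length $2^kN$ and one sender $j$. Some symbols $c$ of sender $j$ in the first copy that are good for $Y$ and bad for $Z$ are paired with symbols $d$ of sender $j$ in the second copy that are bad for $Y$ and good for $Z$; in each pair, with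 values $u_c$ and $e_d$, the value $u_c$ is replaced by $u_c+e_d$, and all other symbols are kept. The new $S$ restricts to the old $S$ on each copy and lists $u_c+e_d$ immediately before $e_d$ for each pair; likewise for $T$. In particular $S^{2M}$ and $T^{2M}$ are *monotone*: within each of the $2^k$ blocks of length $N$ the symbols of each sender appear in increasing order. **Theorem.** 1. *(Uniform inputs.)* Let $\ell$ be a prime, let $P_Y,P_Z$ be MACs with inputs in $\mathbb F_\ell$, and let $p$ be the law of independent uniform inputs with constant $Q$. For every $\epsilon>0$, $\beta<1/2$ and $(I_1,I_2)\in K:=\mathscr R_Y(p)\cap\mathscr R_Z(p)$ there exist arbitrarily large $N=2^n$, a number $M=2^kN$, and an aligned scheme of length $M$ with monotone permutations $S^{2M},T^{2M}$ such that for $j=1,2$ (i) $\min\{R_j^s,R_j^t\}>I_j-\epsilon$, and moreover $|\min\{R_j^s,R_j^t\}-I_j|<\epsilon$ if $(I_1,I_2)$ is a maximal element of $K$ for the componentwise order; (ii) $\displaystyle\frac{|\mathcal G_Y^{(j)}\cap\mathcal G_Z^{(j)}|}{M}\log_2\ell>\min\{R_j^s,R_j^t\}-\epsilon.$ 2. *(Arbitrary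 inputs.)* Let $P_Y,P_Z$ be MACs with finite input alphabets $\mathcal X,\mathcal W$, let $p=p(q)p(x|q)p(w|q)$ be any input law, and let $(I_1,I_2)\in K:=\mathscr R_Y(p)\cap\mathscr R_Z(p)$. For every $\epsilon>0$ and $\beta<1/2$ there exist a prime $\ell$ and maps $x(x',q)$, $w(w',q)$, $x',w'\in\mathbb F_\ell$, such that the conclusion of part 1, with this $K$, holds for the two induced MACs $P'_Y(y,q|x',w')=p(q)P_Y(y|x(x',q),w(w',q))$ and $P'_Z(z,q|x',w')=p(q)P_Z(z|x(x',q),w(w',q))$. 3. *(Achievability.)* For every $\beta<1/2$, every point $(R_1,R_2)$ of the capacity region of the compound MAC $\{P_Y,P_Z\}$ is achievable by polar codes: for every $\delta>0$ there are codes of arbitrarily large length $M=2^kN$ whose rates are within $\delta$ of $R_1$ and $R_2$ and whose average error probability is at most $\delta$ on each of the two MACs. Here such a code is given by a prime $\ell$, a law $p(q)$, maps $x(x',q),w(w',q)$ as in part 2, an aligned scheme of length $M$ for the induced MACs, information sets $\mathcal A_j\subseteq\mathcal G_Y^{(j)}\cap\mathcal G_Z^{(j)}$, frozen values for all other symbols,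 and a time-sharing sequence $q^M$ known to senders and receivers. The message of sender $j$ is uniform on $\mathbb F_\ell^{\mathcal A_j}$ (rate $\frac{|\mathcal A_j|}{M}\log_2\ell$), it is placed on the symbols in $\mathcal A_j$, the transform is inverted, and the maps $x(\cdot,q_t),w(\cdot,q_t)$ are applied symbol by symbol; the receivers $Y$ and $Z$ use successive cancellation decoding along $S^{2M}$ and $T^{2M}$. -/

import Mathlib

open scoped ENNReal

namespace CompoundMAC

noncomputable section

/-! ## Finite information theory (all quantities in bits) -/

/-- Shannon entropy, in bits, of the finite-valued random variable `f` under the law `μ`. -/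
def entropy {Ω A : Type*} [Fintype A] (μ : PMF Ω) (f : Ω → A) : ℝ :=
  (∑ a, Real.negMulLog ((μ.map f) a).toReal) / Real.log 2

/-- Conditional mutual information `I(f; g | h)`, in bits, of finite-valued random variables. -/
def condMutualInfo {Ω A B C : Type*} [Fintype A] [Fintype B] [Fintype C]
    (μ : PMF Ω) (f : Ω → A) (g : Ω → B) (h : Ω → C) : ℝ :=
  entropy μ (fun ω => (f ω, h ω)) + entropy μ (fun ω => (g ω, h ω))
    - entropy μ (fun ω => (f ω, g ω, h ω)) - entropy μ h

/-- The product of finitely many probability mass functions: independent coordinates `y t ∼ p t`. -/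
def piPMF {ι A : Type*} [Fintype ι] [DecidableEq ι] [Fintype A] (p : ι → PMF A) :
    PMF (ι → A) :=
  PMF.ofFintype (fun y => ∏ t, p t (y t)) (by
    have h := (Finset.prod_univ_sum (fun _ : ι => (Finset.univ : Finset A))
      (fun t a => p t a)).symm
    rw [Fintype.piFinset_univ] at h
    rw [h]
    refine Finset.prod_eq_one fun t _ => ?_
    have h' := (p t).tsum_coe
    rwa [tsum_fintype] at h')

/-! ## Two-user multiple-access channels and their rate regions

A two-user MAC with input alphabets `X`, `W` and output alphabet `Y` is a map `X → W → PMF Y`.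
Rate pairs are functions `Fin 2 → ℝ`: component `0` is the rate of sender 1 (input `X`),
component `1` the rate of sender 2 (input `W`). -/

/-- The law `p(q) p(x|q) p(w|q) P(y|x,w)` of `(Q, X, W, Y)`. -/
def jointLaw {T X W Y : Type*} (pQ : PMF T) (pX : T → PMF X) (pW : T → PMF W)
    (P : X → W → PMF Y) : PMF (T × X × W × Y) :=
  pQ.bind fun t => (pX t).bind fun x => (pW t).bind fun w => (P x w).map fun y => (t, x, w, y)

/-- The pentagon `ℛ(p)`:
`R₁ ≤ I(X; Y,W | Q)`, `R₂ ≤ I(W; Y,X | Q)`, `R₁ + R₂ ≤ I(X,W; Y | Q)`, `R₁, R₂ ≥ 0`. -/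
def rateRegion {T X W Y : Type*} [Fintype T] [Fintype X] [Fintype W] [Fintype Y]
    (pQ : PMF T) (pX : T → PMF X) (pW : T → PMF W) (P : X → W → PMF Y) :
    Set (Fin 2 → ℝ) :=
  {R | 0 ≤ R 0 ∧ 0 ≤ R 1 ∧
    R 0 ≤ condMutualInfo (jointLaw pQ pX pW P)
      (fun ω => ω.2.1) (fun ω => (ω.2.2.2, ω.2.2.1)) (fun ω => ω.1) ∧
    R 1 ≤ condMutualInfo (jointLaw pQ pX pW P)
      (fun ω => ω.2.2.1) (fun ω => (ω.2.2.2, ω.2.1)) (fun ω => ω.1) ∧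
    R 0 + R 1 ≤ condMutualInfo (jointLaw pQ pX pW P)
      (fun ω => (ω.2.1, ω.2.2.1)) (fun ω => ω.2.2.2) (fun ω => ω.1)}

/-- The pentagon for independent uniform inputs on `𝔽_q` and constant `Q`. -/
def uniformRegion {q : ℕ} [NeZero q] {Y : Type*} [Fintype Y] (P : ZMod q → ZMod q → PMF Y) :
    Set (Fin 2 → ℝ) :=
  rateRegion (PMF.pure ()) (fun _ => PMF.uniformOfFintype (ZMod q))
    (fun _ => PMF.uniformOfFintype (ZMod q)) P

/-- The capacity region of the compound MAC `{P_Y, P_Z}`: the union of `ℛ_Y(p) ∩ ℛ_Z(p)` over all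
input laws `p(q) p(x|q) p(w|q)` with a finite time-sharing alphabet. -/
def capacityRegion {X W Y Z : Type*} [Fintype X] [Fintype W] [Fintype Y] [Fintype Z]
    (PY : X → W → PMF Y) (PZ : X → W → PMF Z) : Set (Fin 2 → ℝ) :=
  {R | ∃ (m : ℕ) (pQ : PMF (Fin m)) (pX : Fin m → PMF X) (pW : Fin m → PMF W),
    R ∈ rateRegion pQ pX pW PY ∩ rateRegion pQ pX pW PZ}

/-- The MAC with inputs in `𝔽_q` and output `(Y, Q)` induced by the symbol maps `x(x', q)`,
`w(w', q)` and the law of `Q`: `P'(y, q | x', w') = p(q) P(y | x(x', q), w(w', q))`. -/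
def inducedMAC {q m : ℕ} {X W Y : Type*} (pQ : PMF (Fin m))
    (fx : ZMod q → Fin m → X) (fw : ZMod q → Fin m → W) (P : X → W → PMF Y) :
    ZMod q → ZMod q → PMF (Y × Fin m) :=
  fun x' w' => pQ.bind fun t => (P (fx x' t) (fw w' t)).map fun y => (y, t)

/-! ## Indices, polar transform, schemes -/

/-- The indices of a superblock made of `2 ^ k` blocks of length `N = 2 ^ n`: one block for
`k = 0`, and two copies of the previous superblock for `k + 1`. They label the channel uses as
well as the `M = 2 ^ k * N` transformed symbols of one sender. -/
def Idx (n : ℕ) : ℕ → Type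
  | 0 => Fin (2 ^ n)
  | k + 1 => Idx n k ⊕ Idx n k

instance instFintypeIdx (n : ℕ) : ∀ k, Fintype (Idx n k)
  | 0 => inferInstanceAs (Fintype (Fin (2 ^ n)))
  | k + 1 =>
    letI := instFintypeIdx n k
    inferInstanceAs (Fintype (Idx n k ⊕ Idx n k))

instance instDecidableEqIdx (n : ℕ) : ∀ k, DecidableEq (Idx n k)
  | 0 => inferInstanceAs (DecidableEq (Fin (2 ^ n)))
  | k + 1 =>
    letI := instDecidableEqIdx n k
    inferInstanceAs (DecidableEq (Idx n k ⊕ Idx n k))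

/-- The index `a` in the first copy of the superblock. -/
def Idx.fst {n k : ℕ} (a : Idx n k) : Idx n (k + 1) := Sum.inl a

/-- The index `a` in the second copy of the superblock. -/
def Idx.snd {n k : ℕ} (a : Idx n k) : Idx n (k + 1) := Sum.inr a

/-- `a` and `b` lie in the same length-`N` block and `a` is the smaller of the two. -/
def Idx.BlockLT {n : ℕ} : {k : ℕ} → Idx n k → Idx n k → Prop
  | 0, a, b => @LT.lt (Fin (2 ^ n)) _ a b
  | _ + 1, Sum.inl a, Sum.inl b => Idx.BlockLT a b
  | _ + 1, Sum.inr a, Sum.inr b => Idx.BlockLT a b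
  | _ + 1, Sum.inl _, Sum.inr _ => False
  | _ + 1, Sum.inr _, Sum.inl _ => False

/-- The transformed symbols of both senders: `(0, i)` is the `i`-th symbol of sender 1 (the `U`'s),
`(1, i)` the `i`-th symbol of sender 2 (the `V`'s). -/
abbrev Var (n k : ℕ) : Type := Fin 2 × Idx n k

/-- A permutation `S^{2M}` of the `2M` transformed symbols, given by the position of each. -/
abbrev Perm (n k : ℕ) : Type := Var n k ≃ Fin (2 * (2 ^ k * 2 ^ n))

/-- `S` is monotone: the symbols of each sender that belong to the same block appear
in increasing order. -/
def IsMonotone {n k : ℕ} (S : Perm n k) : Prop :=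
  ∀ (j : Fin 2) (a b : Idx n k), Idx.BlockLT a b → S (j, a) < S (j, b)

/-- The matrix `G_N = [1,0;1,1]^{⊗n} B_N`, `N = 2 ^ n`, with `B_N` the bit-reversal permutation. -/
def polarMatrix (q n : ℕ) : Matrix (Fin (2 ^ n)) (Fin (2 ^ n)) (ZMod q) :=
  Matrix.of fun a b => ∏ l : Fin n,
    (!![1, 0; 1, 1] : Matrix (Fin 2) (Fin 2) (ZMod q))
      (finFunctionFinEquiv.symm a l) (finFunctionFinEquiv.symm b l.rev)

/-- The polar transform `U^N = X^N G_N`. -/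
def polarTransform (q n : ℕ) (x : Idx n 0 → ZMod q) : Idx n 0 → ZMod q :=
  Matrix.vecMul (m := Fin (2 ^ n)) x (polarMatrix q n)

/-- `S = (U^i, V^N, U_{i+1}^N)`. -/
def IsSplit {n : ℕ} (i : ℕ) (S : Perm n 0) : Prop :=
  (∀ a b : Fin (2 ^ n), S (0, a) < S (0, b) ↔ a < b) ∧
  (∀ a b : Fin (2 ^ n), S (1, a) < S (1, b) ↔ a < b) ∧
  (∀ a b : Fin (2 ^ n), S (0, a) < S (1, b) ↔ (a : ℕ) < i)

/-- The data of a two-receiver scheme at level `k`: the transform `X^M ↦ Ũ^M` of each sender and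
the permutations `S^{2M}`, `T^{2M}` used by the two receivers. -/
structure Scheme (q n k : ℕ) where
  transform : Fin 2 → (Idx n k → ZMod q) → Idx n k → ZMod q
  S : Perm n k
  T : Perm n k

/-- The value of the transformed symbol `v` when the senders transmit `x 0` and `x 1`. -/
def Scheme.symbol {q n k : ℕ} (s : Scheme q n k) (v : Var n k)
    (x : Fin 2 → Idx n k → ZMod q) : ZMod q :=
  s.transform v.1 (x v.1) v.2

/-- The joint law of independent uniform inputs and the outputs of `M` uses of the MAC `P`. -/
def blockLaw {q : ℕ} [NeZero q] {Y : Type*} [Fintype Y] (n k : ℕ)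
    (P : ZMod q → ZMod q → PMF Y) :
    PMF ((Fin 2 → Idx n k → ZMod q) × (Idx n k → Y)) :=
  (PMF.uniformOfFintype (Fin 2 → Idx n k → ZMod q)).bind fun x =>
    (piPMF fun t => P (x 0 t) (x 1 t)).map fun y => (x, y)

/-- `I(S_i; Y^M | S^{i-1})` in bits, where `S_i` is the symbol `v`. -/
def Scheme.symbolInfo {q n k : ℕ} [NeZero q] {Y : Type*} [Fintype Y] (s : Scheme q n k)
    (P : ZMod q → ZMod q → PMF Y) (S : Perm n k) (v : Var n k) : ℝ :=
  condMutualInfo (blockLaw n k P) (fun ω => s.symbol v ω.1) (fun ω => ω.2)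
    (fun ω (w : {w : Var n k // S w < S v}) => s.symbol w ω.1)

/-- The rate `R_j = (1/M) ∑ I(S_i; Y^M | S^{i-1})`, the sum being over the symbols of sender `j`. -/
def Scheme.rate {q n k : ℕ} [NeZero q] {Y : Type*} [Fintype Y] (s : Scheme q n k)
    (P : ZMod q → ZMod q → PMF Y) (S : Perm n k) (j : Fin 2) : ℝ :=
  (∑ i, s.symbolInfo P S (j, i)) / (2 ^ k * 2 ^ n)

/-- `I(S_i; Y^M | S^{i-1}) > (1 - 2^{-N^β}) log₂ q`. -/
def Scheme.Good {q n k : ℕ} [NeZero q] {Y : Type*} [Fintype Y] (s : Scheme q n k) (β : ℝ)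
    (P : ZMod q → ZMod q → PMF Y) (S : Perm n k) (v : Var n k) : Prop :=
  (1 - (2 : ℝ) ^ (-((2 ^ n : ℝ) ^ β))) * Real.logb 2 q < s.symbolInfo P S v

/-- `I(S_i; Y^M | S^{i-1}) < 2^{-N^β} log₂ q`. -/
def Scheme.Bad {q n k : ℕ} [NeZero q] {Y : Type*} [Fintype Y] (s : Scheme q n k) (β : ℝ)
    (P : ZMod q → ZMod q → PMF Y) (S : Perm n k) (v : Var n k) : Prop :=
  s.symbolInfo P S v < (2 : ℝ) ^ (-((2 ^ n : ℝ) ^ β)) * Real.logb 2 q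

/-! ## Alignment -/

/-- Combining two copies of a superblock: with `U = t x₁` and `E = t x₂`, the symbol `U_c` is
replaced by `U_c + E_d` if `m c = some d`; all other symbols (in particular `E_d`) are kept. -/
def alignTransform {q n k : ℕ} (m : Idx n k → Option (Idx n k))
    (t : (Idx n k → ZMod q) → Idx n k → ZMod q) (x : Idx n (k + 1) → ZMod q) :
    Idx n (k + 1) → ZMod q :=
  Sum.elim
    (fun c => t (fun a => x a.fst) c + (m c).elim 0 (fun d => t (fun a => x a.snd) d))
    (fun d => t (fun a => x a.snd) d)

/-- `S'` is a decoding order for two copies of a superblock with order `S`, in which the symbols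
of sender `j` are combined according to `m`: each copy is decoded in the order `S`, and
`U_c + E_d`, `E_d` are decoded one right after the other. -/
def IsMerge {n k : ℕ} (j : Fin 2) (m : Idx n k → Option (Idx n k)) (S : Perm n k)
    (S' : Perm n (k + 1)) : Prop :=
  (∀ v w : Var n k, S' (v.1, v.2.fst) < S' (w.1, w.2.fst) ↔ S v < S w) ∧
  (∀ v w : Var n k, S' (v.1, v.2.snd) < S' (w.1, w.2.snd) ↔ S v < S w) ∧
  (∀ c d : Idx n k, m c = some d →
    ((S' (j, d.snd) : Fin _) : ℕ) = ((S' (j, c.fst) : Fin _) : ℕ) + 1)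

/-- The schemes obtained by polar splitting followed by recursive alignment.
`base`: polar transforms, with orders `(U^i, V^N, U_{i+1}^N)` and `(U^{i'}, V^N, U_{i'+1}^N)`.
`step`: two copies of a scheme, in which some symbols `c` of the first copy that are good for
receiver `Y` and bad for receiver `Z` are combined with symbols `d` of the same sender in the
second copy that are bad for `Y` and good for `Z`; the other sender's symbols stay uncombined. -/
inductive IsAligned {q : ℕ} [NeZero q] {Y Z : Type*} [Fintype Y] [Fintype Z]
    (PY : ZMod q → ZMod q → PMF Y) (PZ : ZMod q → ZMod q → PMF Z) (β : ℝ) (n : ℕ) :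
    {k : ℕ} → Scheme q n k → Prop
  | base (s : Scheme q n 0) (i i' : ℕ) (hi : i ≤ 2 ^ n) (hi' : i' ≤ 2 ^ n)
      (ht : ∀ j, s.transform j = polarTransform q n)
      (hS : IsSplit i s.S) (hT : IsSplit i' s.T) : IsAligned PY PZ β n s
  | step {k : ℕ} (s : Scheme q n k) (s' : Scheme q n (k + 1)) (j : Fin 2)
      (m : Idx n k → Option (Idx n k))
      (hs : IsAligned PY PZ β n s)
      (hII : ∀ c d, m c = some d → s.Good β PY s.S (j, c) ∧ s.Bad β PZ s.T (j, c))
      (hIII : ∀ c d, m c = some d → s.Bad β PY s.S (j, d) ∧ s.Good β PZ s.T (j, d))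
      (ht : ∀ j', s'.transform j' =
        alignTransform (if j' = j then m else fun _ => none) (s.transform j'))
      (hS : IsMerge j m s.S s'.S) (hT : IsMerge j m s.T s'.T) : IsAligned PY PZ β n s'

open Classical in
/-- The symbols of sender `j` that are good for both receivers. -/
def Scheme.commonGood {q n k : ℕ} [NeZero q] {Y Z : Type*} [Fintype Y] [Fintype Z]
    (s : Scheme q n k) (β : ℝ) (PY : ZMod q → ZMod q → PMF Y) (PZ : ZMod q → ZMod q → PMF Z)
    (j : Fin 2) : Finset (Idx n k) :=
  {i | s.Good β PY s.S (j, i) ∧ s.Good β PZ s.T (j, i)}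

/-- The compound MAC `{PY, PZ}` over `𝔽_q` has, for the target pair `I` in the region `K` and the
parameters `ε`, `β`, a scheme of block length `N = 2 ^ n ≥ 2 ^ n₀` with the required
rates and polarization. Writing `Rˢ`, `Rᵗ` for the rate pairs of `S^{2M}`, `T^{2M}`:
`min {Rˢ_j, Rᵗ_j} > I_j - ε`, and `|min {Rˢ_j, Rᵗ_j} - I_j| < ε` if `I` is a maximal point of `K`;
the fraction of common good symbols, times `log₂ q`, exceeds `min {Rˢ_j, Rᵗ_j} - ε`. -/
def HasAlignedScheme {q : ℕ} [NeZero q] {Y Z : Type*} [Fintype Y] [Fintype Z]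
    (PY : ZMod q → ZMod q → PMF Y) (PZ : ZMod q → ZMod q → PMF Z)
    (K : Set (Fin 2 → ℝ)) (I : Fin 2 → ℝ) (ε β : ℝ) (n₀ : ℕ) : Prop :=
  ∃ (n k : ℕ) (s : Scheme q n k), n₀ ≤ n ∧ IsAligned PY PZ β n s ∧
    IsMonotone s.S ∧ IsMonotone s.T ∧
    ∀ j : Fin 2,
      I j - ε < min (s.rate PY s.S j) (s.rate PZ s.T j) ∧
      (Maximal (· ∈ K) I → |min (s.rate PY s.S j) (s.rate PZ s.T j) - I j| < ε) ∧
      min (s.rate PY s.S j) (s.rate PZ s.T j) - ε <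
        ((s.commonGood β PY PZ j).card : ℝ) / (2 ^ k * 2 ^ n) * Real.logb 2 q

/-! ## Polar codes -/

/-- `dec` is a successive cancellation decoder for the MAC `P` along `S`: symbols outside the
information sets `A` are set to the frozen values `f`, and an information symbol `v` is set to a
maximizer of the likelihood of the output and of the previously decided symbols. -/
def IsSCDecoder {q n k : ℕ} [NeZero q] {Y : Type*} [Fintype Y] (s : Scheme q n k)
    (P : ZMod q → ZMod q → PMF Y) (S : Perm n k) (A : Fin 2 → Finset (Idx n k))
    (f : Var n k → ZMod q) (dec : (Idx n k → Y) → Var n k → ZMod q) : Prop :=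
  ∀ (y : Idx n k → Y) (v : Var n k),
    (v.2 ∉ A v.1 → dec y v = f v) ∧
    (v.2 ∈ A v.1 → ∀ a : ZMod q,
      (blockLaw n k P).toOuterMeasure
        {ω | ω.2 = y ∧ (∀ w, S w < S v → s.symbol w ω.1 = dec y w) ∧ s.symbol v ω.1 = a} ≤
      (blockLaw n k P).toOuterMeasure
        {ω | ω.2 = y ∧ (∀ w, S w < S v → s.symbol w ω.1 = dec y w) ∧
          s.symbol v ω.1 = dec y v})

/-- Encoding: `enc j d` is the input word whose transform carries the message `d` on the
information set `A j` and the frozen values elsewhere. -/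
def IsEncoder {q n k : ℕ} (s : Scheme q n k) (A : Fin 2 → Finset (Idx n k))
    (f : Var n k → ZMod q) (enc : (j : Fin 2) → (A j → ZMod q) → Idx n k → ZMod q) : Prop :=
  ∀ (j : Fin 2) (d : A j → ZMod q),
    (∀ i : A j, s.transform j (enc j d) i = d i) ∧
    (∀ i, i ∉ A j → s.transform j (enc j d) i = f (j, i))

/-- Average probability, over independent uniform messages, that some message symbol is decoded
wrongly over the MAC `P`, when `x(x'_t, τ_t)`, `w(w'_t, τ_t)` are sent and the receiver
decodes from the received word and the time-sharing sequence `τ`. -/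
def errorProb {q n k m : ℕ} [NeZero q] {X W Y : Type*} [Fintype Y] (P : X → W → PMF Y)
    (fx : ZMod q → Fin m → X) (fw : ZMod q → Fin m → W) (τ : Idx n k → Fin m)
    (A : Fin 2 → Finset (Idx n k)) (enc : (j : Fin 2) → (A j → ZMod q) → Idx n k → ZMod q)
    (dec : (Idx n k → Y × Fin m) → Var n k → ZMod q) : ℝ≥0∞ :=
  ((PMF.uniformOfFintype ((j : Fin 2) → A j → ZMod q)).bind fun d =>
      (piPMF fun t => P (fx (enc 0 (d 0) t) (τ t)) (fw (enc 1 (d 1) t) (τ t))).map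
        fun y => (d, y)).toOuterMeasure
    {ω | ∃ (j : Fin 2) (i : A j), dec (fun t => (ω.2 t, τ t)) (j, i) ≠ ω.1 j i}

/-- `R` is achievable on the compound MAC `{PY, PZ}` by polar codes: there are polar codes of
arbitrarily large length, with rates (in bits per channel use) arbitrarily close to `R` and
arbitrarily small error probability on both MACs. A polar code consists of a prime `q`, a law
`pQ` and symbol maps (which induce two MACs over `𝔽_q`), a scheme aligned for these MACs,
information sets of symbols that are good for both receivers, frozen symbols, a time-sharing
sequence known to all, and successive cancellation decoders along `S^{2M}` and `T^{2M}`. -/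
def PolarAchievable {X W Y Z : Type*} [Fintype Y] [Fintype Z]
    (PY : X → W → PMF Y) (PZ : X → W → PMF Z) (β : ℝ) (R : Fin 2 → ℝ) : Prop :=
  ∀ δ > (0 : ℝ), ∀ n₀ : ℕ,
    ∃ (m : ℕ) (pQ : PMF (Fin m)) (q : ℕ) (_ : Fact q.Prime)
      (fx : ZMod q → Fin m → X) (fw : ZMod q → Fin m → W)
      (n k : ℕ) (s : Scheme q n k) (A : Fin 2 → Finset (Idx n k)) (f : Var n k → ZMod q)
      (τ : Idx n k → Fin m) (enc : (j : Fin 2) → (A j → ZMod q) → Idx n k → ZMod q)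
      (decY : (Idx n k → Y × Fin m) → Var n k → ZMod q)
      (decZ : (Idx n k → Z × Fin m) → Var n k → ZMod q),
      n₀ ≤ n ∧
      IsAligned (inducedMAC pQ fx fw PY) (inducedMAC pQ fx fw PZ) β n s ∧
      (∀ j, A j ⊆ s.commonGood β (inducedMAC pQ fx fw PY) (inducedMAC pQ fx fw PZ) j) ∧
      IsEncoder s A f enc ∧
      IsSCDecoder s (inducedMAC pQ fx fw PY) s.S A f decY ∧
      IsSCDecoder s (inducedMAC pQ fx fw PZ) s.T A f decZ ∧
      (∀ j, |((A j).card : ℝ) / (2 ^ k * 2 ^ n) * Real.logb 2 q - R j| < δ) ∧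
      errorProb PY fx fw τ A enc decY ≤ ENNReal.ofReal δ ∧
      errorProb PZ fx fw τ A enc decZ ≤ ENNReal.ofReal δ

end

end CompoundMAC

open CompoundMAC

/-!
Conditional entropies are computed in nats, as sums over the values of the side information of the
functional `cent` on vectors indexed by `𝔽_q`; `famEnt p` is the conditional entropy of a symbol
whose joint law with its side information is `p`. Since the transformed symbols are uniform and
independent, a symbol is good when its conditional entropy is below the threshold times `log q`, and
bad when it is that close to `log q`.

*Splits.* For a decoding order `(Uⁱ, V, U_{i+1}, …)`, doubling the block length together with the
split point applies the usual minus and plus steps to every symbol (`mergeData_split`). The mean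
entropy of each sender is therefore the same at all block lengths. At a large enough length the
possible split points give a fine subdivision of the dominant face of the pentagon, because moving
the split by one position changes only the position of one symbol of the first sender, and the total
is fixed by the chain rule (`exists_split_approx`).

*Polarization.* A symbol whose entropy hardly grows under the minus step is nearly determined or
nearly uniform (`exists_gain_dichotomy`): the gain bounds Hellinger distances between translates of
the law, so that for each translation the overlap is close to 0 or to 1, and a law that is nearly
invariant under one nonzero translation is nearly uniform because `q` is prime. The bounded
martingale of entropies has a small increment at some level. From there the Bhattacharyya parameter,
or dually the distance from uniform, is squared by one of the steps and multiplied by at most a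
constant by the other, which yields the speed `2 ^ (-N ^ β)` for `β < 1 / 2`
(`exists_polarization`).

*Alignment.* Two independent copies with `u_c` replaced by `u_c + e_d`, which is decoded directly
before `e_d`, undergo one minus and plus step for each pair, and unpaired symbols keep their
entropies exactly (`MergeData`). When `c` is good for `Y` only and `d` good for `Z` only,
`u_c + e_d` is bad for both receivers and `e_d` good for both (`EntMerge.commonGood_le`). The symbols
like `c` in the second copy and those like `d` in the first are untouched, so that alignment can be
repeated; after `r` repetitions a fraction `2 ^ (-r)` of the possible pairs is unaligned
(`exists_aligns`). The number `r` does not depend on the block length. The receivers must share the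
order of the symbols that are paired. In a split the symbols of the second sender are contiguous,
hence aligning them preserves the common order of the symbols of the first sender
(`sameOrder_merged_of_contiguous`), which can be aligned afterwards (`exists_aligned_of_split`).

*Rates.* Each receiver is given the split for a point of the dominant face of its own pentagon above
the required point. The minimum of the two points is at least the required one, with equality if
that is maximal (`min_facePoint_eq_of_maximal`). After alignment, the common good symbols of each
sender realise this minimum (`exists_aligned_scheme`, `exists_scheme_of_close`). Input laws that are
not uniform are approximated by images of the uniform law on a large prime field, whose pentagons are
close by continuity (`exists_induced_approx`).

*Decoding.* The error probability of guessing a most likely symbol is at most its conditional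
entropy. By the union bound successive cancellation fails with probability at most the sum of the
entropies of the information symbols, on average over uniform frozen values and over time-sharing
sequences (`sum_scDecoder_error_le`, `sum_wordError`), so that some choice of these is good for both
receivers (`exists_frozen_errorProb_le`).
-/

set_option linter.unusedSectionVars false

namespace CompoundMAC

noncomputable section

/-! ### Entropy, Bhattacharyya and deviation functionals of a vector on `𝔽_q` -/

open Real in
/-- A pointwise lower bound of divergence by squared Hellinger distance, up to the terms that cancel
in sums over laws of equal mass. -/
lemma two_mul_sub_sqrt_le_mul_log_sub_log {t s : ℝ} (ht : 0 ≤ t) (hs : 0 ≤ s) (h : s = 0 → t = 0) :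
    2 * t - 2 * √(t * s) ≤ t * (log t - log s) := by
  rcases ht.eq_or_lt with rfl | ht'
  · simp
  have hs' : 0 < s := lt_of_le_of_ne hs fun h0 => ht'.ne' (h h0.symm)
  have h1 : log (√(s / t)) ≤ √(s / t) - 1 := log_le_sub_one_of_pos (sqrt_pos.2 (by positivity))
  rw [log_sqrt (by positivity), log_div hs'.ne' ht'.ne'] at h1
  have h2 : √(t * s) = t * √(s / t) := by
    rw [show t * s = t ^ 2 * (s / t) by field_simp, sqrt_mul (by positivity), sqrt_sq ht]
  rw [h2]
  nlinarith

open Real in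
lemma sub_le_mul_log_sub_log {t s : ℝ} (ht : 0 ≤ t) (hs : 0 ≤ s) (h : s = 0 → t = 0) :
    t - s ≤ t * (log t - log s) := by
  refine le_trans ?_ (two_mul_sub_sqrt_le_mul_log_sub_log ht hs h)
  rw [sqrt_mul ht]
  nlinarith [sq_nonneg (√t - √s), sq_sqrt ht, sq_sqrt hs]

variable {q : ℕ} [NeZero q]

/-- The total mass of a vector. -/
def tot (p : ZMod q → ℝ) : ℝ := ∑ x, p x

/-- The entropy functional `∑ p_x log (|p| / p_x)` in nats, homogeneous of degree one: summed over
the values of the side information, it gives a conditional entropy. -/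
def cent (p : ZMod q → ℝ) : ℝ := ∑ x, Real.negMulLog (p x) - Real.negMulLog (tot p)

/-- The Bhattacharyya coefficient of a vector and its translate by `d`. -/
def bhat (d : ZMod q) (p : ZMod q → ℝ) : ℝ := ∑ x, √(p x * p (x + d))

/-- The `ℓ¹` distance of a vector from the constant vector of the same mass. -/
def dev (p : ZMod q → ℝ) : ℝ := ∑ x, |p x - tot p / q|

/-- The law of a sum of independent variables with laws `p` and `r`. -/
def conv (p r : ZMod q → ℝ) (z : ZMod q) : ℝ := ∑ x, p (z - x) * r x

/-- For independent `X₁ ∼ p`, `X₂ ∼ r`: the law of `X₂` on the event `X₁ + X₂ = u`. -/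
def fiber (p r : ZMod q → ℝ) (u x : ZMod q) : ℝ := p (u - x) * r x

lemma tot_nonneg {p : ZMod q → ℝ} (hp : ∀ x, 0 ≤ p x) : 0 ≤ tot p :=
  Finset.sum_nonneg fun x _ => hp x

lemma le_tot {p : ZMod q → ℝ} (hp : ∀ x, 0 ≤ p x) (x : ZMod q) : p x ≤ tot p :=
  Finset.single_le_sum (fun y _ => hp y) (Finset.mem_univ x)

lemma eq_zero_of_tot_eq_zero {p : ZMod q → ℝ} (hp : ∀ x, 0 ≤ p x) (h : tot p = 0) (x : ZMod q) :
    p x = 0 := le_antisymm (h ▸ le_tot hp x) (hp x)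

lemma conv_nonneg {p r : ZMod q → ℝ} (hp : ∀ x, 0 ≤ p x) (hr : ∀ x, 0 ≤ r x) (z : ZMod q) :
    0 ≤ conv p r z := Finset.sum_nonneg fun x _ => mul_nonneg (hp _) (hr x)

lemma sum_sub_right (f : ZMod q → ℝ) (a : ZMod q) : ∑ z, f (z - a) = ∑ z, f z :=
  Equiv.sum_comp (Equiv.subRight a) f

lemma sum_add_right' (f : ZMod q → ℝ) (a : ZMod q) : ∑ z, f (z + a) = ∑ z, f z :=
  Equiv.sum_comp (Equiv.addRight a) f

lemma conv_comm (p r : ZMod q → ℝ) : conv p r = conv r p := by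
  ext z
  unfold conv
  rw [← Equiv.sum_comp (Equiv.subLeft z)]
  simp [mul_comm]

lemma tot_fiber (p r : ZMod q → ℝ) (u : ZMod q) : tot (fiber p r u) = conv p r u := rfl

lemma sum_fiber_eq {f : ℝ → ℝ → ℝ} (p r : ZMod q → ℝ) :
    ∑ u, ∑ x, f (p (u - x)) (r x) = ∑ y, ∑ x, f (p y) (r x) := by
  rw [Finset.sum_comm]
  rw [Finset.sum_comm (s := (Finset.univ : Finset (ZMod q)))]
  rw [Finset.sum_comm]
  conv_rhs => rw [Finset.sum_comm]
  exact Finset.sum_congr rfl fun x _ => sum_sub_right (fun y => f (p y) (r x)) x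

lemma tot_conv (p r : ZMod q → ℝ) : tot (conv p r) = tot p * tot r := by
  unfold tot conv
  rw [sum_fiber_eq (f := fun a b => a * b), Finset.sum_mul_sum]

lemma cent_eq (p : ZMod q → ℝ) :
    cent p = ∑ x, p x * (Real.log (tot p) - Real.log (p x)) := by
  simp only [cent, Real.negMulLog, mul_sub, Finset.sum_sub_distrib, ← Finset.sum_mul]
  rw [show ∑ x, p x = tot p from rfl]
  simp only [neg_mul, Finset.sum_neg_distrib]
  ring

lemma cent_smul (c : ℝ) (p : ZMod q → ℝ) : cent (fun x => c * p x) = c * cent p := by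
  have : tot (fun x => c * p x) = c * tot p := (Finset.mul_sum _ _ _).symm
  simp only [cent, this, Real.negMulLog_mul, Finset.sum_add_distrib, ← Finset.mul_sum,
    ← Finset.sum_mul]
  rw [show ∑ x, p x = tot p from rfl]
  ring

lemma cent_nonneg {p : ZMod q → ℝ} (hp : ∀ x, 0 ≤ p x) : 0 ≤ cent p := by
  rw [cent_eq]
  refine Finset.sum_nonneg fun x _ => ?_
  rcases (hp x).eq_or_lt with h | h
  · simp [← h]
  · exact mul_nonneg (hp x) (sub_nonneg.2 (Real.log_le_log h (le_tot hp x)))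

lemma cent_const (t : ℝ) : cent (fun _ : ZMod q => t) = q * t * Real.log q := by
  have h : tot (fun _ : ZMod q => t) = q * t := by simp [tot]
  rw [cent, h, Real.negMulLog_mul]
  simp [Real.negMulLog]
  ring

/-- Conditioning reduces entropy. -/
lemma sum_cent_le {B : Type*} [Fintype B] {p : B → ZMod q → ℝ} (hp : ∀ b x, 0 ≤ p b x) :
    ∑ b, cent (p b) ≤ cent (fun x => ∑ b, p b x) := by
  set P : ZMod q → ℝ := fun x => ∑ b, p b x with hP
  have hP0 : ∀ x, 0 ≤ P x := fun x => Finset.sum_nonneg fun b _ => hp b x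
  have hle : ∀ b x, p b x ≤ P x := fun b x =>
    Finset.single_le_sum (f := fun b => p b x) (fun b _ => hp b x) (Finset.mem_univ b)
  have htot : ∑ b, tot (p b) = tot P := Finset.sum_comm
  have key : ∀ b, cent (p b) ≤ ∑ x, p b x * (Real.log (tot P) - Real.log (P x)) := by
    intro b
    rw [cent_eq]
    have h1 : ∀ x, p b x - tot (p b) * (P x / tot P) ≤
        p b x * (Real.log (tot P) - Real.log (P x)) -
          p b x * (Real.log (tot (p b)) - Real.log (p b x)) := by
      intro x
      rcases (hp b x).eq_or_lt with h | h
      · rw [← h]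
        have : 0 ≤ tot (p b) * (P x / tot P) :=
          mul_nonneg (tot_nonneg (hp b)) (div_nonneg (hP0 x) (tot_nonneg hP0))
        simpa using this
      · have a1 : 0 < tot (p b) := h.trans_le (le_tot (hp b) x)
        have a2 : 0 < P x := h.trans_le (hle b x)
        have a3 : 0 < tot P := a2.trans_le (le_tot hP0 x)
        refine (sub_le_mul_log_sub_log (s := tot (p b) * (P x / tot P)) h.le
          (by positivity) fun h0 => absurd h0 (by positivity)).trans_eq ?_
        rw [Real.log_mul a1.ne' (by positivity), Real.log_div a2.ne' a3.ne']
        ring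
    have h2 : ∑ x, (p b x - tot (p b) * (P x / tot P)) = 0 := by
      rw [Finset.sum_sub_distrib, ← Finset.mul_sum, ← Finset.sum_div]
      rw [show ∑ x, p b x = tot (p b) from rfl, show ∑ x, P x = tot P from rfl]
      by_cases h0 : tot P = 0
      · have : tot (p b) = 0 := le_antisymm
          (by rw [← h0, ← htot]; exact Finset.single_le_sum (f := fun b => tot (p b))
                (fun b _ => tot_nonneg (hp b)) (Finset.mem_univ b)) (tot_nonneg (hp b))
        simp [this]
      · field_simp; ring
    have h3 := Finset.sum_le_sum fun x (_ : x ∈ Finset.univ) => h1 x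
    rw [h2, Finset.sum_sub_distrib] at h3
    linarith
  refine (Finset.sum_le_sum fun b _ => key b).trans_eq ?_
  rw [Finset.sum_comm, cent_eq]
  simp only [← Finset.sum_mul]
  rfl

lemma cent_le_tot_mul_log {p : ZMod q → ℝ} (hp : ∀ x, 0 ≤ p x) :
    cent p ≤ tot p * Real.log q := by
  have h := sum_cent_le (B := ZMod q) (p := fun b x => p (x + b)) fun b x => hp _
  have h1 : ∀ b : ZMod q, cent (fun x => p (x + b)) = cent p := fun b => by
    simp only [cent, tot]
    rw [sum_add_right' (fun x => Real.negMulLog (p x)), sum_add_right' p]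
  have h2 : (fun x : ZMod q => ∑ b, p (x + b)) = fun _ => tot p := by
    ext x
    exact Equiv.sum_comp (Equiv.addLeft x) p
  rw [h2, cent_const] at h
  simp only [h1, Finset.sum_const, Finset.card_univ, ZMod.card, nsmul_eq_mul] at h
  have hq : (0 : ℝ) < q := by exact_mod_cast NeZero.pos q
  nlinarith

/-- The error probability of guessing a most likely value is at most the entropy. -/
lemma tot_sub_le_cent {p : ZMod q → ℝ} (hp : ∀ x, 0 ≤ p x) {a : ZMod q} (ha : ∀ x, p x ≤ p a) :
    tot p - p a ≤ cent p := by
  rw [cent_eq]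
  rcases (tot_nonneg hp).eq_or_lt with h | h
  · rw [← h]
    simp [eq_zero_of_tot_eq_zero hp h.symm]
  have h1 : ∀ x, p x - p x * (p a / tot p) ≤ p x * (Real.log (tot p) - Real.log (p x)) := by
    intro x
    rcases (hp x).eq_or_lt with h0 | h0
    · simp [← h0]
    have h2 := Real.one_sub_inv_le_log_of_pos (x := tot p / p x) (by positivity)
    rw [Real.log_div h.ne' h0.ne', inv_div] at h2
    have h3 : p x / tot p ≤ p a / tot p := by gcongr; exact ha x
    nlinarith
  refine le_trans (le_of_eq ?_) (Finset.sum_le_sum fun x _ => h1 x)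
  rw [Finset.sum_sub_distrib, ← Finset.sum_mul]
  rw [show ∑ x, p x = tot p from rfl]
  field_simp

lemma bhat_nonneg (d : ZMod q) (p : ZMod q → ℝ) : 0 ≤ bhat d p :=
  Finset.sum_nonneg fun _ _ => Real.sqrt_nonneg _

lemma bhat_zero {p : ZMod q → ℝ} (hp : ∀ x, 0 ≤ p x) : bhat 0 p = tot p := by
  simp [bhat, tot, Real.sqrt_mul_self (hp _)]

lemma sum_bhat {p : ZMod q → ℝ} (hp : ∀ x, 0 ≤ p x) : ∑ d, bhat d p = (∑ x, √(p x)) ^ 2 := by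
  simp only [bhat, Real.sqrt_mul (hp _)]
  rw [Finset.sum_comm, sq, Finset.sum_mul_sum]
  refine Finset.sum_congr rfl fun x _ => ?_
  exact Equiv.sum_comp (Equiv.addLeft x) fun y => √(p x) * √(p y)

lemma bhat_neg (d : ZMod q) (p : ZMod q → ℝ) : bhat (-d) p = bhat d p := by
  unfold bhat
  rw [← sum_add_right' _ d]
  simp [mul_comm]

lemma sum_sq_sqrt_sub {p : ZMod q → ℝ} (hp : ∀ x, 0 ≤ p x) (d : ZMod q) :
    ∑ x, (√(p x) - √(p (x + d))) ^ 2 = 2 * (tot p - bhat d p) := by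
  simp only [sub_sq, Real.sq_sqrt (hp _), Finset.sum_add_distrib, Finset.sum_sub_distrib]
  rw [sum_add_right' p d]
  simp only [bhat, Real.sqrt_mul (hp _), tot, mul_assoc, ← Finset.mul_sum]
  ring

lemma bhat_le_tot {p : ZMod q → ℝ} (hp : ∀ x, 0 ≤ p x) (d : ZMod q) : bhat d p ≤ tot p := by
  have h := sum_sq_sqrt_sub hp d
  have : 0 ≤ ∑ x, (√(p x) - √(p (x + d))) ^ 2 := Finset.sum_nonneg fun _ _ => sq_nonneg _
  linarith

/-- Small overlaps of all translates mean that the symbol is nearly determined. -/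
lemma cent_le_sum_bhat {p : ZMod q → ℝ} (hp : ∀ x, 0 ≤ p x) :
    cent p ≤ ∑ d ∈ Finset.univ.erase 0, bhat d p := by
  have h0 : ∑ d ∈ Finset.univ.erase 0, bhat d p = (∑ x, √(p x)) ^ 2 - tot p := by
    rw [← sum_bhat hp, ← Finset.add_sum_erase _ _ (Finset.mem_univ (0 : ZMod q)), bhat_zero hp]
    ring
  rw [h0, cent_eq]
  have h1 : ∀ x, p x * (Real.log (tot p) - Real.log (p x)) ≤
      2 * √(tot p) * √(p x) - 2 * p x := by
    intro x
    have := two_mul_sub_sqrt_le_mul_log_sub_log (hp x) (tot_nonneg hp)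
      fun h => eq_zero_of_tot_eq_zero hp h x
    rw [mul_comm (p x) (tot p), Real.sqrt_mul (tot_nonneg hp)] at this
    linarith
  refine (Finset.sum_le_sum fun x _ => h1 x).trans ?_
  rw [Finset.sum_sub_distrib, ← Finset.mul_sum, ← Finset.mul_sum]
  rw [show ∑ x, p x = tot p from rfl]
  nlinarith [sq_nonneg (√(tot p) - ∑ x, √(p x)), Real.sq_sqrt (tot_nonneg hp)]

/-- Closeness to the constant vector means that the entropy is nearly maximal. -/
lemma tot_mul_log_sub_cent_le {p : ZMod q → ℝ} (hp : ∀ x, 0 ≤ p x) :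
    tot p * Real.log q - cent p ≤ q * dev p := by
  have hq : (0 : ℝ) < q := by exact_mod_cast NeZero.pos q
  rw [cent_eq]
  rcases (tot_nonneg hp).eq_or_lt with h | h
  · simp [eq_zero_of_tot_eq_zero hp h.symm, tot, dev]
  have h1 : ∀ x, p x * Real.log q - p x * (Real.log (tot p) - Real.log (p x)) ≤
      q * |p x - tot p / q| := by
    intro x
    rcases (hp x).eq_or_lt with h0 | h0
    · rw [← h0]; simp; positivity
    have h2 := Real.log_le_sub_one_of_pos (x := q * p x / tot p) (by positivity)
    rw [Real.log_div (by positivity) h.ne', Real.log_mul hq.ne' h0.ne'] at h2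
    have h3 : q * p x / tot p - 1 = q / tot p * (p x - tot p / q) := by field_simp
    have h4 : p x * (q / tot p * (p x - tot p / q)) ≤ q * |p x - tot p / q| := by
      have h5 : p x * (q / tot p) ≤ q := by
        rw [mul_div_assoc', div_le_iff₀ h, mul_comm]
        exact mul_le_mul_of_nonneg_left (le_tot hp x) hq.le
      calc p x * (q / tot p * (p x - tot p / q)) = p x * (q / tot p) * (p x - tot p / q) := by ring
        _ ≤ p x * (q / tot p) * |p x - tot p / q| := by gcongr; exact le_abs_self _
        _ ≤ q * |p x - tot p / q| := by gcongr
    nlinarith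
  have h2 := Finset.sum_le_sum fun x (_ : x ∈ Finset.univ) => h1 x
  rw [Finset.sum_sub_distrib, ← Finset.sum_mul, ← Finset.mul_sum] at h2
  exact h2

lemma dev_nonneg (p : ZMod q → ℝ) : 0 ≤ dev p := Finset.sum_nonneg fun _ _ => abs_nonneg _

lemma dev_le_two_mul_tot {p : ZMod q → ℝ} (hp : ∀ x, 0 ≤ p x) : dev p ≤ 2 * tot p := by
  have hq : (0 : ℝ) < q := by exact_mod_cast NeZero.pos q
  have h : ∀ x, |p x - tot p / q| ≤ p x + tot p / q := fun x => by
    have := div_nonneg (tot_nonneg hp) hq.le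
    rw [abs_le]; constructor <;> linarith [hp x]
  refine (Finset.sum_le_sum fun x _ => h x).trans_eq ?_
  rw [Finset.sum_add_distrib]
  simp only [Finset.sum_const, Finset.card_univ, ZMod.card, nsmul_eq_mul, tot]
  field_simp; ring

/-- Convolution with a law close to uniform, of a law close to uniform, squares the distance. -/
lemma dev_conv_le (p r : ZMod q → ℝ) : dev (conv p r) ≤ dev p * dev r := by
  have hq : (0 : ℝ) < q := by exact_mod_cast NeZero.pos q
  have h : ∀ z, conv p r z - tot (conv p r) / q =
      ∑ x, (p (z - x) - tot p / q) * (r x - tot r / q) := by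
    intro z
    have e1 : ∑ x, p (z - x) = tot p := Equiv.sum_comp (Equiv.subLeft z) p
    have e2 : ∑ x, r x = tot r := rfl
    simp only [sub_mul, mul_sub, Finset.sum_sub_distrib, ← Finset.mul_sum, ← Finset.sum_mul, e1, e2]
    simp only [Finset.sum_const, Finset.card_univ, ZMod.card, nsmul_eq_mul, tot_conv, conv]
    field_simp; ring
  unfold dev
  simp only [h]
  refine (Finset.sum_le_sum fun z _ => Finset.abs_sum_le_sum_abs _ _).trans_eq ?_
  simp only [abs_mul]
  rw [Finset.sum_mul_sum]
  exact sum_fiber_eq (f := fun a b => |a - tot p / q| * |b - tot r / q|) p r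

/-- Revealing the sum loses at most a constant factor in the distance from uniform. -/
lemma sum_dev_fiber_le {p r : ZMod q → ℝ} (hp : ∀ x, 0 ≤ p x) (hr : ∀ x, 0 ≤ r x) :
    ∑ u, dev (fiber p r u) ≤ 3 * dev p * tot r + tot p * dev r := by
  have hq : (0 : ℝ) < q := by exact_mod_cast NeZero.pos q
  set c := tot p * tot r / q ^ 2 with hc
  have h1 : ∀ u x, |fiber p r u x - tot (fiber p r u) / q| ≤
      (|p (u - x) - tot p / q| * r x + tot p / q * |r x - tot r / q|) +
        |conv p r u - tot (conv p r) / q| / q := by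
    intro u x
    have e : fiber p r u x - tot (fiber p r u) / q =
        (p (u - x) - tot p / q) * r x + tot p / q * (r x - tot r / q) +
          -((conv p r u - tot (conv p r) / q) / q) := by
      rw [tot_fiber, tot_conv, fiber]; field_simp; ring
    rw [e]
    refine (abs_add_le _ _).trans (add_le_add ((abs_add_le _ _).trans (le_of_eq ?_)) (le_of_eq ?_))
    · rw [abs_mul, abs_mul, abs_of_nonneg (hr x), abs_of_nonneg (div_nonneg (tot_nonneg hp) hq.le)]
    · rw [abs_neg, abs_div, abs_of_pos hq]
  have h2 : ∑ u, dev (fiber p r u) ≤ dev p * tot r + tot p * dev r + dev (conv p r) := by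
    refine (Finset.sum_le_sum fun u _ => Finset.sum_le_sum fun x _ => h1 u x).trans_eq ?_
    simp only [Finset.sum_add_distrib]
    rw [sum_fiber_eq (f := fun a b => |a - tot p / q| * b), ← Finset.sum_mul_sum]
    simp only [Finset.sum_const, Finset.card_univ, ZMod.card, nsmul_eq_mul, ← Finset.mul_sum]
    rw [← mul_assoc, ← Finset.sum_div]
    change dev p * tot r + q * (tot p / q) * dev r + q * (dev (conv p r) / q) = _
    field_simp
  have h3 := dev_conv_le p r
  have h4 := mul_le_mul_of_nonneg_left (dev_le_two_mul_tot hr) (dev_nonneg p)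
  linarith

lemma sum_bhat_fiber {p : ZMod q → ℝ} (hp : ∀ x, 0 ≤ p x) (r : ZMod q → ℝ) (d : ZMod q) :
    ∑ u, bhat d (fiber p r u) = bhat d p * bhat d r := by
  rw [← bhat_neg d p]
  unfold bhat fiber
  have h : ∀ u x : ZMod q, √(p (u - x) * r x * (p (u - (x + d)) * r (x + d))) =
      √(p (u - x) * p (u - x + -d)) * √(r x * r (x + d)) := by
    intro u x
    rw [← Real.sqrt_mul (mul_nonneg (hp _) (hp _))]
    congr 1
    rw [show u - (x + d) = u - x + -d by ring]; ring
  simp only [h]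
  rw [Finset.sum_mul_sum, Finset.sum_comm]
  conv_rhs => rw [Finset.sum_comm]
  exact Finset.sum_congr rfl fun x _ => by
    rw [← Finset.sum_mul, ← Finset.sum_mul,
      sum_sub_right (fun y => √(p y * p (y + -d))) x]

lemma sqrt_sum_le_sum_sqrt {ι : Type*} (s : Finset ι) {f : ι → ℝ} (hf : ∀ i, 0 ≤ f i) :
    √(∑ i ∈ s, f i) ≤ ∑ i ∈ s, √(f i) := by
  refine Real.sqrt_le_iff.2 ⟨Finset.sum_nonneg fun _ _ => Real.sqrt_nonneg _, ?_⟩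
  refine le_trans (le_of_eq ?_) (Finset.sum_sq_le_sq_sum_of_nonneg fun i _ => Real.sqrt_nonneg (f i))
  exact Finset.sum_congr rfl fun i _ => (Real.sq_sqrt (hf i)).symm

/-- Translating a sum by `d` splits as translations of the summands by `d - e` and `e`. -/
lemma bhat_conv_le {p r : ZMod q → ℝ} (hp : ∀ x, 0 ≤ p x) (hr : ∀ x, 0 ≤ r x) (d : ZMod q) :
    bhat d (conv p r) ≤ ∑ e, bhat (d - e) p * bhat e r := by
  have h1 : ∀ z, √(conv p r z * conv p r (z + d)) ≤
      ∑ x, ∑ e, √(p (z - x) * p (z - x + (d - e))) * √(r x * r (x + e)) := by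
    intro z
    unfold conv
    rw [Finset.sum_mul_sum]
    refine (sqrt_sum_le_sum_sqrt _ fun x => Finset.sum_nonneg fun y _ => ?_).trans
      (Finset.sum_le_sum fun x _ => (sqrt_sum_le_sum_sqrt _ fun y => ?_).trans (le_of_eq ?_))
    · exact mul_nonneg (mul_nonneg (hp _) (hr _)) (mul_nonneg (hp _) (hr _))
    · exact mul_nonneg (mul_nonneg (hp _) (hr _)) (mul_nonneg (hp _) (hr _))
    · rw [← Equiv.sum_comp (Equiv.addLeft x)]
      refine Finset.sum_congr rfl fun e _ => ?_
      rw [← Real.sqrt_mul (mul_nonneg (hp _) (hp _))]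
      congr 1
      simp only [Equiv.coe_addLeft]
      rw [show z + d - (x + e) = z - x + (d - e) by ring]; ring
  refine (Finset.sum_le_sum fun z _ => h1 z).trans_eq ?_
  rw [Finset.sum_comm]
  conv_lhs => enter [2, x]; rw [Finset.sum_comm]
  rw [Finset.sum_comm]
  refine Finset.sum_congr rfl fun e _ => ?_
  simp only [← Finset.sum_mul]
  unfold bhat
  rw [Finset.mul_sum]
  exact Finset.sum_congr rfl fun x _ => by
    rw [sum_sub_right (fun y => √(p y * p (y + (d - e)))) x]

/-- The chain rule for `(X₁, X₂) ↦ (X₁ + X₂, X₂)`. -/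
lemma cent_conv_add_sum_cent_fiber (p r : ZMod q → ℝ) :
    cent (conv p r) + ∑ u, cent (fiber p r u) = tot r * cent p + tot p * cent r := by
  simp only [cent, Finset.sum_sub_distrib, tot_fiber, tot_conv]
  have h := sum_fiber_eq (f := fun a b => Real.negMulLog (a * b)) p r
  have e : ∑ u, ∑ x, Real.negMulLog (fiber p r u x) =
      ∑ y, ∑ x, Real.negMulLog (p y * r x) := h
  rw [e]
  simp only [Real.negMulLog_mul, Finset.sum_add_distrib, ← Finset.sum_mul, ← Finset.mul_sum]
  change _ - (tot r * Real.negMulLog (tot p) + tot p * Real.negMulLog (tot r)) +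
    (tot r * _ + tot p * _ - _) = _
  ring

/-- The entropy gained by adding an independent variable, in terms of Hellinger distances between
the translates of `p` that are mixed. -/
lemma sum_sq_le_cent_conv_sub {p r : ZMod q → ℝ} (hp : ∀ x, 0 ≤ p x) (hr : ∀ x, 0 ≤ r x) :
    ∑ x, r x * ∑ z, (√(p (z - x)) - √(conv p r z / tot r)) ^ 2 ≤
      cent (conv p r) - tot r * cent p := by
  rcases (tot_nonneg hr).eq_or_lt with h | h
  · have h0 := eq_zero_of_tot_eq_zero hr h.symm
    have h1 : conv p r = fun _ => 0 := by ext z; simp [conv, h0]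
    simp [h0, h1, cent, tot]
  have hs : ∀ z, 0 ≤ conv p r z / tot r := fun z => div_nonneg (conv_nonneg hp hr z) h.le
  -- the divergence of each translate from the mixture
  have h1 : ∀ x z, r x * (√(p (z - x)) - √(conv p r z / tot r)) ^ 2 ≤
      r x * (p (z - x) * (Real.log (p (z - x)) - Real.log (conv p r z) + Real.log (tot r))) +
        r x * (conv p r z / tot r - p (z - x)) := by
    intro x z
    rcases (hr x).eq_or_lt with h0 | h0
    · simp [← h0]
    rw [← mul_add]
    refine mul_le_mul_of_nonneg_left ?_ h0.le
    rcases (hp (z - x)).eq_or_lt with h2 | h2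
    · rw [← h2]
      simp [Real.sq_sqrt (hs z)]
    have h3 : 0 < conv p r z := lt_of_lt_of_le (mul_pos h2 h0)
      (Finset.single_le_sum (f := fun x => p (z - x) * r x)
        (fun y _ => mul_nonneg (hp _) (hr _)) (Finset.mem_univ x))
    have h4 := two_mul_sub_sqrt_le_mul_log_sub_log (s := conv p r z / tot r) h2.le (hs z)
      fun h0 => absurd h0 (by positivity)
    rw [Real.log_div h3.ne' h.ne', Real.sqrt_mul h2.le] at h4
    rw [sub_sq, Real.sq_sqrt h2.le, Real.sq_sqrt (hs z)]
    linarith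
  simp only [Finset.mul_sum]
  refine (Finset.sum_le_sum fun x _ => Finset.sum_le_sum fun z _ => h1 x z).trans (le_of_eq ?_)
  simp only [Finset.sum_add_distrib]
  have e1 : ∑ x, ∑ z, r x * (conv p r z / tot r - p (z - x)) = 0 := by
    have : ∀ x, ∑ z, (conv p r z / tot r - p (z - x)) = 0 := fun x => by
      rw [Finset.sum_sub_distrib, ← Finset.sum_div, sum_sub_right p x]
      change tot (conv p r) / tot r - tot p = 0
      rw [tot_conv]; field_simp; ring
    simp [← Finset.mul_sum, this]
  have e2 : ∑ x, ∑ z, r x * (p (z - x) *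
      (Real.log (p (z - x)) - Real.log (conv p r z) + Real.log (tot r))) =
      ∑ x, ∑ z, r x * (p (z - x) * Real.log (p (z - x)))
      - ∑ z, conv p r z * Real.log (conv p r z) + ∑ z, conv p r z * Real.log (tot r) := by
    have a1 : ∀ g : ZMod q → ℝ, ∑ z, conv p r z * g z = ∑ x, ∑ z, r x * (p (z - x) * g z) := by
      intro g
      rw [Finset.sum_comm]
      refine Finset.sum_congr rfl fun z _ => ?_
      rw [conv, Finset.sum_mul]
      exact Finset.sum_congr rfl fun x _ => by ring
    rw [a1, a1, ← Finset.sum_sub_distrib, ← Finset.sum_add_distrib]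
    refine Finset.sum_congr rfl fun x _ => ?_
    rw [← Finset.sum_sub_distrib, ← Finset.sum_add_distrib]
    exact Finset.sum_congr rfl fun z _ => by ring
  rw [e1, e2, ← Finset.sum_mul]
  have e3 : ∑ x, ∑ z, r x * (p (z - x) * Real.log (p (z - x))) =
      tot r * ∑ z, p z * Real.log (p z) := by
    rw [tot, Finset.sum_mul]
    refine Finset.sum_congr rfl fun x _ => ?_
    rw [← Finset.mul_sum, sum_sub_right (fun y => p y * Real.log (p y)) x]
  rw [e3]
  have e4 : ∑ z, conv p r z = tot p * tot r := tot_conv p r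
  rw [e4]
  simp only [cent, tot_conv, Real.negMulLog_mul]
  simp only [Real.negMulLog, neg_mul, Finset.sum_neg_distrib]
  ring

/-- Adding an independent variable does not decrease entropy. -/
lemma tot_mul_cent_le_cent_conv {p r : ZMod q → ℝ} (hp : ∀ x, 0 ≤ p x) (hr : ∀ x, 0 ≤ r x) :
    tot r * cent p ≤ cent (conv p r) := by
  have h := sum_sq_le_cent_conv_sub hp hr
  have : 0 ≤ ∑ x, r x * ∑ z, (√(p (z - x)) - √(conv p r z / tot r)) ^ 2 :=
    Finset.sum_nonneg fun x _ => mul_nonneg (hr x) (Finset.sum_nonneg fun _ _ => sq_nonneg _)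
  linarith

/-- A lower bound on the entropy gained by adding an independent variable: if `r` puts mass on two
points that differ by `d` and `p` differs from its translate by `d`, the mixture gains entropy. -/
lemma mul_le_cent_conv_sub {p r : ZMod q → ℝ} (hp : ∀ x, 0 ≤ p x) (hr : ∀ x, 0 ≤ r x)
    (d : ZMod q) :
    (tot p - bhat d p) * ((∑ x, r x * r (x + d)) / tot r) ≤
      2 * (cent (conv p r) - tot r * cent p) := by
  rcases (tot_nonneg hr).eq_or_lt with h | h
  · have h0 := eq_zero_of_tot_eq_zero hr h.symm
    have h1 : conv p r = fun _ => 0 := by ext z; simp [conv, h0]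
    simp [h0, h1, cent, tot]
  set s : ZMod q → ℝ := fun z => √(conv p r z / tot r) with hs
  set A : ZMod q → ℝ := fun x => ∑ z, (√(p (z - x)) - s z) ^ 2 with hA
  have hA0 : ∀ x, 0 ≤ A x := fun x => Finset.sum_nonneg fun _ _ => sq_nonneg _
  have h1 : ∑ x, r x * A x ≤ cent (conv p r) - tot r * cent p := sum_sq_le_cent_conv_sub hp hr
  have h2 : ∀ x, tot p - bhat d p ≤ A x + A (x + d) := by
    intro x
    have e : ∑ z, (√(p (z - x)) - √(p (z - (x + d)))) ^ 2 = 2 * (tot p - bhat d p) := by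
      rw [← bhat_neg, ← sum_sq_sqrt_sub hp,
        ← sum_sub_right (fun z => (√(p z) - √(p (z + -d))) ^ 2) x]
      refine Finset.sum_congr rfl fun z _ => ?_
      rw [show z - (x + d) = z - x + -d by ring]
    have : ∑ z, (√(p (z - x)) - √(p (z - (x + d)))) ^ 2 ≤ 2 * (A x + A (x + d)) := by
      rw [hA, ← Finset.sum_add_distrib, Finset.mul_sum]
      refine Finset.sum_le_sum fun z _ => ?_
      nlinarith [sq_nonneg (√(p (z - x)) - s z + (√(p (z - (x + d))) - s z))]
    linarith
  have hb : 0 ≤ tot p - bhat d p := sub_nonneg.2 (bhat_le_tot hp d)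
  have h3 : ∀ x, (tot p - bhat d p) * (r x * r (x + d) / tot r) ≤
      r x * A x + r (x + d) * A (x + d) := by
    intro x
    have a1 : r x * r (x + d) / tot r ≤ r x := by
      rw [div_le_iff₀ h]; exact mul_le_mul_of_nonneg_left (le_tot hr _) (hr x)
    have a2 : r x * r (x + d) / tot r ≤ r (x + d) := by
      rw [div_le_iff₀ h, mul_comm]; exact mul_le_mul_of_nonneg_left (le_tot hr _) (hr _)
    have a3 : 0 ≤ r x * r (x + d) / tot r := div_nonneg (mul_nonneg (hr _) (hr _)) h.le
    calc _ ≤ (A x + A (x + d)) * (r x * r (x + d) / tot r) := by gcongr; exact h2 x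
      _ = (r x * r (x + d) / tot r) * A x + (r x * r (x + d) / tot r) * A (x + d) := by ring
      _ ≤ _ := add_le_add (mul_le_mul_of_nonneg_right a1 (hA0 _))
          (mul_le_mul_of_nonneg_right a2 (hA0 _))
  have h4 := Finset.sum_le_sum fun x (_ : x ∈ Finset.univ) => h3 x
  rw [← Finset.mul_sum, ← Finset.sum_div, Finset.sum_add_distrib,
    sum_add_right' (fun x => r x * A x) d] at h4
  linarith

lemma sq_bhat_le {p : ZMod q → ℝ} (hp : ∀ x, 0 ≤ p x) (d : ZMod q) :
    bhat d p ^ 2 ≤ q * ∑ x, p x * p (x + d) := by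
  have h := Finset.sum_mul_sq_le_sq_mul_sq Finset.univ (fun _ : ZMod q => (1 : ℝ))
    (fun x => √(p x * p (x + d)))
  simp only [one_mul, one_pow, Finset.sum_const, Finset.card_univ, ZMod.card, nsmul_eq_mul,
    mul_one, Real.sq_sqrt (mul_nonneg (hp _) (hp _))] at h
  exact h

lemma sq_sum_abs_sub_le {p : ZMod q → ℝ} (hp : ∀ x, 0 ≤ p x) (d : ZMod q) :
    (∑ x, |p x - p (x + d)|) ^ 2 ≤ 8 * tot p * (tot p - bhat d p) := by
  have h := Finset.sum_mul_sq_le_sq_mul_sq Finset.univ (fun x => |√(p x) - √(p (x + d))|)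
    (fun x => √(p x) + √(p (x + d)))
  have e : ∀ x, |√(p x) - √(p (x + d))| * (√(p x) + √(p (x + d))) = |p x - p (x + d)| := by
    intro x
    rw [← abs_of_nonneg (add_nonneg (Real.sqrt_nonneg (p x)) (Real.sqrt_nonneg (p (x + d)))),
      ← abs_mul]
    congr 1
    nlinarith [Real.sq_sqrt (hp x), Real.sq_sqrt (hp (x + d))]
  simp only [e, sq_abs] at h
  rw [sum_sq_sqrt_sub hp] at h
  have h2 : ∑ x, (√(p x) + √(p (x + d))) ^ 2 ≤ 4 * tot p := by
    have : ∀ x, (√(p x) + √(p (x + d))) ^ 2 ≤ 2 * p x + 2 * p (x + d) := fun x => by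
      nlinarith [Real.sq_sqrt (hp x), Real.sq_sqrt (hp (x + d)), sq_nonneg (√(p x) - √(p (x + d)))]
    refine (Finset.sum_le_sum fun x _ => this x).trans_eq ?_
    rw [Finset.sum_add_distrib, ← Finset.mul_sum, ← Finset.mul_sum, sum_add_right' p d]
    rw [show ∑ x, p x = tot p from rfl]; ring
  have h3 : 0 ≤ tot p - bhat d p := sub_nonneg.2 (bhat_le_tot hp d)
  nlinarith

/-- Over a prime field, a law nearly invariant under one nonzero translation is nearly uniform:
every translation is a multiple of the given one. -/
lemma dev_le_sum_abs_sub [Fact q.Prime] (p : ZMod q → ℝ) {d : ZMod q} (hd : d ≠ 0) :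
    dev p ≤ q * ∑ x, |p x - p (x + d)| := by
  have hq : (0 : ℝ) < q := by exact_mod_cast NeZero.pos q
  set D := ∑ x, |p x - p (x + d)| with hD
  have hmul : ∀ k : ℕ, ∑ x, |p x - p (x + k * d)| ≤ k * D := by
    intro k
    induction k with
    | zero => simp
    | succ k ih =>
      have h : ∀ x, |p x - p (x + (k + 1 : ℕ) * d)| ≤
          |p x - p (x + k * d)| + |p (x + k * d) - p (x + k * d + d)| := by
        intro x
        rw [show x + ((k + 1 : ℕ) : ZMod q) * d = x + k * d + d by push_cast; ring]
        exact abs_sub_le _ _ _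
      refine (Finset.sum_le_sum fun x _ => h x).trans ?_
      rw [Finset.sum_add_distrib, sum_add_right' (fun y => |p y - p (y + d)|) (k * d)]
      push_cast
      linarith
  -- `e` is the multiple `e / d` of `d`
  have hall : ∀ e : ZMod q, ∑ x, |p x - p (x + e)| ≤ q * D := by
    intro e
    have h := hmul (e * d⁻¹).val
    rw [ZMod.natCast_zmod_val, mul_assoc, inv_mul_cancel₀ hd, mul_one] at h
    refine h.trans (mul_le_mul_of_nonneg_right ?_ (Finset.sum_nonneg fun _ _ => abs_nonneg _))
    exact_mod_cast (ZMod.val_lt _).le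
  have h1 : ∀ x, |p x - tot p / q| ≤ (∑ e, |p x - p (x + e)|) / q := by
    intro x
    have e : p x - tot p / q = (∑ e, (p x - p (x + e))) / q := by
      rw [Finset.sum_sub_distrib, show ∑ e, p (x + e) = tot p from Equiv.sum_comp (Equiv.addLeft x) p]
      simp only [Finset.sum_const, Finset.card_univ, ZMod.card, nsmul_eq_mul]
      field_simp
    rw [e, abs_div, abs_of_pos hq]
    gcongr
    exact Finset.abs_sum_le_sum_abs _ _
  refine (Finset.sum_le_sum fun x _ => h1 x).trans ?_
  rw [← Finset.sum_div, Finset.sum_comm, div_le_iff₀ hq]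
  refine (Finset.sum_le_sum fun e _ => hall e).trans_eq ?_
  simp only [Finset.sum_const, Finset.card_univ, ZMod.card, nsmul_eq_mul]
  ring

/-! ### Joint laws of a symbol and its side information -/

variable {q : ℕ} [NeZero q] {B C : Type*} [Fintype B] [Fintype C]

/-- A family `p b x = Pr(X = x, Y = b)` is the joint law of a symbol `X` and side information `Y`. -/
def IsLaw (p : B → ZMod q → ℝ) : Prop := (∀ b x, 0 ≤ p b x) ∧ ∑ b, tot (p b) = 1

/-- The conditional entropy `H(X | Y)` in nats. -/
def famEnt (p : B → ZMod q → ℝ) : ℝ := ∑ b, cent (p b)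

/-- The Bhattacharyya parameter `∑_{d ≠ 0} Z_d(X | Y)`. It is small when `Y` determines `X`. -/
def famBhat (p : B → ZMod q → ℝ) : ℝ := ∑ d ∈ Finset.univ.erase 0, ∑ b, bhat d (p b)

/-- The mean `ℓ¹` distance of the conditional law of `X` given `Y` from the uniform law. -/
def famDev (p : B → ZMod q → ℝ) : ℝ := ∑ b, dev (p b)

/-- The joint law of `X₁ + X₂` and `(Y₁, Y₂)`. -/
def minusFam (p : B → ZMod q → ℝ) (r : C → ZMod q → ℝ) (b : B × C) : ZMod q → ℝ :=
  conv (p b.1) (r b.2)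

/-- The joint law of `X₂` and `((Y₁, Y₂), X₁ + X₂)`. -/
def plusFam (p : B → ZMod q → ℝ) (r : C → ZMod q → ℝ) (b : (B × C) × ZMod q) : ZMod q → ℝ :=
  fiber (p b.1.1) (r b.1.2) b.2

lemma sum_tot_mul {p : B → ZMod q → ℝ} (hp : IsLaw p) (c : ℝ) : ∑ b, tot (p b) * c = c := by
  rw [← Finset.sum_mul, hp.2, one_mul]

lemma famEnt_nonneg {p : B → ZMod q → ℝ} (hp : IsLaw p) : 0 ≤ famEnt p :=
  Finset.sum_nonneg fun b _ => cent_nonneg (hp.1 b)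

lemma famEnt_le {p : B → ZMod q → ℝ} (hp : IsLaw p) : famEnt p ≤ Real.log q :=
  (Finset.sum_le_sum fun b _ => cent_le_tot_mul_log (hp.1 b)).trans_eq (sum_tot_mul hp _)

lemma famBhat_nonneg (p : B → ZMod q → ℝ) : 0 ≤ famBhat p :=
  Finset.sum_nonneg fun d _ => Finset.sum_nonneg fun b _ => bhat_nonneg d (p b)

lemma famDev_nonneg (p : B → ZMod q → ℝ) : 0 ≤ famDev p :=
  Finset.sum_nonneg fun b _ => dev_nonneg (p b)

lemma famEnt_le_famBhat {p : B → ZMod q → ℝ} (hp : IsLaw p) : famEnt p ≤ famBhat p := by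
  rw [famBhat, Finset.sum_comm]
  exact Finset.sum_le_sum fun b _ => cent_le_sum_bhat (hp.1 b)

lemma log_sub_famEnt_le {p : B → ZMod q → ℝ} (hp : IsLaw p) :
    Real.log q - famEnt p ≤ q * famDev p := by
  have h := Finset.sum_le_sum fun b (_ : b ∈ Finset.univ) => tot_mul_log_sub_cent_le (hp.1 b)
  rwa [Finset.sum_sub_distrib, sum_tot_mul hp, ← Finset.mul_sum] at h

/-- `H(X₁ + X₂ | Y₁, Y₂) + H(X₂ | Y₁, Y₂, X₁ + X₂) = H(X₁ | Y₁) + H(X₂ | Y₂)`. -/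
lemma famEnt_minus_add_plus {p : B → ZMod q → ℝ} {r : C → ZMod q → ℝ} (hp : IsLaw p)
    (hr : IsLaw r) : famEnt (minusFam p r) + famEnt (plusFam p r) = famEnt p + famEnt r := by
  unfold famEnt
  rw [Fintype.sum_prod_type (f := fun b => cent (plusFam p r b)), ← Finset.sum_add_distrib,
    Fintype.sum_prod_type]
  simp only [minusFam, plusFam, cent_conv_add_sum_cent_fiber, Finset.sum_add_distrib]
  congr 1
  · exact Finset.sum_congr rfl fun b _ => sum_tot_mul hr _
  · rw [Finset.sum_comm]
    exact Finset.sum_congr rfl fun b _ => sum_tot_mul hp _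

/-- The sum of two symbols does not depend on their order. -/
lemma famEnt_minus_comm (p : B → ZMod q → ℝ) (r : C → ZMod q → ℝ) :
    famEnt (minusFam p r) = famEnt (minusFam r p) := by
  unfold famEnt
  rw [← Equiv.sum_comp (Equiv.prodComm C B)]
  exact Finset.sum_congr rfl fun b _ => by simp [minusFam, conv_comm]

lemma famEnt_le_minus {p : B → ZMod q → ℝ} {r : C → ZMod q → ℝ} (hp : IsLaw p)
    (hr : IsLaw r) : famEnt p ≤ famEnt (minusFam p r) := by
  unfold famEnt
  rw [Fintype.sum_prod_type]
  refine Finset.sum_le_sum fun b _ => ?_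
  rw [← sum_tot_mul hr (cent (p b))]
  exact Finset.sum_le_sum fun c _ => tot_mul_cent_le_cent_conv (hp.1 b) (hr.1 c)

lemma famEnt_le_minus' {p : B → ZMod q → ℝ} {r : C → ZMod q → ℝ} (hp : IsLaw p)
    (hr : IsLaw r) : famEnt r ≤ famEnt (minusFam p r) :=
  famEnt_minus_comm p r ▸ famEnt_le_minus hr hp

/-- Under the plus step the coefficient of each translation is squared exactly. -/
lemma famBhat_plus_le {p : B → ZMod q → ℝ} (hp : IsLaw p) :
    famBhat (plusFam p p) ≤ famBhat p ^ 2 := by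
  have h : ∀ d, ∑ b, bhat d (plusFam p p b) = (∑ b, bhat d (p b)) ^ 2 := by
    intro d
    rw [Fintype.sum_prod_type, Fintype.sum_prod_type, sq, Finset.sum_mul_sum]
    exact Finset.sum_congr rfl fun b _ => Finset.sum_congr rfl fun c _ =>
      sum_bhat_fiber (hp.1 b) (p c) d
  unfold famBhat
  simp only [h]
  exact Finset.sum_sq_le_sq_sum_of_nonneg fun d _ =>
    Finset.sum_nonneg fun b _ => bhat_nonneg d (p b)

/-- For `d ≠ 0` one of the translations `d - e` and `e` is nonzero, and the parameter of the other is at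
most 1. -/
lemma famBhat_minus_le {p : B → ZMod q → ℝ} (hp : IsLaw p) :
    famBhat (minusFam p p) ≤ (q + 1) * famBhat p := by
  have hq : (1 : ℝ) ≤ q := by exact_mod_cast NeZero.one_le
  set Z : ZMod q → ℝ := fun d => ∑ b, bhat d (p b) with hZ
  have hZ0 : ∀ d, 0 ≤ Z d := fun d => Finset.sum_nonneg fun b _ => bhat_nonneg d (p b)
  have hZ1 : ∀ d, Z d ≤ 1 := fun d =>
    (Finset.sum_le_sum fun b _ => bhat_le_tot (hp.1 b) d).trans_eq hp.2
  have hZz : Z 0 = 1 := by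
    rw [hZ, ← hp.2]; exact Finset.sum_congr rfl fun b _ => bhat_zero (hp.1 b)
  have h : ∀ d, ∑ b, bhat d (minusFam p p b) ≤ ∑ e, Z (d - e) * Z e := by
    intro d
    rw [Fintype.sum_prod_type]
    refine (Finset.sum_le_sum fun b _ => Finset.sum_le_sum fun c _ =>
      bhat_conv_le (hp.1 b) (hp.1 c) d).trans_eq ?_
    simp only [hZ, Finset.sum_mul_sum]
    conv_lhs => enter [2, b]; rw [Finset.sum_comm]
    rw [Finset.sum_comm]
  have h2 : ∀ d, ∑ e, Z (d - e) * Z e ≤ Z d + famBhat p := by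
    intro d
    rw [← Finset.add_sum_erase _ _ (Finset.mem_univ (0 : ZMod q)), hZz, sub_zero, mul_one]
    refine add_le_add le_rfl (Finset.sum_le_sum fun e _ => ?_)
    exact mul_le_of_le_one_left (hZ0 e) (hZ1 _)
  refine (Finset.sum_le_sum fun d _ => (h d).trans (h2 d)).trans ?_
  rw [Finset.sum_add_distrib, Finset.sum_const, Finset.card_erase_of_mem (Finset.mem_univ _),
    Finset.card_univ, ZMod.card, nsmul_eq_mul, Nat.cast_sub NeZero.one_le]
  change famBhat p + _ ≤ _
  have := famBhat_nonneg p
  push_cast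
  nlinarith

/-- Under the minus step the distance from uniform is squared: the dual of `famBhat_plus_le`. -/
lemma famDev_minus_le (p : B → ZMod q → ℝ) : famDev (minusFam p p) ≤ famDev p ^ 2 := by
  unfold famDev
  rw [Fintype.sum_prod_type, sq, Finset.sum_mul_sum]
  exact Finset.sum_le_sum fun b _ => Finset.sum_le_sum fun c _ => dev_conv_le _ _

lemma famDev_plus_le {p : B → ZMod q → ℝ} (hp : IsLaw p) :
    famDev (plusFam p p) ≤ 4 * famDev p := by
  unfold famDev
  rw [Fintype.sum_prod_type, Fintype.sum_prod_type]
  refine (Finset.sum_le_sum fun b _ => Finset.sum_le_sum fun c _ =>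
    sum_dev_fiber_le (hp.1 b) (hp.1 c)).trans_eq ?_
  simp only [Finset.sum_add_distrib, ← Finset.mul_sum, ← Finset.sum_mul, hp.2]
  ring

/-- If combining two copies gains little entropy, each Bhattacharyya parameter is near `0` or near
`1`. -/
lemma bhat_sq_mul_le {p : B → ZMod q → ℝ} (hp : IsLaw p) (d : ZMod q) :
    (∑ b, bhat d (p b)) ^ 2 * (1 - ∑ b, bhat d (p b)) ≤
      2 * q * (famEnt (minusFam p p) - famEnt p) := by
  have hq : (0 : ℝ) ≤ q := by positivity
  set Z := ∑ b, bhat d (p b) with hZ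
  set R : B → ℝ := fun b => (∑ x, p b x * p b (x + d)) / tot (p b) with hR
  have hR0 : ∀ b, 0 ≤ R b := fun b => div_nonneg
    (Finset.sum_nonneg fun x _ => mul_nonneg (hp.1 b _) (hp.1 b _)) (tot_nonneg (hp.1 b))
  have hZ1 : Z ≤ 1 := (Finset.sum_le_sum fun b _ => bhat_le_tot (hp.1 b) d).trans_eq hp.2
  have h1 : (1 - Z) * ∑ b, R b ≤ 2 * (famEnt (minusFam p p) - famEnt p) := by
    have e1 : famEnt p = ∑ b, ∑ c, tot (p c) * cent (p b) :=
      Finset.sum_congr rfl fun b _ => (sum_tot_mul hp _).symm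
    have e2 : 1 - Z = ∑ b, (tot (p b) - bhat d (p b)) := by
      rw [Finset.sum_sub_distrib, hp.2]
    rw [e1, e2, famEnt, Fintype.sum_prod_type, ← Finset.sum_sub_distrib, Finset.sum_mul_sum,
      Finset.mul_sum]
    refine Finset.sum_le_sum fun b _ => ?_
    rw [← Finset.sum_sub_distrib, Finset.mul_sum]
    exact Finset.sum_le_sum fun c _ => mul_le_cent_conv_sub (hp.1 b) (hp.1 c) d
  have h2 : Z ^ 2 ≤ q * ∑ b, R b := by
    have a : Z ≤ ∑ b, √(tot (p b)) * √(q * R b) := by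
      refine Finset.sum_le_sum fun b _ => ?_
      rw [← Real.sqrt_mul (tot_nonneg (hp.1 b))]
      refine Real.le_sqrt_of_sq_le ((sq_bhat_le (hp.1 b) d).trans (le_of_eq ?_))
      rcases eq_or_ne (tot (p b)) 0 with h0 | h0
      · simp [h0, eq_zero_of_tot_eq_zero (hp.1 b) h0]
      · simp only [hR]; field_simp
    have a2 := Finset.sum_mul_sq_le_sq_mul_sq Finset.univ (fun b => √(tot (p b)))
      (fun b => √(q * R b))
    simp only [Real.sq_sqrt (tot_nonneg (hp.1 _)), hp.2, one_mul,
      Real.sq_sqrt (mul_nonneg hq (hR0 _)), ← Finset.mul_sum] at a2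
    refine le_trans ?_ a2
    have : 0 ≤ Z := Finset.sum_nonneg fun b _ => bhat_nonneg d (p b)
    gcongr
  calc Z ^ 2 * (1 - Z) ≤ (q * ∑ b, R b) * (1 - Z) :=
        mul_le_mul_of_nonneg_right h2 (sub_nonneg.2 hZ1)
    _ = q * ((1 - Z) * ∑ b, R b) := by ring
    _ ≤ q * (2 * (famEnt (minusFam p p) - famEnt p)) := by gcongr
    _ = _ := by ring

/-- A Bhattacharyya parameter close to 1 for a single nonzero translation makes the symbol nearly
uniform given its side information, since `q` is prime. -/
lemma sq_famDev_le [Fact q.Prime] {p : B → ZMod q → ℝ} (hp : IsLaw p) {d : ZMod q} (hd : d ≠ 0) :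
    famDev p ^ 2 ≤ 8 * q ^ 2 * (1 - ∑ b, bhat d (p b)) := by
  have h1 : famDev p ≤ q * ∑ b, √(8 * tot (p b)) * √(tot (p b) - bhat d (p b)) := by
    unfold famDev
    rw [Finset.mul_sum]
    refine Finset.sum_le_sum fun b _ => (dev_le_sum_abs_sub (p b) hd).trans ?_
    have : 0 ≤ 8 * tot (p b) := mul_nonneg (by norm_num) (tot_nonneg (hp.1 b))
    rw [← Real.sqrt_mul this]
    gcongr
    exact Real.le_sqrt_of_sq_le (sq_sum_abs_sub_le (hp.1 b) d)
  have h2 := Finset.sum_mul_sq_le_sq_mul_sq Finset.univ (fun b => √(8 * tot (p b)))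
      (fun b => √(tot (p b) - bhat d (p b)))
  have e1 : ∑ b, √(8 * tot (p b)) ^ 2 = 8 := by
    simp only [Real.sq_sqrt (mul_nonneg (by norm_num : (0 : ℝ) ≤ 8) (tot_nonneg (hp.1 _))),
      ← Finset.mul_sum, hp.2, mul_one]
  have e2 : ∑ b, √(tot (p b) - bhat d (p b)) ^ 2 = 1 - ∑ b, bhat d (p b) := by
    simp only [Real.sq_sqrt (sub_nonneg.2 (bhat_le_tot (hp.1 _) d)), Finset.sum_sub_distrib, hp.2]
  rw [e1, e2] at h2
  have h0 := famDev_nonneg p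
  calc famDev p ^ 2 ≤ (q * ∑ b, √(8 * tot (p b)) * √(tot (p b) - bhat d (p b))) ^ 2 := by gcongr
    _ = q ^ 2 * (∑ b, √(8 * tot (p b)) * √(tot (p b) - bhat d (p b))) ^ 2 := by ring
    _ ≤ q ^ 2 * (8 * (1 - ∑ b, bhat d (p b))) := by gcongr
    _ = _ := by ring

/-- The dichotomy behind polarization: a symbol whose entropy hardly changes under one step
is nearly determined, or nearly uniform, given its side information. -/
lemma exists_gain_dichotomy (q : ℕ) [Fact q.Prime] {ζ : ℝ} (hζ : 0 < ζ) :
    ∃ η > 0, ∀ {B : Type*} [Fintype B] {p : B → ZMod q → ℝ}, IsLaw p →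
      famEnt (minusFam p p) - famEnt p ≤ η → famBhat p ≤ ζ ∨ famDev p ≤ ζ := by
  have hq : (0 : ℝ) < q := by exact_mod_cast NeZero.pos q
  set u := ζ / q with hu
  have hu0 : 0 < u := by positivity
  set w := ζ ^ 2 / (8 * q ^ 2) with hw
  have hw0 : 0 < w := by positivity
  refine ⟨u ^ 2 * w / (4 * q), by positivity, fun {B} _ {p} hp hη => ?_⟩
  -- Either all Bhattacharyya parameters are small, or one is not small; the latter is then close
  -- to 1, because a value in between forces a definite entropy gain.
  by_cases hall : ∀ d : ZMod q, d ≠ 0 → ∑ b, bhat d (p b) ≤ u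
  · left
    refine (Finset.sum_le_sum fun d hd => hall d (Finset.ne_of_mem_erase hd)).trans ?_
    rw [Finset.sum_const, nsmul_eq_mul]
    have : ((Finset.univ.erase (0 : ZMod q)).card : ℝ) ≤ q := by
      have := Finset.card_le_univ (Finset.univ.erase (0 : ZMod q))
      rw [ZMod.card] at this
      exact_mod_cast this
    calc _ ≤ q * u := by gcongr
      _ = ζ := by rw [hu]; field_simp
  · right
    push Not at hall
    obtain ⟨d, hd, hdu⟩ := hall
    have h1 := bhat_sq_mul_le hp d
    have h2 := sq_famDev_le hp hd
    set Z := ∑ b, bhat d (p b)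
    have hZ1 : Z ≤ 1 := (Finset.sum_le_sum fun b _ => bhat_le_tot (hp.1 b) d).trans_eq hp.2
    have h3 : 1 - Z ≤ w := by
      by_contra hlt
      push Not at hlt
      have : u ^ 2 * w < Z ^ 2 * (1 - Z) := by
        have : u ^ 2 ≤ Z ^ 2 := by gcongr
        calc u ^ 2 * w < u ^ 2 * (1 - Z) := by gcongr
          _ ≤ _ := mul_le_mul_of_nonneg_right this (by linarith)
      have h5 : 2 * q * (famEnt (minusFam p p) - famEnt p) ≤ 2 * q * (u ^ 2 * w / (4 * q)) := by
        gcongr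
      have h6 : 2 * q * (u ^ 2 * w / (4 * q)) = u ^ 2 * w / 2 := by field_simp; ring
      have : 0 < u ^ 2 * w := by positivity
      linarith
    have h4 : famDev p ^ 2 ≤ ζ ^ 2 := by
      refine h2.trans ?_
      calc 8 * (q : ℝ) ^ 2 * (1 - Z) ≤ 8 * q ^ 2 * w := by gcongr
        _ = ζ ^ 2 := by rw [hw]; field_simp
    exact (sq_le_sq₀ (famDev_nonneg p) hζ.le).1 h4

/-! ### Polarization of a binary tree process -/

section Tree

variable {𝒯 : Type*}

/-- The average of `f` over the two children `a W`, `b W` of a node `W` of a binary tree. Its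
`m`-th iterate is the average over the `2 ^ m` descendants `m` levels below. -/
def childAvg (a b : 𝒯 → 𝒯) (f : 𝒯 → ℝ) (W : 𝒯) : ℝ := (f (a W) + f (b W)) / 2

lemma childAvg_comm (a b : 𝒯 → 𝒯) : childAvg a b = childAvg b a := by
  ext f W
  simp [childAvg, add_comm]

lemma iterate_childAvg_succ (a b : 𝒯 → 𝒯) (f : 𝒯 → ℝ) (n : ℕ) (W : 𝒯) :
    (childAvg a b)^[n + 1] f W =
      ((childAvg a b)^[n] f (a W) + (childAvg a b)^[n] f (b W)) / 2 := by
  rw [Function.iterate_succ_apply']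
  rfl

lemma iterate_childAvg_mono (a b : 𝒯 → 𝒯) {f g : 𝒯 → ℝ} (h : ∀ W, f W ≤ g W) (n : ℕ) (W : 𝒯) :
    (childAvg a b)^[n] f W ≤ (childAvg a b)^[n] g W := by
  induction n generalizing W with
  | zero => exact h W
  | succ n ih =>
    rw [iterate_childAvg_succ, iterate_childAvg_succ]
    linarith [ih (a W), ih (b W)]

lemma iterate_childAvg_mul_add (a b : 𝒯 → 𝒯) (f : 𝒯 → ℝ) (c e : ℝ) (n : ℕ) (W : 𝒯) :
    (childAvg a b)^[n] (fun W => c * f W + e) W = c * (childAvg a b)^[n] f W + e := by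
  induction n generalizing W with
  | zero => rfl
  | succ n ih =>
    rw [iterate_childAvg_succ, iterate_childAvg_succ, ih, ih]
    ring

lemma iterate_childAvg_add (a b : 𝒯 → 𝒯) (f g : 𝒯 → ℝ) (n : ℕ) (W : 𝒯) :
    (childAvg a b)^[n] (fun W => f W + g W) W =
      (childAvg a b)^[n] f W + (childAvg a b)^[n] g W := by
  induction n generalizing W with
  | zero => rfl
  | succ n ih =>
    rw [iterate_childAvg_succ, iterate_childAvg_succ, iterate_childAvg_succ, ih, ih]
    ring

lemma iterate_childAvg_le (a b : 𝒯 → 𝒯) {f : 𝒯 → ℝ} {c : ℝ} (h : ∀ W, f W ≤ c) (n : ℕ) (W : 𝒯) :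
    (childAvg a b)^[n] f W ≤ c := by
  have := iterate_childAvg_mono a b (g := fun W => 0 * f W + c) (fun W => by simpa using h W) n W
  rwa [iterate_childAvg_mul_add, zero_mul, zero_add] at this

/-- The potential `L ^ (-s)`, where `Z ≤ exp (-L)`, contracts by the factor `lam` until `L` drops
below `Lm`; the second term bounds the probability that this ever happens. -/
lemma iterate_childAvg_indicator_le {a b : 𝒯 → 𝒯} {Z : 𝒯 → ℝ} {C : ℝ} (hC : 1 ≤ C)
    (hZ0 : ∀ W, 0 ≤ Z W) (ha : ∀ W, Z (a W) ≤ C * Z W) (hb : ∀ W, Z (b W) ≤ Z W ^ 2)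
    {s lam Lm : ℝ} (hs : 0 < s) (hl0 : 0 ≤ lam) (hl1 : lam ≤ 1) (hLm : Real.log C < Lm)
    (hcontr : ∀ L, Lm < L →
      ((2 * L) ^ (-s) + (L - Real.log C) ^ (-s)) / 2 ≤ lam * L ^ (-s))
    {l : ℝ} (hl : 0 < l) (n : ℕ) (W : 𝒯) {L : ℝ} (hL : 0 < L) (hZ : Z W ≤ Real.exp (-L)) :
    (childAvg a b)^[n] (fun W => open Classical in if Z W ≤ Real.exp (-l) then 0 else 1) W ≤
      L ^ (-s) * (lam ^ n * l ^ s + Lm ^ s) := by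
  have hLm0 : 0 < Lm := (Real.log_nonneg hC).trans_lt hLm
  have hpos : ∀ n : ℕ, 0 ≤ lam ^ n * l ^ s + Lm ^ s := fun n => by positivity
  induction n generalizing W L with
  | zero =>
    simp only [Function.iterate_zero, id, pow_zero, one_mul]
    split_ifs with h
    · positivity
    · have h1 : L < l := by
        by_contra hlt
        push Not at hlt
        exact h (hZ.trans (Real.exp_le_exp.2 (by linarith)))
      have h2 : L ^ s ≤ l ^ s := Real.rpow_le_rpow hL.le h1.le hs.le
      have h3 : L ^ (-s) * L ^ s = 1 := by rw [← Real.rpow_add hL]; simp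
      have h4 : 0 ≤ L ^ (-s) := by positivity
      have h5 : 0 ≤ Lm ^ s := by positivity
      nlinarith
  | succ n ih =>
    -- below `Lm` the trivial bound 1 by the second term, above `Lm` the contraction
    rcases le_or_gt L Lm with hle | hlt
    · refine (iterate_childAvg_le a b (c := 1) (fun W => by split_ifs <;> norm_num) _ _).trans ?_
      have h2 : L ^ s ≤ Lm ^ s := Real.rpow_le_rpow hL.le hle hs.le
      have h3 : L ^ (-s) * L ^ s = 1 := by rw [← Real.rpow_add hL]; simp
      have h4 : 0 ≤ L ^ (-s) := by positivity
      have h5 : 0 ≤ lam ^ (n + 1) * l ^ s := by positivity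
      nlinarith
    · rw [iterate_childAvg_succ]
      have hLc : 0 < L - Real.log C := by linarith
      have h1 := ih (a W) hLc ((ha W).trans (by
        rw [neg_sub, Real.exp_sub, Real.exp_log (by linarith)]
        rw [Real.exp_neg] at hZ
        rw [div_eq_mul_inv]
        exact mul_le_mul_of_nonneg_left hZ (by linarith)))
      have h2 := ih (b W) (by linarith : 0 < 2 * L) ((hb W).trans (by
        rw [show -(2 * L) = -L + -L by ring, Real.exp_add, ← sq]
        exact pow_le_pow_left₀ (hZ0 W) hZ 2))
      calc _ ≤ ((2 * L) ^ (-s) + (L - Real.log C) ^ (-s)) / 2 * (lam ^ n * l ^ s + Lm ^ s) := by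
            linarith
        _ ≤ lam * L ^ (-s) * (lam ^ n * l ^ s + Lm ^ s) :=
            mul_le_mul_of_nonneg_right (hcontr L hlt) (hpos n)
        _ = L ^ (-s) * (lam ^ (n + 1) * l ^ s + lam * Lm ^ s) := by ring
        _ ≤ L ^ (-s) * (lam ^ (n + 1) * l ^ s + Lm ^ s) := by
            have h5 : 0 ≤ Lm ^ s := by positivity
            gcongr
            nlinarith

open Filter Topology in
/-- For small `s` the contraction factor `(1 + 2 ^ (-s)) / 2` of the potential `L ^ (-s)` beats the
growth rate `2 ^ (-β s)`. -/
lemma exists_contraction {β C : ℝ} (hβ : β < 1 / 2) (hβ0 : 0 ≤ β) (hC : 1 ≤ C) :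
    ∃ s lam Lm : ℝ, 0 < s ∧ 0 ≤ lam ∧ lam ≤ 1 ∧ Real.log C < Lm ∧ lam * 2 ^ (β * s) < 1 ∧
      ∀ L, Lm < L → ((2 * L) ^ (-s) + (L - Real.log C) ^ (-s)) / 2 ≤ lam * L ^ (-s) := by
  -- With `s log 2 = 1 / 2 - β`, the elementary bounds `1 + t ≤ exp t` are enough.
  set x := 1 / 2 - β with hx
  have hx0 : 0 < x := by rw [hx]; linarith
  have hlog2 : 0 < Real.log 2 := Real.log_pos (by norm_num)
  set s := x / Real.log 2 with hs
  have hs0 : 0 < s := by positivity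
  have e1 : (2 : ℝ) ^ (-s) = Real.exp (-x) := by
    rw [Real.rpow_def_of_pos (by norm_num), hs]; congr 1; field_simp
  have e2 : (2 : ℝ) ^ (β * s) = Real.exp (β * x) := by
    rw [Real.rpow_def_of_pos (by norm_num), hs]; congr 1; field_simp
  have h1 : Real.exp (-x) ≤ 1 / (1 + x) := by
    rw [Real.exp_neg, ← one_div]
    exact one_div_le_one_div_of_le (by positivity) (by linarith [Real.add_one_le_exp x])
  have h2 : 1 - β * x ≤ Real.exp (-(β * x)) := by
    linarith [Real.add_one_le_exp (-(β * x))]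
  have h3 : (1 + 1 / (1 + x)) / 2 < 1 - β * x := by
    rw [div_lt_iff₀ (by norm_num), ← sub_pos]
    have : (1 - β * x) * 2 - (1 + 1 / (1 + x)) = x * ((1 - 2 * β) * (1 - β)) / (1 + x) := by
      have hb : β = 1 / 2 - x := by linarith
      have hx1 : 1 + x ≠ 0 := by positivity
      clear_value x
      rw [hb]; field_simp; ring
    rw [this]
    have : 0 < (1 - 2 * β) * (1 - β) := mul_pos (by linarith) (by linarith)
    positivity
  obtain ⟨lam, hlo, hhi⟩ := exists_between (show ((2 : ℝ) ^ (-s) + 1) / 2 < Real.exp (-(β * x)) by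
    rw [e1]; linarith)
  have hlim : Tendsto (fun L : ℝ => ((2 : ℝ) ^ (-s) + (1 - Real.log C / L) ^ (-s)) / 2) atTop
      (𝓝 (((2 : ℝ) ^ (-s) + (1 - 0) ^ (-s)) / 2)) := by
    refine Tendsto.div_const (Tendsto.add tendsto_const_nhds ?_) _
    refine Tendsto.rpow_const (tendsto_const_nhds.sub (tendsto_const_nhds.div_atTop tendsto_id)) ?_
    left; norm_num
  rw [sub_zero, Real.one_rpow] at hlim
  obtain ⟨A, hA⟩ := eventually_atTop.1 (hlim.eventually (gt_mem_nhds hlo))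
  have hlam0 : 0 ≤ lam := le_trans (by positivity) hlo.le
  refine ⟨s, lam, max A (Real.log C + 1), hs0, hlam0, ?_, ?_, ?_, ?_⟩
  · refine hhi.le.trans (Real.exp_le_one_iff.2 ?_)
    nlinarith
  · exact lt_of_lt_of_le (by linarith) (le_max_right _ _)
  · rw [e2]
    calc lam * Real.exp (β * x) < Real.exp (-(β * x)) * Real.exp (β * x) := by
          gcongr
      _ = 1 := by rw [← Real.exp_add]; simp
  · intro L hL
    have hLA : A < L := (le_max_left _ _).trans_lt hL
    have hLC : Real.log C + 1 < L := (le_max_right _ _).trans_lt hL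
    have hc0 := Real.log_nonneg hC
    have hL0 : 0 < L := by linarith
    have := hA L hLA.le
    rw [Real.mul_rpow (by norm_num) hL0.le,
      show L - Real.log C = (1 - Real.log C / L) * L by field_simp,
      Real.mul_rpow (by rw [sub_nonneg, div_le_one hL0]; linarith) hL0.le, ← add_mul]
    have h5 : 0 ≤ L ^ (-s) := by positivity
    nlinarith

open Filter Topology in
/-- Once `Z` is small, almost all descendants have doubly exponentially small `Z`. -/
lemma exists_fast_polarization {β C ε : ℝ} (hβ : β < 1 / 2) (hβ0 : 0 ≤ β) (hC : 1 ≤ C)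
    (hε : 0 < ε) :
    ∃ ζ > 0, ∀ κ > 0, ∃ n₀ : ℕ, ∀ n ≥ n₀, ∀ {𝒯 : Type*} (a b : 𝒯 → 𝒯) (Z : 𝒯 → ℝ),
      (∀ W, 0 ≤ Z W) → (∀ W, Z (a W) ≤ C * Z W) → (∀ W, Z (b W) ≤ Z W ^ 2) →
      ∀ W, Z W ≤ ζ → (childAvg a b)^[n] (fun W => open Classical in
        if Z W ≤ Real.exp (-(κ * 2 ^ (β * n))) then 0 else 1) W ≤ ε := by
  obtain ⟨s, lam, Lm, hs, hl0, hl1, hLm, hrate, hcontr⟩ := exists_contraction hβ hβ0 hC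
  have hLm0 : 0 < Lm := (Real.log_nonneg hC).trans_lt hLm
  obtain ⟨L, hL, hL0⟩ : ∃ L : ℝ, L ^ (-s) * Lm ^ s < ε / 2 ∧ 0 < L := by
    have h : Tendsto (fun L : ℝ => L ^ (-s) * Lm ^ s) atTop (𝓝 (0 * Lm ^ s)) :=
      (tendsto_rpow_neg_atTop hs).mul_const _
    rw [zero_mul] at h
    exact ((h.eventually (gt_mem_nhds (by positivity))).and (eventually_gt_atTop 0)).exists
  refine ⟨Real.exp (-L), Real.exp_pos _, fun κ hκ => ?_⟩
  have hlim : Tendsto (fun n : ℕ => L ^ (-s) * κ ^ s * (lam * 2 ^ (β * s)) ^ n) atTop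
      (𝓝 (L ^ (-s) * κ ^ s * 0)) :=
    (tendsto_pow_atTop_nhds_zero_of_lt_one (by positivity) hrate).const_mul _
  rw [mul_zero] at hlim
  obtain ⟨n₀, hn₀⟩ := eventually_atTop.1 (hlim.eventually (gt_mem_nhds (half_pos hε)))
  refine ⟨n₀, fun n hn 𝒯 a b Z hZ0 ha hb W hW => ?_⟩
  refine (iterate_childAvg_indicator_le hC hZ0 ha hb hs hl0 hl1 hLm hcontr
    (l := κ * 2 ^ (β * n)) (by positivity) n W hL0 hW).trans ?_
  have h1 := hn₀ n hn
  have h2 : lam ^ n * (κ * 2 ^ (β * n)) ^ s = κ ^ s * (lam * 2 ^ (β * s)) ^ n := by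
    rw [Real.mul_rpow hκ.le (by positivity), mul_pow, ← Real.rpow_mul (by norm_num),
      ← Real.rpow_natCast (2 ^ (β * s)), ← Real.rpow_mul (by norm_num),
      show β * n * s = β * s * n by ring]
    ring
  rw [h2, mul_add, ← mul_assoc]
  linarith

/-- Bounded martingales have small increments: the average of the squared increment of `h` is at
most `c ^ 2 / K` at one of the first `K` levels. -/
lemma exists_small_increment {a b : 𝒯 → 𝒯} {h : 𝒯 → ℝ} {c : ℝ} (h0 : ∀ W, 0 ≤ h W)
    (hc : ∀ W, h W ≤ c) (hm : ∀ W, h (a W) + h (b W) = 2 * h W) {K : ℕ} (hK : 0 < K) (W : 𝒯) :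
    ∃ n < K, (childAvg a b)^[n] (fun W => (h (a W) - h W) ^ 2) W ≤ c ^ 2 / K := by
  have hsum : ∀ K, ∑ n ∈ Finset.range K, (childAvg a b)^[n] (fun W => (h (a W) - h W) ^ 2) W =
      (childAvg a b)^[K] (fun W => h W ^ 2) W - h W ^ 2 := by
    intro K
    induction K with
    | zero => simp
    | succ K ih =>
      rw [Finset.sum_range_succ, ih, Function.iterate_succ_apply]
      have : childAvg a b (fun W => h W ^ 2) = fun W => (h W ^ 2) + (h (a W) - h W) ^ 2 := by
        ext W
        have : h (b W) = 2 * h W - h (a W) := by linarith [hm W]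
        rw [childAvg, this]
        ring
      rw [this, iterate_childAvg_add]
      ring
  by_contra hcon
  push Not at hcon
  have h1 : ∑ n ∈ Finset.range K, c ^ 2 / (K : ℝ) <
      ∑ n ∈ Finset.range K, (childAvg a b)^[n] (fun W => (h (a W) - h W) ^ 2) W :=
    Finset.sum_lt_sum_of_nonempty (Finset.nonempty_range_iff.2 hK.ne')
      fun n hn => hcon n (Finset.mem_range.1 hn)
  rw [hsum, Finset.sum_const, Finset.card_range, nsmul_eq_mul] at h1
  have h2 : (childAvg a b)^[K] (fun W => h W ^ 2) W ≤ c ^ 2 :=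
    iterate_childAvg_le a b (fun W => pow_le_pow_left₀ (h0 W) (hc W) 2) K W
  have h3 : (K : ℝ) * (c ^ 2 / K) = c ^ 2 := by
    have : (K : ℝ) ≠ 0 := by positivity
    field_simp
  nlinarith [sq_nonneg (h W)]

/-- Polarization with speed `2 ^ (-N ^ β)`, at both ends and uniformly over the starting node: `h`
is the entropy, `Z` the Bhattacharyya parameter and `F` the distance from uniform. -/
theorem exists_polarization {β C c ε : ℝ} (hβ : β < 1 / 2) (hβ0 : 0 ≤ β) (hC : 1 ≤ C)
    (hε : 0 < ε) (gain : ℝ → ℝ) (hgain : ∀ ζ > 0, 0 < gain ζ) {κ : ℝ} (hκ : 0 < κ) :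
    ∃ m₀ : ℕ, ∀ m ≥ m₀, ∀ {𝒯 : Type*} (a b : 𝒯 → 𝒯) (h Z F : 𝒯 → ℝ),
      (∀ W, 0 ≤ h W) → (∀ W, h W ≤ c) → (∀ W, h (a W) + h (b W) = 2 * h W) →
      (∀ W, 0 ≤ Z W) → (∀ W, Z (a W) ≤ C * Z W) → (∀ W, Z (b W) ≤ Z W ^ 2) →
      (∀ W, 0 ≤ F W) → (∀ W, F (b W) ≤ C * F W) → (∀ W, F (a W) ≤ F W ^ 2) →
      (∀ ζ > 0, ∀ W, h (a W) - h W ≤ gain ζ → Z W ≤ ζ ∨ F W ≤ ζ) →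
      ∀ W, (childAvg a b)^[m] (fun W => open Classical in
        if Z W ≤ Real.exp (-(κ * 2 ^ (β * m))) ∨ F W ≤ Real.exp (-(κ * 2 ^ (β * m)))
        then 0 else 1) W ≤ ε := by
  obtain ⟨ζ, hζ, hfast⟩ := exists_fast_polarization hβ hβ0 hC (half_pos hε)
  set η := gain ζ with hη
  have hη0 : 0 < η := hgain ζ hζ
  -- among the first `K` levels there is one at which, up to probability `ε / 2`, the entropy changes
  -- by at most `η` in the next step
  obtain ⟨K, hK⟩ := exists_nat_gt (c ^ 2 / (η ^ 2 * (ε / 2)))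
  have hK0 : 0 < K := by
    have : (0 : ℝ) < K := lt_of_le_of_lt (by positivity) hK
    exact_mod_cast this
  obtain ⟨n₀, hn₀⟩ := hfast (κ * 2 ^ (β * K)) (by positivity)
  refine ⟨K + n₀, fun m hm 𝒯 a b h Z F h0 hc hmart hZ0 hZa hZb hF0 hFb hFa hdich W => ?_⟩
  obtain ⟨n, hnK, hn⟩ := exists_small_increment h0 hc hmart hK0 W
  obtain ⟨r, rfl⟩ : ∃ r, m = n + r := ⟨m - n, by omega⟩
  have hr : n₀ ≤ r := by omega
  set l := κ * 2 ^ (β * (n + r : ℕ)) with hl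
  have hll : l ≤ κ * 2 ^ (β * K) * 2 ^ (β * r) := by
    rw [hl, mul_assoc, ← Real.rpow_add (by norm_num), ← mul_add]
    gcongr
    · norm_num
    · push_cast
      have : (n : ℝ) ≤ K := by exact_mod_cast hnK.le
      linarith
  have hexp : Real.exp (-(κ * 2 ^ (β * K) * 2 ^ (β * r))) ≤ Real.exp (-l) :=
    Real.exp_le_exp.2 (by linarith)
  set f : 𝒯 → ℝ := fun W => open Classical in
    if Z W ≤ Real.exp (-l) ∨ F W ≤ Real.exp (-l) then 0 else 1 with hf
  have hf1 : ∀ W, f W ≤ 1 := fun W => by simp only [hf]; split_ifs <;> norm_num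
  have hr1 : ∀ W, (childAvg a b)^[r] f W ≤ 1 / η ^ 2 * (h (a W) - h W) ^ 2 + ε / 2 := by
    intro W
    -- Nodes with a small increment are already nearly extremal and polarize fast, `Z` along the
    -- children `b` or `F` along the children `a`; those with a large one are rare by Chebyshev.
    by_cases hinc : h (a W) - h W ≤ η
    · have : (childAvg a b)^[r] f W ≤ ε / 2 := by
        rcases hdich ζ hζ W hinc with h1 | h1
        · refine le_trans (iterate_childAvg_mono a b (fun W => ?_) r W)
            (hn₀ r hr a b Z hZ0 hZa hZb W h1)
          simp only [hf]
          split_ifs with h2 h3 h3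
          · exact le_rfl
          · exact zero_le_one
          · exact absurd (Or.inl (h3.trans hexp)) h2
          · exact le_rfl
        · rw [childAvg_comm]
          refine le_trans (iterate_childAvg_mono b a (fun W => ?_) r W)
            (hn₀ r hr b a F hF0 hFb hFa W h1)
          simp only [hf]
          split_ifs with h2 h3 h3
          · exact le_rfl
          · exact zero_le_one
          · exact absurd (Or.inr (h3.trans hexp)) h2
          · exact le_rfl
      have : 0 ≤ 1 / η ^ 2 * (h (a W) - h W) ^ 2 := by positivity
      linarith
    · push Not at hinc
      refine (iterate_childAvg_le a b hf1 r W).trans ?_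
      have : 1 ≤ 1 / η ^ 2 * (h (a W) - h W) ^ 2 := by
        rw [one_div_mul_eq_div, one_le_div (by positivity)]
        gcongr
      linarith
  rw [Function.iterate_add_apply]
  refine (iterate_childAvg_mono a b hr1 n W).trans ?_
  rw [iterate_childAvg_mul_add]
  have h5 : c ^ 2 / K ≤ η ^ 2 * (ε / 2) := by
    rw [div_lt_iff₀ (by positivity)] at hK
    rw [div_le_iff₀ (by positivity)]
    linarith
  calc _ ≤ 1 / η ^ 2 * (η ^ 2 * (ε / 2)) + ε / 2 := by gcongr; exact hn.trans h5
    _ = ε := by field_simp; ring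

end Tree

/-! ### Random variables on a finite probability space -/

section Fam

variable {q : ℕ} [NeZero q] {Ω Ω' B B' C C' : Type*} [Fintype Ω] [Fintype Ω'] [Fintype B]
  [Fintype B'] [Fintype C] [Fintype C']

open Classical in
/-- The joint law `b x ↦ Pr(X = x, Y = b)` of a symbol `X` and side information `Y` on a finite
space with weights `μ`. -/
def fam (μ : Ω → ℝ) (X : Ω → ZMod q) (Y : Ω → B) (b : B) (x : ZMod q) : ℝ :=
  ∑ ω, if X ω = x ∧ Y ω = b then μ ω else 0

/-- Two families of vectors agree up to relabelling, and up to zero vectors. The relation is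
expressed through the sums of arbitrary functionals, since only such sums are ever used. -/
def FamEquiv (p : B → ZMod q → ℝ) (p' : B' → ZMod q → ℝ) : Prop :=
  ∀ φ : (ZMod q → ℝ) → ℝ, φ (fun _ => 0) = 0 → ∑ b, φ (p b) = ∑ b, φ (p' b)

lemma FamEquiv.famEnt {p : B → ZMod q → ℝ} {p' : B' → ZMod q → ℝ} (h : FamEquiv p p') :
    famEnt p = famEnt p' := h cent (by simp [cent, tot])

lemma FamEquiv.famDev {p : B → ZMod q → ℝ} {p' : B' → ZMod q → ℝ} (h : FamEquiv p p') :
    famDev p = famDev p' := h dev (by simp [dev, tot])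

lemma FamEquiv.famBhat {p : B → ZMod q → ℝ} {p' : B' → ZMod q → ℝ} (h : FamEquiv p p') :
    famBhat p = famBhat p' :=
  Finset.sum_congr rfl fun d _ => h (bhat d) (by simp [bhat])

lemma fam_nonneg {μ : Ω → ℝ} (hμ : ∀ ω, 0 ≤ μ ω) (X : Ω → ZMod q) (Y : Ω → B) (b : B)
    (x : ZMod q) : 0 ≤ fam μ X Y b x :=
  Finset.sum_nonneg fun ω _ => by split_ifs; exacts [hμ ω, le_rfl]

open Classical in
lemma tot_fam (μ : Ω → ℝ) (X : Ω → ZMod q) (Y : Ω → B) (b : B) :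
    tot (fam μ X Y b) = ∑ ω, if Y ω = b then μ ω else 0 := by
  unfold tot fam
  rw [Finset.sum_comm]
  refine Finset.sum_congr rfl fun ω _ => ?_
  by_cases h : Y ω = b <;> simp [h]

lemma sum_tot_fam (μ : Ω → ℝ) (X : Ω → ZMod q) (Y : Ω → B) :
    ∑ b, tot (fam μ X Y b) = ∑ ω, μ ω := by
  classical
  simp only [tot_fam]
  rw [Finset.sum_comm]
  simp

lemma isLaw_fam {μ : Ω → ℝ} (hμ : ∀ ω, 0 ≤ μ ω) (h1 : ∑ ω, μ ω = 1) (X : Ω → ZMod q)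
    (Y : Ω → B) : IsLaw (fam μ X Y) :=
  ⟨fun b x => fam_nonneg hμ X Y b x, by rw [sum_tot_fam, h1]⟩

/-- The joint law depends on the side information only through the partition it generates. -/
lemma famEquiv_of_ker (μ : Ω → ℝ) (X : Ω → ZMod q) {Y : Ω → B} {Y' : Ω → B'}
    (h : ∀ ω ω', Y ω = Y ω' ↔ Y' ω = Y' ω') : FamEquiv (fam μ X Y) (fam μ X Y') := by
  classical
  intro φ hφ
  have aux : ∀ {D : Type _} [Fintype D] (Z : Ω → D),
      ∑ b, φ (fam μ X Z b) = ∑ b ∈ Finset.univ.image Z, φ (fam μ X Z b) := by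
    intro D _ Z
    symm
    refine Finset.sum_subset (Finset.subset_univ _) fun b _ hb => ?_
    rw [← hφ]
    congr 1
    ext x
    refine Finset.sum_eq_zero fun ω _ => if_neg fun hω => hb ?_
    exact Finset.mem_image.2 ⟨ω, Finset.mem_univ _, hω.2⟩
  have aux' : ∀ {D : Type _} [Fintype D] (Z : Ω → D),
      ∑ b, φ (fam μ X Z b) = ∑ b ∈ Finset.univ.image Z, φ (fam μ X Z b) := by
    intro D _ Z
    symm
    refine Finset.sum_subset (Finset.subset_univ _) fun b _ hb => ?_
    rw [← hφ]
    congr 1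
    ext x
    refine Finset.sum_eq_zero fun ω _ => if_neg fun hω => hb ?_
    exact Finset.mem_image.2 ⟨ω, Finset.mem_univ _, hω.2⟩
  rw [aux Y, aux' Y']
  have hch : ∀ b ∈ Finset.univ.image Y, ∃ ω, Y ω = b := fun b hb => by
    obtain ⟨ω, _, h⟩ := Finset.mem_image.1 hb
    exact ⟨ω, h⟩
  refine Finset.sum_bij (fun b hb => Y' (hch b hb).choose) ?_ ?_ ?_ ?_
  · intro b hb
    exact Finset.mem_image_of_mem _ (Finset.mem_univ _)
  · intro b hb b' hb' he
    rw [← (hch b hb).choose_spec, ← (hch b' hb').choose_spec]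
    exact (h _ _).2 he
  · intro b hb
    obtain ⟨ω, _, rfl⟩ := Finset.mem_image.1 hb
    have hm : Y ω ∈ Finset.univ.image Y := Finset.mem_image_of_mem _ (Finset.mem_univ _)
    exact ⟨Y ω, hm, (h _ _).1 (hch _ hm).choose_spec⟩
  · intro b hb
    congr 1
    ext x
    unfold fam
    refine Finset.sum_congr rfl fun ω _ => ?_
    have := h ω (hch b hb).choose
    rw [(hch b hb).choose_spec] at this
    simp only [this]

lemma fam_comp_equiv (e : Ω' ≃ Ω) (μ : Ω → ℝ) (X : Ω → ZMod q) (Y : Ω → B) :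
    fam (fun ω => μ (e ω)) (fun ω => X (e ω)) (fun ω => Y (e ω)) = fam μ X Y := by
  ext b x
  exact Equiv.sum_comp e fun ω => open Classical in if X ω = x ∧ Y ω = b then μ ω else 0

/-- The weights of two independent copies. -/
def prodWt (μ : Ω → ℝ) (ν : Ω' → ℝ) (ω : Ω × Ω') : ℝ := μ ω.1 * ν ω.2

/-- The sum of two independent symbols, given the side information of both. -/
lemma fam_minus (μ : Ω → ℝ) (ν : Ω' → ℝ) (X₁ : Ω → ZMod q) (X₂ : Ω' → ZMod q) (Y₁ : Ω → B)
    (Y₂ : Ω' → C) :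
    fam (prodWt μ ν) (fun ω => X₁ ω.1 + X₂ ω.2) (fun ω => (Y₁ ω.1, Y₂ ω.2)) =
      minusFam (fam μ X₁ Y₁) (fam ν X₂ Y₂) := by
  classical
  ext ⟨b, c⟩ z
  unfold minusFam conv fam prodWt
  simp only [Finset.sum_mul_sum]
  rw [Finset.sum_comm, Fintype.sum_prod_type]
  refine Finset.sum_congr rfl fun ω _ => ?_
  rw [Finset.sum_comm]
  refine Finset.sum_congr rfl fun ω' _ => ?_
  rw [Finset.sum_eq_single (X₂ ω')]
  · simp only [Prod.mk.injEq, true_and, eq_sub_iff_add_eq]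
    by_cases h1 : X₁ ω + X₂ ω' = z <;> by_cases h2 : Y₁ ω = b <;> by_cases h3 : Y₂ ω' = c <;>
      simp [h1, h2, h3]
  · intro x _ hx
    rw [if_neg (c := X₂ ω' = x ∧ Y₂ ω' = c) (fun h => hx h.1.symm), mul_zero]
  · simp

/-- The second of two independent symbols, given the side information of both and the sum. -/
lemma fam_plus (μ : Ω → ℝ) (ν : Ω' → ℝ) (X₁ : Ω → ZMod q) (X₂ : Ω' → ZMod q) (Y₁ : Ω → B)
    (Y₂ : Ω' → C) :
    fam (prodWt μ ν) (fun ω => X₂ ω.2) (fun ω => ((Y₁ ω.1, Y₂ ω.2), X₁ ω.1 + X₂ ω.2)) =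
      plusFam (fam μ X₁ Y₁) (fam ν X₂ Y₂) := by
  classical
  ext ⟨⟨b, c⟩, u⟩ x
  unfold plusFam fiber fam prodWt
  simp only [Finset.sum_mul_sum]
  rw [Fintype.sum_prod_type]
  refine Finset.sum_congr rfl fun ω _ => Finset.sum_congr rfl fun ω' _ => ?_
  simp only [Prod.mk.injEq]
  by_cases h0 : X₂ ω' = x
  · subst h0
    by_cases h1 : X₁ ω + X₂ ω' = u <;> by_cases h2 : Y₁ ω = b <;> by_cases h3 : Y₂ ω' = c <;>
      simp [h1, h2, h3, eq_sub_iff_add_eq]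
  · simp [h0]

/-- Independent side information is irrelevant. -/
lemma famEnt_fam_fst (μ : Ω → ℝ) {ν : Ω' → ℝ} (hν : ∑ ω, ν ω = 1) (X : Ω → ZMod q) (Y₁ : Ω → B)
    (Y₂ : Ω' → C) :
    famEnt (fam (prodWt μ ν) (fun ω => X ω.1) (fun ω => (Y₁ ω.1, Y₂ ω.2))) =
      famEnt (fam μ X Y₁) := by
  classical
  have h : ∀ b, fam (prodWt μ ν) (fun ω => X ω.1) (fun ω => (Y₁ ω.1, Y₂ ω.2)) b =
      fun x => (∑ ω, if Y₂ ω = b.2 then ν ω else 0) * fam μ X Y₁ b.1 x := by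
    intro b
    ext x
    unfold fam prodWt
    rw [mul_comm, Finset.sum_mul_sum, Fintype.sum_prod_type]
    refine Finset.sum_congr rfl fun ω _ => Finset.sum_congr rfl fun ω' _ => ?_
    simp only [Prod.ext_iff]
    by_cases h1 : X ω = x <;> by_cases h2 : Y₁ ω = b.1 <;> by_cases h3 : Y₂ ω' = b.2 <;>
      simp [h1, h2, h3]
  have hs : ∑ c, (∑ ω, if Y₂ ω = c then ν ω else 0) = 1 := by
    rw [Finset.sum_comm, ← hν]
    simp
  unfold famEnt
  simp only [h, cent_smul]
  rw [Fintype.sum_prod_type]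
  refine Finset.sum_congr rfl fun b _ => ?_
  change ∑ c, (∑ ω, if Y₂ ω = c then ν ω else 0) * cent (fam μ X Y₁ b) = _
  rw [← Finset.sum_mul, hs, one_mul]

lemma famEnt_fam_snd {μ : Ω → ℝ} (hμ : ∑ ω, μ ω = 1) (ν : Ω' → ℝ) (X : Ω' → ZMod q) (Y₁ : Ω → B)
    (Y₂ : Ω' → C) :
    famEnt (fam (prodWt μ ν) (fun ω => X ω.2) (fun ω => (Y₁ ω.1, Y₂ ω.2))) =
      famEnt (fam ν X Y₂) := by
  rw [← famEnt_fam_fst ν hμ X Y₂ Y₁,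
    ← fam_comp_equiv (Equiv.prodComm Ω Ω') (prodWt ν μ) (fun ω => X ω.1)
      (fun ω => (Y₂ ω.1, Y₁ ω.2))]
  have h := famEquiv_of_ker (prodWt μ ν) (fun ω => X ω.2)
    (Y := fun ω => (Y₁ ω.1, Y₂ ω.2)) (Y' := fun ω => (Y₂ ω.2, Y₁ ω.1)) (by
      intro ω ω'; simp only [Prod.mk.injEq]; exact and_comm)
  have e1 : (fun ω => prodWt ν μ (Equiv.prodComm Ω Ω' ω)) = prodWt μ ν :=
    funext fun ω => mul_comm _ _
  rw [h.famEnt, e1]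
  rfl

/-- Conditioning on more side information reduces entropy. -/
lemma famEnt_fam_le {μ : Ω → ℝ} (hμ : ∀ ω, 0 ≤ μ ω) (X : Ω → ZMod q) (Y : Ω → B) (Y' : Ω → C) :
    famEnt (fam μ X (fun ω => (Y ω, Y' ω))) ≤ famEnt (fam μ X Y) := by
  classical
  unfold famEnt
  rw [Fintype.sum_prod_type]
  refine Finset.sum_le_sum fun b _ => ?_
  refine (sum_cent_le fun c x => fam_nonneg hμ _ _ _ _).trans_eq ?_
  congr 1
  ext x
  unfold fam
  rw [Finset.sum_comm]
  refine Finset.sum_congr rfl fun ω _ => ?_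
  by_cases h : X ω = x ∧ Y ω = b
  · simp [h]
  · simp only [Prod.mk.injEq, ← and_assoc, h, false_and, if_false, Finset.sum_const_zero]

end Fam

/-! ### Ordered symbols and the merge of two independent copies -/

section Merge

variable {q : ℕ} [NeZero q] {Ω Ω' : Type*} [Fintype Ω] [Fintype Ω']
  {V V' : Type*} [Fintype V] [Fintype V'] [DecidableEq V] [DecidableEq V']
  {L L' : Type*} [LinearOrder L] [LinearOrder L']
  {B B' : Type*} [Fintype B] [Fintype B']

/-- What is known when the symbol `v` is decoded: the output `y`, and the symbols `w` that come
before `v` in the order `pos`. -/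
def pastInfo (sym : V → Ω → ZMod q) (y : Ω → B) (pos : V → L) (v : V) (ω : Ω) :
    B × ({w : V // pos w < pos v} → ZMod q) := (y ω, fun w => sym w ω)

lemma pastInfo_eq_iff {sym : V → Ω → ZMod q} {y : Ω → B} {pos : V → L} {v : V} {ω ω' : Ω} :
    pastInfo sym y pos v ω = pastInfo sym y pos v ω' ↔
      y ω = y ω' ∧ ∀ w, pos w < pos v → sym w ω = sym w ω' := by
  simp [pastInfo, Prod.ext_iff, funext_iff]

/-- The joint law of the symbol `v` and of what is known when it is decoded. -/
def symFam (μ : Ω → ℝ) (sym : V → Ω → ZMod q) (y : Ω → B) (pos : V → L) (v : V) :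
    B × ({w : V // pos w < pos v} → ZMod q) → ZMod q → ℝ :=
  fam μ (sym v) (pastInfo sym y pos v)

/-- The data `sym'`, `y'`, `pos'` arise from two independent copies of `sym`, `y`, `pos`: `l v` and
`r v` are the symbols `v` of the two copies; if `pm c = some d`, then `d` of the second copy is
added to `c` of the first copy, and the two are decoded one right after the other. -/
structure MergeData (μ : Ω → ℝ) (μ' : Ω' → ℝ) (sym : V → Ω → ZMod q) (sym' : V' → Ω' → ZMod q)
    (y : Ω → B) (y' : Ω' → B') (pos : V → L) (pos' : V' → L') (l r : V → V')
    (pm : V → Option V) (e : Ω' ≃ Ω × Ω) : Prop where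
  wt : ∀ ω, μ' ω = prodWt μ μ (e ω)
  sum_wt : ∑ ω, μ ω = 1
  wt_nonneg : ∀ ω, 0 ≤ μ ω
  out : ∀ ω ω', y' ω = y' ω' ↔ y (e ω).1 = y (e ω').1 ∧ y (e ω).2 = y (e ω').2
  cover : ∀ v', (∃ v, v' = l v) ∨ ∃ v, v' = r v
  ne : ∀ v w, l v ≠ r w
  inj_r : Function.Injective r
  inj : Function.Injective pos'
  pos_l : ∀ v w, pos' (l v) < pos' (l w) ↔ pos v < pos w
  pos_r : ∀ v w, pos' (r v) < pos' (r w) ↔ pos v < pos w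
  adj : ∀ c d, pm c = some d → ∀ u, pos' u < pos' (r d) ↔ pos' u < pos' (l c) ∨ u = l c
  sym_l : ∀ v ω, sym' (l v) ω = sym v (e ω).1 + (pm v).elim 0 fun d => sym d (e ω).2
  sym_r : ∀ v ω, sym' (r v) ω = sym v (e ω).2

variable {μ : Ω → ℝ} {μ' : Ω' → ℝ} {sym : V → Ω → ZMod q} {sym' : V' → Ω' → ZMod q}
  {y : Ω → B} {y' : Ω' → B'} {pos : V → L} {pos' : V' → L'} {l r : V → V'}
  {pm : V → Option V} {e : Ω' ≃ Ω × Ω}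

namespace MergeData

lemma isLaw (h : MergeData μ μ' sym sym' y y' pos pos' l r pm e)
    (v : V) : IsLaw (symFam μ sym y pos v) := isLaw_fam h.wt_nonneg h.sum_wt _ _

/-- If with the first symbol of a pair the past also contains the second, then knowing the past of
the merged system is knowing the symbols of the two copies that lie in it. -/
lemma past_iff (h : MergeData μ μ' sym sym' y y' pos pos' l r pm e)
    {D : V' → Prop} (hD : ∀ c d, pm c = some d → D (l c) → D (r d)) (ω ω' : Ω') :
    (∀ u, D u → sym' u ω = sym' u ω') ↔
      (∀ v, D (l v) → sym v (e ω).1 = sym v (e ω').1) ∧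
        ∀ v, D (r v) → sym v (e ω).2 = sym v (e ω').2 := by
  constructor
  · intro hu
    have h2 : ∀ v, D (r v) → sym v (e ω).2 = sym v (e ω').2 := fun v hv => by
      have := hu _ hv
      rwa [h.sym_r, h.sym_r] at this
    refine ⟨fun v hv => ?_, h2⟩
    have := hu _ hv
    rw [h.sym_l, h.sym_l] at this
    cases hc : pm v with
    | none => simpa [hc] using this
    | some d =>
      simp only [hc, Option.elim_some, h2 d (hD v d hc hv)] at this
      exact add_right_cancel this
  · rintro ⟨h1, h2⟩ u hu
    rcases h.cover u with ⟨v, rfl⟩ | ⟨v, rfl⟩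
    · rw [h.sym_l, h.sym_l, h1 v hu]
      cases hc : pm v with
      | none => simp
      | some d => simp only [Option.elim_some, h2 d (hD v d hc hu)]
    · rw [h.sym_r, h.sym_r, h2 v hu]

/-- If the past contains the first symbol of a pair, it contains the second, unless that is the
symbol about to be decoded. -/
lemma closed (h : MergeData μ μ' sym sym' y y' pos pos' l r pm e)
    {c d : V} (hcd : pm c = some d) {u : V'} (hu : u ≠ r d)
    (hlt : pos' (l c) < pos' u) : pos' (r d) < pos' u := by
  rcases lt_trichotomy (pos' (r d)) (pos' u) with h1 | h1 | h1
  · exact h1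
  · exact absurd (h.inj h1).symm hu
  · rcases (h.adj c d hcd u).1 h1 with h2 | h2
    · exact absurd (h2.trans hlt) (lt_irrefl _)
    · rw [h2] at hlt
      exact absurd hlt (lt_irrefl _)

/-- A symbol of the second copy precedes a pair exactly when it precedes the partner in that pair. -/
lemma pos_l_lt_r (h : MergeData μ μ' sym sym' y y' pos pos' l r pm e)
    {c d v : V} (hcd : pm c = some d) :
    pos' (r v) < pos' (l c) ↔ pos v < pos d := by
  rw [← h.pos_r, h.adj c d hcd (r v)]
  simp [(h.ne c v).symm]

/-- The first symbol of a pair undergoes the minus step. -/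
lemma famEquiv_minus (h : MergeData μ μ' sym sym' y y' pos pos' l r pm e)
    {c d : V} (hcd : pm c = some d) :
    FamEquiv (symFam μ' sym' y' pos' (l c))
      (minusFam (symFam μ sym y pos c) (symFam μ sym y pos d)) := by
  unfold symFam
  rw [← fam_minus, ← fam_comp_equiv e]
  have e1 : (fun ω => prodWt μ μ (e ω)) = μ' := funext fun ω => (h.wt ω).symm
  have e2 : (fun ω => sym c (e ω).1 + sym d (e ω).2) = sym' (l c) :=
    funext fun ω => by rw [h.sym_l, hcd]; rfl
  rw [e1, e2]
  refine famEquiv_of_ker _ _ fun ω ω' => ?_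
  simp only [Prod.mk.injEq]
  rw [pastInfo_eq_iff, pastInfo_eq_iff, pastInfo_eq_iff, h.out,
    h.past_iff (D := fun u => pos' u < pos' (l c))
      (fun c' d' h' hlt => h.closed h' (h.ne _ _) hlt)]
  simp only [h.pos_l, h.pos_l_lt_r hcd]
  tauto

/-- The second symbol of a pair undergoes the plus step, since its past contains the sum. -/
lemma famEquiv_plus (h : MergeData μ μ' sym sym' y y' pos pos' l r pm e)
    {c d : V} (hcd : pm c = some d) :
    FamEquiv (symFam μ' sym' y' pos' (r d))
      (plusFam (symFam μ sym y pos c) (symFam μ sym y pos d)) := by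
  unfold symFam
  rw [← fam_plus, ← fam_comp_equiv e]
  have e1 : (fun ω => prodWt μ μ (e ω)) = μ' := funext fun ω => (h.wt ω).symm
  have e2 : (fun ω => sym d (e ω).2) = sym' (r d) := funext fun ω => by rw [h.sym_r]
  rw [e1, e2]
  refine famEquiv_of_ker _ _ fun ω ω' => ?_
  simp only [Prod.mk.injEq]
  rw [pastInfo_eq_iff, pastInfo_eq_iff, pastInfo_eq_iff, h.out]
  have e3 : (∀ u, pos' u < pos' (r d) → sym' u ω = sym' u ω') ↔
      (∀ u, pos' u < pos' (l c) → sym' u ω = sym' u ω') ∧ sym' (l c) ω = sym' (l c) ω' := by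
    simp only [h.adj c d hcd]
    exact ⟨fun hu => ⟨fun u hlt => hu u (Or.inl hlt), hu _ (Or.inr rfl)⟩,
      fun hu u hlt => hlt.elim (hu.1 u) fun hh => hh ▸ hu.2⟩
  rw [e3, h.past_iff (D := fun u => pos' u < pos' (l c))
      (fun c' d' h' hlt => h.closed h' (h.ne _ _) hlt)]
  simp only [h.pos_l, h.pos_l_lt_r hcd, h.sym_l c, hcd, Option.elim_some]
  tauto

lemma famEnt_add (h : MergeData μ μ' sym sym' y y' pos pos' l r pm e)
    {c d : V} (hcd : pm c = some d) :
    famEnt (symFam μ' sym' y' pos' (l c)) + famEnt (symFam μ' sym' y' pos' (r d)) =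
      famEnt (symFam μ sym y pos c) + famEnt (symFam μ sym y pos d) := by
  rw [(h.famEquiv_minus hcd).famEnt, (h.famEquiv_plus hcd).famEnt,
    famEnt_minus_add_plus (h.isLaw c) (h.isLaw d)]

lemma famEnt_le_l (h : MergeData μ μ' sym sym' y y' pos pos' l r pm e)
    {c d : V} (hcd : pm c = some d) :
    famEnt (symFam μ sym y pos c) ≤ famEnt (symFam μ' sym' y' pos' (l c)) ∧
    famEnt (symFam μ sym y pos d) ≤ famEnt (symFam μ' sym' y' pos' (l c)) := by
  rw [(h.famEquiv_minus hcd).famEnt]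
  exact ⟨famEnt_le_minus (h.isLaw c) (h.isLaw d), famEnt_le_minus' (h.isLaw c) (h.isLaw d)⟩

/-- An unpaired symbol only gains independent side information from the other copy. -/
lemma famEnt_l (h : MergeData μ μ' sym sym' y y' pos pos' l r pm e)
    {v : V} (hv : pm v = none) :
    famEnt (symFam μ' sym' y' pos' (l v)) = famEnt (symFam μ sym y pos v) := by
  unfold symFam
  rw [← famEnt_fam_fst μ h.sum_wt (sym v) (pastInfo sym y pos v)
    (fun ω => (y ω, fun w : {w : V // pos' (r w) < pos' (l v)} => sym w ω)), ← fam_comp_equiv e]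
  have e1 : (fun ω => prodWt μ μ (e ω)) = μ' := funext fun ω => (h.wt ω).symm
  have e2 : (fun ω => sym v (e ω).1) = sym' (l v) :=
    funext fun ω => by rw [h.sym_l, hv]; simp
  rw [e1, e2]
  refine (famEquiv_of_ker _ _ fun ω ω' => ?_).famEnt
  simp only [Prod.mk.injEq]
  rw [pastInfo_eq_iff, pastInfo_eq_iff, h.out,
    h.past_iff (D := fun u => pos' u < pos' (l v))
      (fun c' d' h' hlt => h.closed h' (h.ne _ _) hlt)]
  simp only [h.pos_l, funext_iff, Subtype.forall]
  tauto

/-- The symbols of the second copy that are not the partner of a symbol keep their entropy. The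
symbols of the first copy in the past of such a symbol come together with their partners. -/
lemma famEnt_r (h : MergeData μ μ' sym sym' y y' pos pos' l r pm e)
    {v : V} (hv : ∀ c, pm c ≠ some v) :
    famEnt (symFam μ' sym' y' pos' (r v)) = famEnt (symFam μ sym y pos v) := by
  unfold symFam
  rw [← famEnt_fam_snd h.sum_wt μ (sym v)
    (fun ω => (y ω, fun w : {w : V // pos' (l w) < pos' (r v)} => sym w ω))
    (pastInfo sym y pos v), ← fam_comp_equiv e]
  have e1 : (fun ω => prodWt μ μ (e ω)) = μ' := funext fun ω => (h.wt ω).symm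
  have e2 : (fun ω => sym v (e ω).2) = sym' (r v) := funext fun ω => by rw [h.sym_r]
  rw [e1, e2]
  refine (famEquiv_of_ker _ _ fun ω ω' => ?_).famEnt
  simp only [Prod.mk.injEq]
  rw [pastInfo_eq_iff, pastInfo_eq_iff, h.out,
    h.past_iff (D := fun u => pos' u < pos' (r v))
      (fun c' d' h' hlt => h.closed h' (fun hh => hv c' (by rw [h', h.inj_r hh])) hlt)]
  simp only [h.pos_r, funext_iff, Subtype.forall]
  tauto

end MergeData

end Merge

/-! ### Information quantities as conditional entropies -/

section Entropy

variable {Ω A B C : Type*} [Fintype Ω] [Fintype A] [Fintype B] [Fintype C]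

open Classical in
lemma toReal_map_apply (μ : PMF Ω) (f : Ω → A) (a : A) :
    ((μ.map f) a).toReal = ∑ ω, if f ω = a then (μ ω).toReal else 0 := by
  rw [PMF.map_apply, tsum_fintype, ENNReal.toReal_sum]
  · refine Finset.sum_congr rfl fun ω _ => ?_
    by_cases h : f ω = a
    · simp [h]
    · rw [if_neg h, if_neg fun h' => h h'.symm]; simp
  · intro ω _
    split_ifs
    · exact μ.apply_ne_top ω
    · exact ENNReal.zero_ne_top

open Classical in
lemma entropy_eq_sum (μ : PMF Ω) (f : Ω → A) :
    entropy μ f =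
      (∑ a, Real.negMulLog (∑ ω, if f ω = a then (μ ω).toReal else 0)) / Real.log 2 := by
  unfold entropy
  simp only [toReal_map_apply]

lemma sum_toReal_eq_one (μ : PMF Ω) : ∑ ω, (μ ω).toReal = 1 := by
  rw [← ENNReal.toReal_sum fun ω _ => μ.apply_ne_top ω, ← tsum_fintype (L := .unconditional _),
    μ.tsum_coe, ENNReal.toReal_one]

variable {q : ℕ} [NeZero q]

/-- `famEnt` is a conditional entropy in nats, `entropy` is in bits. -/
lemma famEnt_fam_eq (μ : PMF Ω) (f : Ω → ZMod q) (g : Ω → B) :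
    famEnt (fam (fun ω => (μ ω).toReal) f g) =
      (entropy μ (fun ω => (f ω, g ω)) - entropy μ g) * Real.log 2 := by
  classical
  have h2 : Real.log 2 ≠ 0 := (Real.log_pos (by norm_num)).ne'
  rw [entropy_eq_sum, entropy_eq_sum, ← sub_div, div_mul_cancel₀ _ h2]
  unfold famEnt cent
  rw [Finset.sum_sub_distrib]
  simp only [tot_fam]
  rw [Fintype.sum_prod_type, Finset.sum_comm]
  simp only [Prod.mk.injEq]
  rfl

lemma entropy_comp_equiv (μ : PMF Ω) (f : Ω → A) (e : A ≃ B) :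
    entropy μ (fun ω => e (f ω)) = entropy μ f := by
  classical
  rw [entropy_eq_sum, entropy_eq_sum, ← Equiv.sum_comp e]
  simp only [EmbeddingLike.apply_eq_iff_eq]

lemma condMutualInfo_eq (μ : PMF Ω) (f : Ω → ZMod q) (g : Ω → B) (h : Ω → C) :
    condMutualInfo μ f g h =
      (famEnt (fam (fun ω => (μ ω).toReal) f h) -
        famEnt (fam (fun ω => (μ ω).toReal) f (fun ω => (g ω, h ω)))) / Real.log 2 := by
  have h2 : Real.log 2 ≠ 0 := (Real.log_pos (by norm_num)).ne'
  rw [famEnt_fam_eq, famEnt_fam_eq, condMutualInfo]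
  field_simp
  ring

end Entropy

/-! ### Blocks of channel uses -/

section Block

variable {q : ℕ} [NeZero q] {Y : Type*} [Fintype Y]

/-- The weight of an input pair and an output word for `|ι|` uses of the MAC with independent
uniform inputs. -/
def chanWt (P : ZMod q → ZMod q → PMF Y) (ι : Type*) [Fintype ι]
    (ω : (Fin 2 → ι → ZMod q) × (ι → Y)) : ℝ :=
  ((q : ℝ) ^ (2 * Fintype.card ι))⁻¹ * ∏ t, (P (ω.1 0 t) (ω.1 1 t) (ω.2 t)).toReal

lemma piPMF_apply {ι A : Type*} [Fintype ι] [DecidableEq ι] [Fintype A] (p : ι → PMF A)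
    (y : ι → A) : piPMF p y = ∏ t, p t (y t) := rfl

lemma card_inputs (ι : Type*) [Fintype ι] [DecidableEq ι] :
    Fintype.card (Fin 2 → ι → ZMod q) = q ^ (2 * Fintype.card ι) := by
  simp [Fintype.card_pi, ← pow_mul, mul_comm]

lemma toReal_blockLaw (n k : ℕ) (P : ZMod q → ZMod q → PMF Y)
    (ω : (Fin 2 → Idx n k → ZMod q) × (Idx n k → Y)) :
    (blockLaw n k P ω).toReal = chanWt P (Idx n k) ω := by
  classical
  obtain ⟨x, y⟩ := ω
  rw [blockLaw, PMF.bind_apply, tsum_fintype, Finset.sum_eq_single x]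
  · rw [PMF.uniformOfFintype_apply, card_inputs, PMF.map_apply, tsum_fintype,
      Finset.sum_eq_single y]
    · simp [piPMF_apply, chanWt, ENNReal.toReal_mul, ENNReal.toReal_prod]
    · intro y' _ hy'
      exact if_neg fun h => hy' (by simpa using h.symm)
    · simp
  · intro x' _ hx'
    rw [PMF.map_apply, tsum_fintype, Finset.sum_eq_zero, mul_zero]
    intro y' _
    exact if_neg fun h => hx' (by simpa using (congrArg Prod.fst h).symm)
  · simp

lemma chanWt_nonneg (P : ZMod q → ZMod q → PMF Y) (ι : Type*) [Fintype ι]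
    (ω : (Fin 2 → ι → ZMod q) × (ι → Y)) : 0 ≤ chanWt P ι ω :=
  mul_nonneg (by positivity) (Finset.prod_nonneg fun _ _ => ENNReal.toReal_nonneg)

lemma sum_prod_toReal {ι : Type*} [Fintype ι] [DecidableEq ι] (p : ι → PMF Y) :
    ∑ y : ι → Y, ∏ t, (p t (y t)).toReal = 1 := by
  have h := (Finset.prod_univ_sum (fun _ : ι => (Finset.univ : Finset Y))
    (fun t a => (p t a).toReal)).symm
  rw [Fintype.piFinset_univ] at h
  rw [h]
  simp [sum_toReal_eq_one]

lemma sum_chanWt_snd (P : ZMod q → ZMod q → PMF Y) (ι : Type*) [Fintype ι] [DecidableEq ι]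
    (x : Fin 2 → ι → ZMod q) :
    ∑ y, chanWt P ι (x, y) = ((q : ℝ) ^ (2 * Fintype.card ι))⁻¹ := by
  simp only [chanWt]
  rw [← Finset.mul_sum, sum_prod_toReal (fun t => P (x 0 t) (x 1 t)), mul_one]

lemma sum_chanWt (P : ZMod q → ZMod q → PMF Y) (ι : Type*) [Fintype ι] [DecidableEq ι] :
    ∑ ω, chanWt P ι ω = 1 := by
  rw [Fintype.sum_prod_type]
  simp only [sum_chanWt_snd, Finset.sum_const, Finset.card_univ, card_inputs, nsmul_eq_mul]
  have hq : (q : ℝ) ≠ 0 := by exact_mod_cast NeZero.ne q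
  push_cast
  field_simp

lemma sum_elim_equiv_symm {A ι ι' : Type*} (e : ι' ≃ ι ⊕ ι) (f : ι' → A) (a : ι') :
    Sum.elim (fun a => f (e.symm (.inl a))) (fun a => f (e.symm (.inr a))) (e a) = f a := by
  obtain ⟨b, rfl⟩ := e.symm.surjective a
  rcases b with b | b <;> simp

/-- Splitting the uses of the channel into two halves. -/
def splitUses (q : ℕ) (Y : Type*) {ι ι' : Type*} (e : ι' ≃ ι ⊕ ι) :
    ((Fin 2 → ι' → ZMod q) × (ι' → Y)) ≃
      ((Fin 2 → ι → ZMod q) × (ι → Y)) × ((Fin 2 → ι → ZMod q) × (ι → Y)) where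
  toFun ω := ((fun j a => ω.1 j (e.symm (.inl a)), fun a => ω.2 (e.symm (.inl a))),
    (fun j a => ω.1 j (e.symm (.inr a)), fun a => ω.2 (e.symm (.inr a))))
  invFun ω := (fun j a => Sum.elim (ω.1.1 j) (ω.2.1 j) (e a), fun a => Sum.elim ω.1.2 ω.2.2 (e a))
  left_inv ω := by
    ext
    · exact sum_elim_equiv_symm e (ω.1 _) _
    · exact sum_elim_equiv_symm e ω.2 _
  right_inv ω := by simp

lemma chanWt_splitUses (P : ZMod q → ZMod q → PMF Y) {ι ι' : Type*} [Fintype ι] [Fintype ι']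
    (e : ι' ≃ ι ⊕ ι) (ω : (Fin 2 → ι' → ZMod q) × (ι' → Y)) :
    chanWt P ι' ω = prodWt (chanWt P ι) (chanWt P ι) (splitUses q Y e ω) := by
  unfold prodWt chanWt
  rw [← Equiv.prod_comp e.symm, Fintype.prod_sum_type, Fintype.card_congr e, Fintype.card_sum]
  simp only [splitUses, Equiv.coe_fn_mk]
  rw [mul_add, pow_add, mul_inv]
  ring

lemma splitUses_out {ι ι' : Type*} (e : ι' ≃ ι ⊕ ι) (ω ω' : (Fin 2 → ι' → ZMod q) × (ι' → Y)) :
    ω.2 = ω'.2 ↔ (splitUses q Y e ω).1.2 = (splitUses q Y e ω').1.2 ∧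
      (splitUses q Y e ω).2.2 = (splitUses q Y e ω').2.2 := by
  constructor
  · intro h
    simp [splitUses, h]
  · rintro ⟨h1, h2⟩
    ext a
    obtain ⟨b, rfl⟩ := e.symm.surjective a
    rcases b with b | b
    · exact congrFun h1 b
    · exact congrFun h2 b

end Block

section Scheme

variable {q n k : ℕ} [NeZero q] {Y : Type*} [Fintype Y]

/-- The conditional entropy, in nats, of a transformed symbol given the output and the preceding
symbols. -/
def Scheme.symbolEnt (s : Scheme q n k) (P : ZMod q → ZMod q → PMF Y) (S : Perm n k)
    (v : Var n k) : ℝ :=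
  famEnt (symFam (chanWt P (Idx n k)) (fun v ω => s.symbol v ω.1) (fun ω => ω.2) S v)

lemma Scheme.isLaw_symFam (s : Scheme q n k) (P : ZMod q → ZMod q → PMF Y) (S : Perm n k)
    (v : Var n k) :
    IsLaw (symFam (chanWt P (Idx n k)) (fun v ω => s.symbol v ω.1) (fun ω => ω.2) S v) :=
  isLaw_fam (chanWt_nonneg P _) (sum_chanWt P _) _ _

lemma Scheme.symbolEnt_nonneg (s : Scheme q n k) (P : ZMod q → ZMod q → PMF Y) (S : Perm n k)
    (v : Var n k) : 0 ≤ s.symbolEnt P S v := famEnt_nonneg (s.isLaw_symFam P S v)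

/-- The transformed words determine the input words. -/
def Scheme.IsBijective (s : Scheme q n k) : Prop := ∀ j, Function.Bijective (s.transform j)

/-- The bijection between input words and transformed words of both senders. -/
def Scheme.IsBijective.equiv {s : Scheme q n k} (hs : s.IsBijective) :
    (Fin 2 → Idx n k → ZMod q) ≃ (Fin 2 → Idx n k → ZMod q) :=
  Equiv.piCongrRight fun j => Equiv.ofBijective _ (hs j)

/-- A symbol that is uniform given the side information has the entropy `log q`. -/
lemma famEnt_eq_log {B : Type*} [Fintype B] {p : B → ZMod q → ℝ} (hp : IsLaw p)
    (h : ∀ b x, p b x = p b 0) : famEnt p = Real.log q := by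
  have h5 : ∀ b, p b = fun _ => p b 0 := fun b => funext (h b)
  unfold famEnt
  rw [← sum_tot_mul hp (Real.log q)]
  refine Finset.sum_congr rfl fun b _ => ?_
  rw [h5, cent_const]
  simp [tot]

/-- Before the output is seen, each symbol is uniform given the preceding ones. -/
lemma famEnt_prior {s : Scheme q n k} (hs : s.IsBijective) (P : ZMod q → ZMod q → PMF Y)
    (S : Perm n k) (v : Var n k) :
    famEnt (fam (chanWt P (Idx n k)) (fun ω => s.symbol v ω.1)
      (fun ω (w : {w : Var n k // S w < S v}) => s.symbol w ω.1)) = Real.log q := by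
  classical
  set c : ℝ := ((q : ℝ) ^ (2 * Fintype.card (Idx n k)))⁻¹ with hc
  have h1 : fam (chanWt P (Idx n k)) (fun ω => s.symbol v ω.1)
      (fun ω (w : {w : Var n k // S w < S v}) => s.symbol w ω.1) =
      fam (fun _ : Fin 2 → Idx n k → ZMod q => c) (fun x => s.symbol v x)
        (fun x (w : {w : Var n k // S w < S v}) => s.symbol w x) := by
    ext b x
    unfold fam
    rw [Fintype.sum_prod_type]
    refine Finset.sum_congr rfl fun u _ => ?_
    split_ifs
    · exact sum_chanWt_snd P _ u
    · simp
  have h2 := fam_comp_equiv hs.equiv (fun _ : Fin 2 → Idx n k → ZMod q => c)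
    (fun u => u v.1 v.2) (fun u (w : {w : Var n k // S w < S v}) => u w.1.1 w.1.2)
  have h3 : ∀ b x, fam (fun _ : Fin 2 → Idx n k → ZMod q => c)
      (fun u => u v.1 v.2) (fun u (w : {w : Var n k // S w < S v}) => u w.1.1 w.1.2) b x =
      fam (fun _ : Fin 2 → Idx n k → ZMod q => c)
      (fun u => u v.1 v.2) (fun u (w : {w : Var n k // S w < S v}) => u w.1.1 w.1.2) b 0 := by
    intro b x
    set δ : Fin 2 → Idx n k → ZMod q := fun j a => if (j, a) = v then x else 0 with hδ
    unfold fam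
    rw [← Equiv.sum_comp (Equiv.addRight δ)]
    refine Finset.sum_congr rfl fun u _ => ?_
    have e1 : (u + δ) v.1 v.2 = u v.1 v.2 + x := by simp [hδ]
    have e2 : (fun w : {w : Var n k // S w < S v} => (u + δ) w.1.1 w.1.2) =
        fun w => u w.1.1 w.1.2 := by
      ext ⟨⟨j, a⟩, hw⟩
      have hne : (j, a) ≠ v := fun h => by rw [h] at hw; exact lt_irrefl _ hw
      simp [hδ, hne]
    simp only [Equiv.coe_addRight, e1, e2, add_eq_right]
  have hlaw : IsLaw (fam (chanWt P (Idx n k)) (fun ω => s.symbol v ω.1)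
      (fun ω (w : {w : Var n k // S w < S v}) => s.symbol w ω.1)) :=
    isLaw_fam (chanWt_nonneg P _) (sum_chanWt P _) _ _
  have h4 := h1.trans h2
  refine famEnt_eq_log hlaw fun b x => ?_
  rw [h4]
  exact h3 b x

/-- The information of a symbol is its defect of conditional entropy, because the symbols are
independent and uniform before the outputs are known. -/
lemma Scheme.symbolInfo_eq {s : Scheme q n k} (hs : s.IsBijective) (P : ZMod q → ZMod q → PMF Y)
    (S : Perm n k) (v : Var n k) :
    s.symbolInfo P S v = (Real.log q - s.symbolEnt P S v) / Real.log 2 := by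
  unfold Scheme.symbolInfo
  rw [condMutualInfo_eq]
  simp only [toReal_blockLaw]
  rw [famEnt_prior hs]
  rfl

end Scheme

/-! ### The polar transform -/

section Polar

variable {q : ℕ}

/-- The two halves of the uses of the channel, for twice the block length. -/
def halves (n : ℕ) : Fin (2 ^ (n + 1)) ≃ Fin (2 ^ n) ⊕ Fin (2 ^ n) :=
  (finCongr (by rw [pow_succ, mul_two])).trans finSumFinEquiv.symm

/-- The index `2 a + ε`, at twice the block length. -/
def child {n : ℕ} (ε : Fin 2) (a : Fin (2 ^ n)) : Fin (2 ^ (n + 1)) :=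
  ⟨2 * a + ε, by have := a.2; have := ε.2; rw [pow_succ]; omega⟩

lemma child_cases {n : ℕ} (b : Fin (2 ^ (n + 1))) : (∃ a, b = child 0 a) ∨ ∃ a, b = child 1 a := by
  have hb : (b : ℕ) < 2 ^ n * 2 := (pow_succ 2 n) ▸ b.2
  rcases Nat.mod_two_eq_zero_or_one (b : ℕ) with h | h
  · exact Or.inl ⟨⟨b / 2, by omega⟩, Fin.ext (by simp [child]; omega)⟩
  · exact Or.inr ⟨⟨b / 2, by omega⟩, Fin.ext (by simp [child]; omega)⟩

/-- The bit reversal turns the Kronecker power into a recursion in which the output index is extended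
by a lowest bit and the input index by a highest bit. -/
lemma polarMatrix_succ (q n : ℕ) (ε ε' : Fin 2) (a b : Fin (2 ^ n)) (a' : Fin (2 ^ (n + 1)))
    (ha : (a' : ℕ) = a + ε * 2 ^ n) :
    polarMatrix q (n + 1) a' (child ε' b) =
      polarMatrix q n a b * (!![1, 0; 1, 1] : Matrix (Fin 2) (Fin 2) (ZMod q)) ε ε' := by
  unfold polarMatrix
  simp only [Matrix.of_apply]
  rw [Fin.prod_univ_castSucc]
  have hε := ε.2
  have hε' := ε'.2
  have h0 : finFunctionFinEquiv.symm a' (Fin.last n) = ε := by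
    ext
    simp only [finFunctionFinEquiv_symm_apply_val, Fin.val_last, ha]
    rw [Nat.add_mul_div_right _ _ (by positivity), Nat.div_eq_of_lt a.2, zero_add,
      Nat.mod_eq_of_lt hε]
  have h1 : finFunctionFinEquiv.symm (child ε' b) (Fin.rev (Fin.last n)) = ε' := by
    ext
    simp only [finFunctionFinEquiv_symm_apply_val, Fin.rev_last, child]
    simp
    omega
  rw [h0, h1]
  congr 1
  refine Finset.prod_congr rfl fun l _ => ?_
  have d1 : finFunctionFinEquiv.symm a' (Fin.castSucc l) = finFunctionFinEquiv.symm a l := by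
    ext
    simp only [finFunctionFinEquiv_symm_apply_val, Fin.val_castSucc, ha]
    have hpow : (2 : ℕ) ^ n = 2 ^ (l : ℕ) * (2 * 2 ^ (n - l - 1)) := by
      rw [← pow_succ', ← pow_add]; congr 1; have := l.2; omega
    rw [show (ε : ℕ) * 2 ^ n = 2 ^ (l : ℕ) * (2 * (ε * 2 ^ (n - l - 1))) by
      rw [hpow]; ring, Nat.add_mul_div_left _ _ (by positivity)]
    omega
  have d2 : finFunctionFinEquiv.symm (child ε' b) (Fin.rev (Fin.castSucc l)) =
      finFunctionFinEquiv.symm b l.rev := by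
    ext
    rw [Fin.rev_castSucc]
    simp only [finFunctionFinEquiv_symm_apply_val, Fin.val_succ, child]
    rw [pow_succ', ← Nat.div_div_eq_div_mul]
    congr 2
    omega
  rw [d1, d2]

/-- Each output pair of the transform of length `2 ^ (n + 1)` combines the same output of the
transforms of the two halves of the input, as the sum and the second summand. -/
lemma vecMul_polarMatrix_child (q n : ℕ) (x : Fin (2 ^ (n + 1)) → ZMod q) (ε : Fin 2)
    (b : Fin (2 ^ n)) :
    Matrix.vecMul x (polarMatrix q (n + 1)) (child ε b) =
      (if ε = 0 then Matrix.vecMul (fun a => x ((halves n).symm (.inl a))) (polarMatrix q n) b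
        else 0) +
        Matrix.vecMul (fun a => x ((halves n).symm (.inr a))) (polarMatrix q n) b := by
  simp only [Matrix.vecMul, dotProduct]
  rw [← Equiv.sum_comp (halves n).symm, Fintype.sum_sum_type]
  congr 1
  · have h : ∀ a : Fin (2 ^ n), polarMatrix q (n + 1) ((halves n).symm (.inl a)) (child ε b) =
        polarMatrix q n a b * if ε = 0 then 1 else 0 := by
      intro a
      rw [polarMatrix_succ q n 0 ε a b _ (by simp [halves])]
      fin_cases ε <;> rfl
    simp only [h]
    split_ifs with h0
    · simp only [mul_one]
    · simp only [mul_zero, Finset.sum_const_zero]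
  · have h : ∀ a : Fin (2 ^ n), polarMatrix q (n + 1) ((halves n).symm (.inr a)) (child ε b) =
        polarMatrix q n a b := by
      intro a
      rw [polarMatrix_succ q n 1 ε a b _ (by simp [halves])]
      fin_cases ε <;> simp
    simp only [h]

lemma vecMul_polarMatrix_injective (q n : ℕ) :
    Function.Injective fun x : Fin (2 ^ n) → ZMod q => Matrix.vecMul x (polarMatrix q n) := by
  induction n with
  | zero =>
    intro x x' h
    have h' : ∀ (x : Fin 1 → ZMod q) (a : Fin 1), Matrix.vecMul x (polarMatrix q 0) a = x a := by
      intro x a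
      change ∑ b : Fin 1, x b * polarMatrix q 0 b a = x a
      rw [Fin.sum_univ_one, show a = 0 from Subsingleton.elim _ _]
      simp [polarMatrix]
    exact (funext (h' x)).symm.trans (Eq.trans h (funext (h' x')))
  | succ n ih =>
    intro x x' h
    have h1 : (fun a => x ((halves n).symm (.inr a))) = fun a => x' ((halves n).symm (.inr a)) := by
      apply ih
      funext b
      have := congrFun h (child 1 b)
      simp only [vecMul_polarMatrix_child] at this
      simpa using this
    have h0 : (fun a => x ((halves n).symm (.inl a))) = fun a => x' ((halves n).symm (.inl a)) := by
      apply ih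
      funext b
      have := congrFun h (child 0 b)
      simp only [vecMul_polarMatrix_child, h1] at this
      simpa using this
    funext a
    obtain ⟨b, rfl⟩ := (halves n).symm.surjective a
    rcases b with b | b
    · exact congrFun h0 b
    · exact congrFun h1 b

lemma polarTransform_bijective (q n : ℕ) [NeZero q] : Function.Bijective (polarTransform q n) :=
  Finite.injective_iff_bijective.1 (vecMul_polarMatrix_injective q n)

end Polar

/-! ### Good and bad symbols -/

section GoodBad

variable {q n k : ℕ} [NeZero q] {Y : Type*} [Fintype Y]

/-- The threshold `2 ^ (-N ^ β)`, `N = 2 ^ n`. -/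
def threshold (n : ℕ) (β : ℝ) : ℝ := (2 : ℝ) ^ (-((2 ^ n : ℝ) ^ β))

lemma threshold_pos (n : ℕ) (β : ℝ) : 0 < threshold n β := Real.rpow_pos_of_pos (by norm_num) _

lemma threshold_le_half (n : ℕ) {β : ℝ} (hβ : 0 ≤ β) : threshold n β ≤ 1 / 2 := by
  have h : (1 : ℝ) ≤ (2 ^ n : ℝ) ^ β := Real.one_le_rpow (one_le_pow₀ (by norm_num)) hβ
  calc threshold n β ≤ (2 : ℝ) ^ (-1 : ℝ) :=
        Real.rpow_le_rpow_of_exponent_le (by norm_num) (by linarith)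
    _ = 1 / 2 := by norm_num [Real.rpow_neg_one]

lemma threshold_anti (n : ℕ) {β β' : ℝ} (h : β ≤ β') : threshold n β' ≤ threshold n β :=
  Real.rpow_le_rpow_of_exponent_le (by norm_num) (neg_le_neg
    (Real.rpow_le_rpow_of_exponent_le (one_le_pow₀ (by norm_num)) h))

lemma Scheme.good_iff {s : Scheme q n k} (hs : s.IsBijective) (β : ℝ)
    (P : ZMod q → ZMod q → PMF Y) (S : Perm n k) (v : Var n k) :
    s.Good β P S v ↔ s.symbolEnt P S v < threshold n β * Real.log q := by
  have h2 : 0 < Real.log 2 := Real.log_pos (by norm_num)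
  unfold Scheme.Good
  rw [Scheme.symbolInfo_eq hs, Real.logb, lt_div_iff₀ h2]
  change (1 - threshold n β) * (Real.log q / Real.log 2) * Real.log 2 < _ ↔ _
  rw [mul_assoc, div_mul_cancel₀ _ h2.ne']
  constructor <;> intro h <;> linarith

lemma Scheme.bad_iff {s : Scheme q n k} (hs : s.IsBijective) (β : ℝ)
    (P : ZMod q → ZMod q → PMF Y) (S : Perm n k) (v : Var n k) :
    s.Bad β P S v ↔ Real.log q - s.symbolEnt P S v < threshold n β * Real.log q := by
  have h2 : 0 < Real.log 2 := Real.log_pos (by norm_num)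
  unfold Scheme.Bad
  rw [Scheme.symbolInfo_eq hs, Real.logb, div_lt_iff₀ h2]
  change _ < threshold n β * (Real.log q / Real.log 2) * Real.log 2 ↔ _
  rw [mul_assoc, div_mul_cancel₀ _ h2.ne']

lemma Scheme.rate_eq {s : Scheme q n k} (hs : s.IsBijective) (P : ZMod q → ZMod q → PMF Y)
    (S : Perm n k) (j : Fin 2) :
    s.rate P S j =
      (∑ i, (Real.log q - s.symbolEnt P S (j, i))) / (2 ^ k * 2 ^ n) / Real.log 2 := by
  unfold Scheme.rate
  simp only [Scheme.symbolInfo_eq hs]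
  rw [← Finset.sum_div]
  ring

end GoodBad

/-! ### Polar splitting -/

/-- Positions in the order given by an injective key. -/
lemma exists_equiv_of_key {α L : Type*} [Fintype α] [LinearOrder L] {m : ℕ}
    (hcard : Fintype.card α = m) (key : α → L) (hkey : Function.Injective key) :
    ∃ e : α ≃ Fin m, ∀ v w, e v < e w ↔ key v < key w := by
  let _ : LinearOrder α := LinearOrder.lift' key hkey
  let e := (Fintype.orderIsoFinOfCardEq α hcard).symm
  exact ⟨e.toEquiv, fun v w => e.lt_iff_lt⟩

lemma card_idx (n k : ℕ) : Fintype.card (Idx n k) = 2 ^ k * 2 ^ n := by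
  induction k with
  | zero => exact (Fintype.card_fin _).trans (by simp)
  | succ k ih =>
    have : Fintype.card (Idx n (k + 1)) = Fintype.card (Idx n k) + Fintype.card (Idx n k) :=
      Fintype.card_sum
    rw [this, ih, pow_succ]
    ring

lemma exists_perm_of_key {n k : ℕ} {L : Type*} [LinearOrder L] (key : Var n k → L)
    (hkey : Function.Injective key) : ∃ S : Perm n k, ∀ v w, S v < S w ↔ key v < key w :=
  exists_equiv_of_key (by rw [Fintype.card_prod, card_idx, Fintype.card_fin]) key hkey

/-- The position of a symbol in `(U^i, V^N, U_{i+1}^N)`, with a gap when `N < i`. -/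
def splitKey {n : ℕ} (i : ℕ) (v : Fin 2 × Fin (2 ^ n)) : ℕ :=
  if v.1 = 0 then (if (v.2 : ℕ) < i then v.2 else v.2 + 2 ^ n) else i + v.2

lemma splitKey_zero {n : ℕ} (i : ℕ) (a : Fin (2 ^ n)) :
    splitKey i (0, a) = if (a : ℕ) < i then (a : ℕ) else a + 2 ^ n := rfl

lemma splitKey_one {n : ℕ} (i : ℕ) (a : Fin (2 ^ n)) : splitKey i (1, a) = i + a := rfl

lemma splitKey_injective (n i : ℕ) : Function.Injective (splitKey (n := n) i) := by
  rintro ⟨j, a⟩ ⟨j', a'⟩ h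
  have ha := a.2
  have ha' := a'.2
  fin_cases j <;> fin_cases j' <;> simp only [Fin.zero_eta, Fin.mk_one, splitKey_zero,
    splitKey_one] at h ⊢
  · split_ifs at h <;> simp only [Prod.mk.injEq, Fin.ext_iff, true_and] <;> omega
  · split_ifs at h <;> omega
  · split_ifs at h <;> omega
  · simp only [Prod.mk.injEq, Fin.ext_iff, true_and]; omega

lemma IsSplit.lt_iff {n i : ℕ} {S : Perm n 0} (h : IsSplit i S) (v w : Fin 2 × Fin (2 ^ n)) :
    S v < S w ↔ splitKey i v < splitKey i w := by
  obtain ⟨h0, h1, h2⟩ := h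
  obtain ⟨j, a⟩ := v
  obtain ⟨j', a'⟩ := w
  have ha := a.2
  have ha' := a'.2
  fin_cases j <;> fin_cases j' <;> simp only [Fin.zero_eta, Fin.mk_one]
  · refine (h0 a a').trans ?_
    rw [splitKey_zero, splitKey_zero, Fin.lt_def]
    split_ifs <;> omega
  · refine (h2 a a').trans ?_
    rw [splitKey_zero, splitKey_one]
    split_ifs <;> omega
  · have h3 : S (1, a) < S (0, a') ↔ ¬ S (0, a') < S (1, a) := by
      rw [not_lt]
      refine ⟨le_of_lt, fun h => lt_of_le_of_ne h fun he => ?_⟩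
      have := congrArg Prod.fst (S.injective he)
      simp at this
    refine h3.trans ((not_congr (h2 a' a)).trans ?_)
    rw [splitKey_zero, splitKey_one]
    split_ifs <;> omega
  · refine (h1 a a').trans ?_
    rw [splitKey_one, splitKey_one, Fin.lt_def]
    omega

/-- The order `(U^i, V^N, U_{i+1}^N)`. -/
def splitPerm (n i : ℕ) : Perm n 0 :=
  (exists_perm_of_key (n := n) (k := 0) (splitKey i) (splitKey_injective n i)).choose

lemma isSplit_splitPerm (n i : ℕ) : IsSplit i (splitPerm n i) := by
  have h : ∀ v w : Fin 2 × Fin (2 ^ n), splitPerm n i v < splitPerm n i w ↔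
      splitKey i v < splitKey i w :=
    (exists_perm_of_key (n := n) (k := 0) (splitKey i) (splitKey_injective n i)).choose_spec
  refine ⟨fun a b => (h (0, a) (0, b)).trans ?_, fun a b => (h (1, a) (1, b)).trans ?_,
    fun a b => (h (0, a) (1, b)).trans ?_⟩
  · have := a.2
    have := b.2
    rw [splitKey_zero, splitKey_zero, Fin.lt_def]
    split_ifs <;> omega
  · rw [splitKey_one, splitKey_one, Fin.lt_def]
    omega
  · rw [splitKey_zero, splitKey_one]
    split_ifs <;> omega

/-- The scheme without alignment, with splitting indices `i` and `i'`. -/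
def splitScheme (q n i i' : ℕ) : Scheme q n 0 :=
  ⟨fun _ => polarTransform q n, splitPerm n i, splitPerm n i'⟩

section Split

variable {q : ℕ} [NeZero q] {Y : Type*} [Fintype Y] (P : ZMod q → ZMod q → PMF Y)

/-- The polar-transformed symbols of one block. -/
def polarSym (q n : ℕ) (Y : Type*) (v : Fin 2 × Fin (2 ^ n))
    (ω : (Fin 2 → Fin (2 ^ n) → ZMod q) × (Fin (2 ^ n) → Y)) : ZMod q :=
  Matrix.vecMul (ω.1 v.1) (polarMatrix q n) v.2

/-- The joint law of a symbol of a split block and of what is known when it is decoded. -/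
def splitFam (n i : ℕ) (v : Fin 2 × Fin (2 ^ n)) :
    (Fin (2 ^ n) → Y) ×
      ({w : Fin 2 × Fin (2 ^ n) // splitKey i w < splitKey i v} → ZMod q) → ZMod q → ℝ :=
  symFam (chanWt P (Fin (2 ^ n))) (polarSym q n Y) (fun ω => ω.2) (splitKey i) v

lemma isLaw_splitFam (n i : ℕ) (v : Fin 2 × Fin (2 ^ n)) : IsLaw (splitFam P n i v) :=
  isLaw_fam (chanWt_nonneg P _) (sum_chanWt P _) _ _

lemma symFam_equiv_of_pos {Ω V B L L' : Type*} [Fintype Ω] [Fintype V] [DecidableEq V]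
    [Fintype B] [LinearOrder L] [LinearOrder L'] (μ : Ω → ℝ) (sym : V → Ω → ZMod q) (y : Ω → B)
    {pos : V → L} {pos' : V → L'} {v : V} (h : ∀ w, pos w < pos v ↔ pos' w < pos' v) :
    FamEquiv (symFam μ sym y pos v) (symFam μ sym y pos' v) :=
  famEquiv_of_ker _ _ fun ω ω' => by simp only [pastInfo_eq_iff, h]

/-- Up to its position numbers, the decoding order of a split is given by `splitKey`. -/
lemma symbolEnt_of_isSplit {n i : ℕ} {s : Scheme q n 0}
    (hs : ∀ j, s.transform j = polarTransform q n) {S : Perm n 0} (hS : IsSplit i S)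
    (v : Fin 2 × Fin (2 ^ n)) : s.symbolEnt P S v = famEnt (splitFam P n i v) := by
  have e : (fun (v : Var n 0) (ω : (Fin 2 → Idx n 0 → ZMod q) × (Idx n 0 → Y)) =>
      s.symbol v ω.1) = polarSym q n Y := by
    funext v ω
    exact congrFun (congrFun (hs v.1) (ω.1 v.1)) v.2
  unfold Scheme.symbolEnt
  rw [e]
  exact (symFam_equiv_of_pos (V := Fin 2 × Fin (2 ^ n)) (chanWt P (Fin (2 ^ n))) (polarSym q n Y)
    (fun ω => ω.2) (pos := S) (pos' := splitKey i) fun w => hS.lt_iff w v).famEnt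

/-- Doubling the block length of a split block pairs each symbol with its own copy. -/
lemma mergeData_split (n i : ℕ) :
    MergeData (chanWt P (Fin (2 ^ n))) (chanWt P (Fin (2 ^ (n + 1)))) (polarSym q n Y)
      (polarSym q (n + 1) Y) (fun ω => ω.2) (fun ω => ω.2) (splitKey i) (splitKey (2 * i))
      (fun v => (v.1, child 0 v.2)) (fun v => (v.1, child 1 v.2)) some
      (splitUses q Y (halves n)) where
  wt ω := chanWt_splitUses P (halves n) ω
  sum_wt := sum_chanWt P _
  wt_nonneg := chanWt_nonneg P _
  out ω ω' := splitUses_out (halves n) ω ω'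
  cover v' := by
    obtain ⟨j, b⟩ := v'
    rcases child_cases b with ⟨a, h⟩ | ⟨a, h⟩
    · exact Or.inl ⟨(j, a), Prod.ext rfl h⟩
    · exact Or.inr ⟨(j, a), Prod.ext rfl h⟩
  ne v w h := by
    simp only [Prod.mk.injEq, child, Fin.ext_iff] at h
    have := h.2
    simp at this
    omega
  inj_r v w h := by
    simp only [Prod.mk.injEq, child, Fin.ext_iff] at h
    exact Prod.ext (Fin.ext h.1) (Fin.ext (by omega))
  inj := splitKey_injective (n + 1) (2 * i)
  pos_l v w := by
    obtain ⟨j, a, ha⟩ := v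
    obtain ⟨j', b, hb⟩ := w
    have hp := pow_succ 2 n
    fin_cases j <;> fin_cases j' <;> simp only [Fin.zero_eta, Fin.mk_one, splitKey_zero,
      splitKey_one, child, Fin.val_zero] <;> (try split_ifs) <;> omega
  pos_r v w := by
    obtain ⟨j, a, ha⟩ := v
    obtain ⟨j', b, hb⟩ := w
    have hp := pow_succ 2 n
    fin_cases j <;> fin_cases j' <;> simp only [Fin.zero_eta, Fin.mk_one, splitKey_zero,
      splitKey_one, child, Fin.val_one] <;> (try split_ifs) <;> omega
  adj c d hcd u := by
    obtain rfl : c = d := by simpa using hcd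
    obtain ⟨j, a, ha⟩ := c
    obtain ⟨j', b, hb⟩ := u
    have hp := pow_succ 2 n
    fin_cases j <;> fin_cases j' <;> simp only [Fin.zero_eta, Fin.mk_one, splitKey_zero,
      splitKey_one, child, Fin.val_one, Fin.val_zero, Prod.mk.injEq, Fin.ext_iff, true_and,
      zero_ne_one, one_ne_zero, false_and, or_false] <;> (try split_ifs) <;> omega
  sym_l v ω := by
    refine (vecMul_polarMatrix_child q n (ω.1 v.1) 0 v.2).trans ?_
    rw [if_pos rfl]
    rfl
  sym_r v ω := by
    refine (vecMul_polarMatrix_child q n (ω.1 v.1) 1 v.2).trans ?_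
    rw [if_neg (by norm_num), zero_add]
    rfl

end Split

/-! ### Rates of split schemes -/

section ChainRule

variable {q : ℕ} [NeZero q] {Ω V B C L : Type*} [Fintype Ω] [Fintype V] [DecidableEq V]
  [Fintype B] [Fintype C] [LinearOrder L]

/-- The joint entropy of the output and of the symbols in `s`. -/
def jointEnt (μ : Ω → ℝ) (sym : V → Ω → ZMod q) (y : Ω → B) (s : Finset V) : ℝ :=
  ∑ b, Real.negMulLog (tot (fam μ (fun _ => (0 : ZMod q)) (fun ω => (y ω, fun w : s => sym w ω)) b))

/-- The chain rule. In particular the sum does not depend on the order `pos` of the symbols. -/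
lemma sum_famEnt_symFam (μ : Ω → ℝ) (sym : V → Ω → ZMod q) (y : Ω → B) {pos : V → L}
    (hpos : Function.Injective pos) :
    ∑ v, famEnt (symFam μ sym y pos v) =
      jointEnt μ sym y Finset.univ - jointEnt μ sym y ∅ := by
  classical
  have h : ∀ s : Finset V, ∑ v ∈ s, famEnt (fam μ (sym v)
      (fun ω => (y ω, fun w : {w // w ∈ s ∧ pos w < pos v} => sym w ω))) = jointEnt μ sym y s - jointEnt μ sym y ∅ := by
    intro s
    refine Finset.induction_on_max_value pos s (by simp) fun a s ha hmax ih => ?_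
    have hlt : ∀ x ∈ s, pos x < pos a := fun x hx =>
      lt_of_le_of_ne (hmax x hx) fun h => ha (hpos h ▸ hx)
    rw [Finset.sum_insert ha]
    have h1 : ∀ v ∈ s, famEnt (fam μ (sym v)
        (fun ω => (y ω, fun w : {w // w ∈ insert a s ∧ pos w < pos v} => sym w ω))) =
        famEnt (fam μ (sym v)
        (fun ω => (y ω, fun w : {w // w ∈ s ∧ pos w < pos v} => sym w ω))) := by
      intro v hv
      refine (famEquiv_of_ker _ _ fun ω ω' => ?_).famEnt
      simp only [Prod.mk.injEq, funext_iff, Subtype.forall]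
      refine and_congr_right fun _ => forall_congr' fun w => ?_
      have : (w ∈ insert a s ∧ pos w < pos v) ↔ w ∈ s ∧ pos w < pos v := by
        rw [Finset.mem_insert]
        refine and_congr_left fun hw => or_iff_right fun h => ?_
        rw [h] at hw
        exact lt_asymm hw (hlt v hv)
      simp only [this]
    rw [Finset.sum_congr rfl h1, ih]
    have h2 : famEnt (fam μ (sym a)
        (fun ω => (y ω, fun w : {w // w ∈ insert a s ∧ pos w < pos a} => sym w ω))) =
        famEnt (fam μ (sym a) (fun ω => (y ω, fun w : s => sym w ω))) := by
      refine (famEquiv_of_ker _ _ fun ω ω' => ?_).famEnt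
      simp only [Prod.mk.injEq, funext_iff, Subtype.forall]
      refine and_congr_right fun _ => forall_congr' fun w => ?_
      have : (w ∈ insert a s ∧ pos w < pos a) ↔ w ∈ s := by
        rw [Finset.mem_insert]
        refine ⟨?_, fun h => ⟨Or.inr h, hlt w h⟩⟩
        rintro ⟨h | h, h'⟩
        · rw [h] at h'; exact absurd h' (lt_irrefl _)
        · exact h
      simp only [this]
    have h3 : famEnt (fam μ (sym a) (fun ω => (y ω, fun w : s => sym w ω))) =
        jointEnt μ sym y (insert a s) - jointEnt μ sym y s := by
      unfold famEnt cent
      rw [Finset.sum_sub_distrib]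
      -- reading the symbols of `insert a s` as the symbol `a` and the symbols of `s`
      have hker := famEquiv_of_ker μ (fun _ => (0 : ZMod q))
        (Y := fun ω => ((y ω, fun w : s => sym w ω), sym a ω))
        (Y' := fun ω => (y ω, fun w : ↥(insert a s) => sym w ω)) (by
          intro ω ω'
          simp only [Prod.mk.injEq, funext_iff, Subtype.forall, Finset.mem_insert,
            forall_eq_or_imp]
          tauto)
      have hk := hker (fun p => Real.negMulLog (tot p)) (by simp [tot])
      rw [Fintype.sum_prod_type] at hk
      congr 1
      · rw [jointEnt, ← hk]
        refine Finset.sum_congr rfl fun b _ => Finset.sum_congr rfl fun x _ => ?_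
        rw [tot_fam]
        congr 1
        refine Finset.sum_congr rfl fun ω _ => ?_
        congr! 1
        simp only [Prod.ext_iff, and_comm]
      · simp only [jointEnt, tot_fam]
    rw [h2, h3]
    ring
  rw [← h Finset.univ]
  refine Finset.sum_congr rfl fun v _ => (famEquiv_of_ker _ _ fun ω ω' => ?_).famEnt
  rw [pastInfo_eq_iff]
  simp [funext_iff]

end ChainRule

section SplitRates

variable {q : ℕ} [NeZero q] {Y : Type*} [Fintype Y] (P : ZMod q → ZMod q → PMF Y)

/-- The sum of the conditional entropies of the symbols of sender `j`. -/
def splitEnt (n i : ℕ) (j : Fin 2) : ℝ := ∑ a, famEnt (splitFam P n i (j, a))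

lemma sum_child {n : ℕ} (g : Fin (2 ^ (n + 1)) → ℝ) :
    ∑ b, g b = ∑ a, (g (child 0 a) + g (child 1 a)) := by
  rw [← Equiv.sum_comp ((finProdFinEquiv (m := 2 ^ n) (n := 2)).trans
    (finCongr (pow_succ 2 n).symm)) g, Fintype.sum_prod_type]
  refine Finset.sum_congr rfl fun a _ => ?_
  rw [Fin.sum_univ_two]
  congr 2 <;> exact Fin.ext (by simp [child, add_comm])

/-- Doubling the block length with the split point preserves the mean entropy of each sender. -/
lemma splitEnt_two_mul (n i : ℕ) (j : Fin 2) :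
    splitEnt P (n + 1) (2 * i) j = 2 * splitEnt P n i j := by
  unfold splitEnt
  rw [sum_child, Finset.mul_sum]
  refine Finset.sum_congr rfl fun a _ => ?_
  have := (mergeData_split P n i).famEnt_add (c := (j, a)) (d := (j, a)) rfl
  exact this.trans (two_mul _).symm

lemma splitEnt_pow_mul (n i m : ℕ) (j : Fin 2) :
    splitEnt P (n + m) (i * 2 ^ m) j = 2 ^ m * splitEnt P n i j := by
  induction m with
  | zero => simp
  | succ m ih =>
    rw [show i * 2 ^ (m + 1) = 2 * (i * 2 ^ m) by ring, ← add_assoc, splitEnt_two_mul, ih]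
    ring

/-- By the chain rule the total entropy does not depend on the decoding order. -/
lemma splitEnt_add (n i i' : ℕ) :
    splitEnt P n i 0 + splitEnt P n i 1 = splitEnt P n i' 0 + splitEnt P n i' 1 := by
  have h : ∀ i, splitEnt P n i 0 + splitEnt P n i 1 = ∑ v, famEnt (splitFam P n i v) := by
    intro i
    rw [Fintype.sum_prod_type, Fin.sum_univ_two]
    rfl
  rw [h, h]
  unfold splitFam
  rw [sum_famEnt_symFam _ _ _ (splitKey_injective n i),
    sum_famEnt_symFam _ _ _ (splitKey_injective n i')]

/-- Moving the split by one position changes the past of a single symbol of the first sender. -/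
lemma abs_splitEnt_succ_sub_le (n i : ℕ) :
    |splitEnt P n (i + 1) 0 - splitEnt P n i 0| ≤ Real.log q := by
  have hsame : ∀ a : Fin (2 ^ n), (a : ℕ) ≠ i →
      famEnt (splitFam P n (i + 1) (0, a)) = famEnt (splitFam P n i (0, a)) := by
    intro a ha
    refine (symFam_equiv_of_pos _ _ _ fun w => ?_).famEnt
    obtain ⟨j, b⟩ := w
    have hb := b.2
    have ha' := a.2
    fin_cases j <;> simp only [Fin.zero_eta, Fin.mk_one, splitKey_zero, splitKey_one] <;>
      split_ifs <;> omega
  have hbd : ∀ i (a : Fin (2 ^ n)), 0 ≤ famEnt (splitFam P n i (0, a)) ∧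
      famEnt (splitFam P n i (0, a)) ≤ Real.log q := fun i a =>
    ⟨famEnt_nonneg (isLaw_splitFam P n i _), famEnt_le (isLaw_splitFam P n i _)⟩
  unfold splitEnt
  rw [← Finset.sum_sub_distrib]
  by_cases hi : i < 2 ^ n
  · rw [Finset.sum_eq_single ⟨i, hi⟩]
    · have h1 := hbd (i + 1) ⟨i, hi⟩
      have h2 := hbd i ⟨i, hi⟩
      rw [abs_le]
      constructor <;> linarith [h1.1, h1.2, h2.1, h2.2]
    · intro a _ ha
      rw [hsame a fun h => ha (Fin.ext h), sub_self]
    · simp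
  · rw [Finset.sum_eq_zero fun a _ => by
      rw [hsame a (by have := a.2; omega), sub_self], abs_zero]
    exact Real.log_natCast_nonneg q

/-- A discrete intermediate value theorem. -/
lemma exists_abs_sub_le_of_steps {f : ℕ → ℝ} {δ x : ℝ} (hf : ∀ i, |f (i + 1) - f i| ≤ δ) {N : ℕ}
    (h0 : f 0 ≤ x) (hN : x ≤ f N) : ∃ i ≤ N, |f i - x| ≤ δ := by
  classical
  have hex : ∃ i, x ≤ f i := ⟨N, hN⟩
  have hδ : 0 ≤ δ := (abs_nonneg _).trans (hf 0)
  refine ⟨Nat.find hex, Nat.find_min' hex hN, ?_⟩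
  have h1 := Nat.find_spec hex
  rcases hi : Nat.find hex with _ | i
  · rw [hi] at h1
    rw [le_antisymm h0 h1, sub_self, abs_zero]
    exact hδ
  · rw [hi] at h1
    have h2 : f i < x := not_le.1 (Nat.find_min hex (by omega))
    have h3 := hf i
    rw [abs_le] at h3 ⊢
    constructor <;> linarith [h3.1, h3.2]

/-- `H(X | Y, W)` for one use of the channel with uniform inputs. -/
def entFst : ℝ := splitEnt P 0 0 0

/-- `H(W | Y, X)` for one use of the channel with uniform inputs. -/
def entSnd : ℝ := splitEnt P 0 1 1

/-- `H(X, W | Y)` for one use of the channel with uniform inputs. -/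
def entSum : ℝ := splitEnt P 0 0 0 + splitEnt P 0 0 1

/-- `H(X | Y)` is at least `H(X | Y, W)`. -/
lemma entFst_add_entSnd_le : entFst P + entSnd P ≤ entSum P := by
  have h : entFst P ≤ splitEnt P 0 1 0 := by
    unfold entFst splitEnt
    refine Finset.sum_le_sum fun a _ => ?_
    have h1 : famEnt (splitFam P 0 0 (0, a)) = famEnt (fam (chanWt P (Fin (2 ^ 0)))
        (polarSym q 0 Y (0, a)) fun ω => (pastInfo (polarSym q 0 Y) (fun ω => ω.2) (splitKey 1)
          (0, a) ω, fun b => polarSym q 0 Y (1, b) ω)) := by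
      refine (famEquiv_of_ker _ _ fun ω ω' => ?_).famEnt
      simp only [Prod.mk.injEq, pastInfo_eq_iff, funext_iff, and_assoc]
      refine and_congr_right fun _ => ?_
      constructor
      · intro h
        refine ⟨fun w hw => h w ?_, fun b => h (1, b) ?_⟩
        · obtain ⟨j, b⟩ := w
          have ha := a.2
          have hb := b.2
          revert hw
          fin_cases j <;> simp only [Fin.zero_eta, Fin.mk_one, splitKey_zero, splitKey_one] <;>
            split_ifs <;> omega
        · have ha := a.2
          have hb := b.2
          simp only [splitKey_zero, splitKey_one]
          split_ifs <;> omega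
      · rintro ⟨_, h2⟩ ⟨j, b⟩ hw
        have hj : j = 1 := by
          have ha := a.2
          have hb := b.2
          fin_cases j
          · simp only [Fin.zero_eta, splitKey_zero] at hw
            split_ifs at hw <;> omega
          · rfl
        subst hj
        exact h2 b
    rw [h1]
    exact famEnt_fam_le (chanWt_nonneg P _) _ _ _
  have h2 := splitEnt_add P 0 0 1
  unfold entSum entSnd
  linarith

/-- Every rate between the corner points of the pentagon is approximated by a split. -/
lemma exists_split_approx (n : ℕ) {g : ℝ} (h1 : entFst P ≤ g) (h2 : g ≤ entSum P - entSnd P) :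
    ∃ i ≤ 2 ^ n, |splitEnt P n i 0 / 2 ^ n - g| ≤ Real.log q / 2 ^ n ∧
      splitEnt P n i 1 / 2 ^ n = entSum P - splitEnt P n i 0 / 2 ^ n := by
  have hp : (0 : ℝ) < 2 ^ n := by positivity
  have e0 := splitEnt_pow_mul P 0 0 n
  have e1 := splitEnt_pow_mul P 0 1 n 0
  simp only [zero_add, zero_mul, one_mul] at e0 e1
  have e2 := splitEnt_add P 0 0 1
  obtain ⟨i, hi, h⟩ := exists_abs_sub_le_of_steps (f := fun i => splitEnt P n i 0)
    (x := 2 ^ n * g) (abs_splitEnt_succ_sub_le P n) (N := 2 ^ n)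
    (by rw [e0]; exact mul_le_mul_of_nonneg_left h1 hp.le)
    (by
      rw [e1]
      refine mul_le_mul_of_nonneg_left ?_ hp.le
      unfold entSum entSnd at h2
      linarith)
  refine ⟨i, hi, ?_, ?_⟩
  · rw [show splitEnt P n i 0 / 2 ^ n - g = (splitEnt P n i 0 - 2 ^ n * g) / 2 ^ n by
      field_simp, abs_div, abs_of_pos hp]
    gcongr
  · have e3 := splitEnt_add P n i 0
    rw [e0 0, e0 1] at e3
    unfold entSum
    field_simp
    linarith

end SplitRates

/-! ### Polarization of split schemes -/

section SplitPolarization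

variable {q : ℕ} {Y : Type*} [Fintype Y]

/-- The symbols of all block lengths `2 ^ (n + m)`, as the nodes of a binary forest. -/
abbrev SplitTree (n : ℕ) : Type := Σ m : ℕ, Fin 2 × Fin (2 ^ (n + m))

/-- The two symbols of twice the block length made from a symbol and its copy. -/
def SplitTree.child {n : ℕ} (ε : Fin 2) (W : SplitTree n) : SplitTree n :=
  ⟨W.1 + 1, W.2.1, CompoundMAC.child ε W.2.2⟩

/-- The descendants `m` levels below the symbols of length `2 ^ n` are the symbols of length
`2 ^ (n + m)`. -/
lemma sum_iterate_childAvg {n : ℕ} (f : SplitTree n → ℝ) (m : ℕ) (j : Fin 2) :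
    ∑ a : Fin (2 ^ n), (childAvg (SplitTree.child 0) (SplitTree.child 1))^[m] f ⟨0, j, a⟩ =
      (∑ a : Fin (2 ^ (n + m)), f ⟨m, j, a⟩) / 2 ^ m := by
  induction m generalizing f with
  | zero => simp
  | succ m ih =>
    simp only [Function.iterate_succ_apply]
    rw [ih, pow_succ, mul_comm, ← div_div]
    congr 1
    refine Eq.trans ?_ (congrArg (· / (2 : ℝ)) (sum_child (n := n + m)
      fun b => f ⟨m + 1, j, b⟩)).symm
    rw [Finset.sum_div]
    rfl

/-- The factor `2 ^ (β n)` accounts for the block length `2 ^ n` at which polarization starts, the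
summand 1 for the factor `log q`. -/
lemma le_threshold_mul_log (hq : q.Prime) (n m : ℕ) {β x : ℝ} (hβ : 0 ≤ β)
    (hx : x ≤ Real.exp (-((2 ^ (β * n) + 1) * 2 ^ (β * m)))) :
    x < threshold (n + m) β * Real.log q := by
  have hlog2 : (1 : ℝ) / 2 < Real.log 2 := by linarith [Real.log_two_gt_d9]
  have hlog2' : Real.log 2 < 1 := by linarith [Real.log_two_lt_d9]
  have hlogq : Real.log 2 ≤ Real.log q :=
    Real.log_le_log (by norm_num) (by exact_mod_cast hq.two_le)
  have hN : ((2 : ℝ) ^ (n + m)) ^ β = 2 ^ (β * n) * 2 ^ (β * m) := by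
    rw [← Real.rpow_natCast, ← Real.rpow_mul (by norm_num), ← Real.rpow_add (by norm_num)]
    congr 1; push_cast; ring
  have h1 : (1 : ℝ) ≤ 2 ^ (β * m) := Real.one_le_rpow (by norm_num) (by positivity)
  have h0 : (0 : ℝ) < 2 ^ (β * n) * 2 ^ (β * m) := by positivity
  have e : threshold (n + m) β = Real.exp (-(Real.log 2 * (2 ^ (β * n) * 2 ^ (β * m)))) := by
    rw [threshold, hN, Real.rpow_def_of_pos (by norm_num)]; congr 1; ring
  have h2 : Real.exp (-((2 ^ (β * n) + 1) * 2 ^ (β * m))) ≤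
      threshold (n + m) β * Real.exp (-1) := by
    rw [e, ← Real.exp_add]
    exact Real.exp_le_exp.2 (by nlinarith)
  have h3 : Real.exp (-1) < Real.log q := by
    have : Real.exp (-1) ≤ 1 / 2 := by
      rw [Real.exp_neg, ← one_div]
      exact one_div_le_one_div_of_le (by norm_num) (by linarith [Real.add_one_le_exp (1 : ℝ)])
    linarith
  exact (hx.trans h2).trans_lt (mul_lt_mul_of_pos_left h3 (threshold_pos _ _))

open Classical in
/-- Almost all symbols of a split scheme are good or bad once the block length has been doubled
sufficiently often. -/
theorem exists_split_polarization [Fact q.Prime] (P : ZMod q → ZMod q → PMF Y) {β ε : ℝ}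
    (hβ0 : 0 ≤ β) (hβ : β < 1 / 2) (hε : 0 < ε) (n i : ℕ) :
    ∃ m₀ : ℕ, ∀ m ≥ m₀, ∀ j : Fin 2,
      ((Finset.univ.filter fun a : Fin (2 ^ (n + m)) =>
        ¬ (famEnt (splitFam P (n + m) (i * 2 ^ m) (j, a)) < threshold (n + m) β * Real.log q ∨
          Real.log q - famEnt (splitFam P (n + m) (i * 2 ^ m) (j, a)) <
            threshold (n + m) β * Real.log q)).card : ℝ) ≤ ε * 2 ^ (n + m) := by
  have hq : q.Prime := Fact.out
  have hq1 : (1 : ℝ) ≤ q := by exact_mod_cast hq.one_le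
  have hgainex : ∀ ζ : ℝ, ∃ η > 0, 0 < ζ → ∀ (v : SplitTree n),
      famEnt (minusFam (splitFam P (n + v.1) (i * 2 ^ v.1) v.2)
        (splitFam P (n + v.1) (i * 2 ^ v.1) v.2)) -
        famEnt (splitFam P (n + v.1) (i * 2 ^ v.1) v.2) ≤ η →
      famBhat (splitFam P (n + v.1) (i * 2 ^ v.1) v.2) ≤ ζ ∨
        famDev (splitFam P (n + v.1) (i * 2 ^ v.1) v.2) ≤ ζ := by
    intro ζ
    by_cases hζ : 0 < ζ
    · obtain ⟨η, hη, h⟩ := exists_gain_dichotomy q hζ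
      exact ⟨η, hη, fun _ v => h (isLaw_splitFam P _ _ _)⟩
    · exact ⟨1, one_pos, fun h => absurd h hζ⟩
  choose gain hgain0 hgain using hgainex
  -- `κ` pays for the initial block length `2 ^ n` and for the factor `q` between the entropy defect
  -- and the distance from uniform
  set κ : ℝ := 2 ^ (β * n) + Real.log q + 1 with hκ
  have hlogq : 0 ≤ Real.log q := Real.log_natCast_nonneg q
  have hκ0 : 0 < κ := by positivity
  -- `q + 4` bounds both growth factors, `q + 1` of `famBhat` and 4 of `famDev`
  obtain ⟨m₀, hm₀⟩ := exists_polarization (C := q + 4) (c := Real.log q) hβ hβ0 (by linarith) hε gain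
    (fun ζ _ => hgain0 ζ) hκ0
  refine ⟨m₀, fun m hm j => ?_⟩
  have hlaw : ∀ W : SplitTree n, IsLaw (splitFam P (n + W.1) (i * 2 ^ W.1) W.2) :=
    fun W => isLaw_splitFam P _ _ _
  have hminus : ∀ W : SplitTree n, FamEquiv
      (splitFam P (n + (W.child 0).1) (i * 2 ^ (W.child 0).1) (W.child 0).2)
      (minusFam (splitFam P (n + W.1) (i * 2 ^ W.1) W.2)
        (splitFam P (n + W.1) (i * 2 ^ W.1) W.2)) := by
    intro W
    have h := (mergeData_split P (n + W.1) (i * 2 ^ W.1)).famEquiv_minus (c := W.2) rfl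
    rw [show 2 * (i * 2 ^ W.1) = i * 2 ^ (W.1 + 1) by ring] at h
    exact h
  have hplus : ∀ W : SplitTree n, FamEquiv
      (splitFam P (n + (W.child 1).1) (i * 2 ^ (W.child 1).1) (W.child 1).2)
      (plusFam (splitFam P (n + W.1) (i * 2 ^ W.1) W.2)
        (splitFam P (n + W.1) (i * 2 ^ W.1) W.2)) := by
    intro W
    have h := (mergeData_split P (n + W.1) (i * 2 ^ W.1)).famEquiv_plus (c := W.2) rfl
    rw [show 2 * (i * 2 ^ W.1) = i * 2 ^ (W.1 + 1) by ring] at h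
    exact h
  have hpol := hm₀ m hm (SplitTree.child (n := n) 0) (SplitTree.child 1)
    (fun W => famEnt (splitFam P (n + W.1) (i * 2 ^ W.1) W.2))
    (fun W => famBhat (splitFam P (n + W.1) (i * 2 ^ W.1) W.2))
    (fun W => famDev (splitFam P (n + W.1) (i * 2 ^ W.1) W.2))
    (fun W => famEnt_nonneg (hlaw W)) (fun W => famEnt_le (hlaw W))
    (fun W => by
      simp only [(hminus W).famEnt, (hplus W).famEnt]
      rw [famEnt_minus_add_plus (hlaw W) (hlaw W), two_mul])
    (fun W => famBhat_nonneg _)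
    (fun W => by
      simp only [(hminus W).famBhat]
      refine (famBhat_minus_le (hlaw W)).trans ?_
      exact mul_le_mul_of_nonneg_right (by linarith) (famBhat_nonneg _))
    (fun W => by
      simp only [(hplus W).famBhat]
      exact famBhat_plus_le (hlaw W))
    (fun W => famDev_nonneg _)
    (fun W => by
      simp only [(hplus W).famDev]
      refine (famDev_plus_le (hlaw W)).trans ?_
      exact mul_le_mul_of_nonneg_right (by linarith) (famDev_nonneg _))
    (fun W => by
      simp only [(hminus W).famDev]
      exact famDev_minus_le _)
    (fun ζ hζ W hW => by
      simp only [(hminus W).famEnt] at hW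
      exact hgain ζ hζ W hW)
  set l := κ * 2 ^ (β * (m : ℝ)) with hl
  have h1 : (1 : ℝ) ≤ 2 ^ (β * (m : ℝ)) := Real.one_le_rpow (by norm_num) (by positivity)
  have hlower : (2 ^ (β * n) + 1) * 2 ^ (β * (m : ℝ)) + Real.log q ≤ l := by
    rw [hl, hκ]
    nlinarith
  rw [Finset.card_filter, Nat.cast_sum]
  calc _ ≤ ∑ a : Fin (2 ^ (n + m)), (if famBhat (splitFam P (n + m) (i * 2 ^ m) (j, a)) ≤
            Real.exp (-l) ∨ famDev (splitFam P (n + m) (i * 2 ^ m) (j, a)) ≤ Real.exp (-l)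
          then (0 : ℝ) else 1) := by
        simp only [Nat.cast_ite, Nat.cast_one, Nat.cast_zero]
        refine Finset.sum_le_sum fun a _ => ?_
        split_ifs with hb hs hs
        · exact le_rfl
        · exact zero_le_one
        · exfalso
          apply hb
          rcases hs with hs | hs
          · left
            refine le_threshold_mul_log hq n m hβ0 ?_
            exact (famEnt_le_famBhat (isLaw_splitFam P _ _ _)).trans
              (hs.trans (Real.exp_le_exp.2 (by linarith)))
          · right
            refine le_threshold_mul_log hq n m hβ0 ?_
            refine (log_sub_famEnt_le (isLaw_splitFam P _ _ _)).trans ?_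
            calc (q : ℝ) * _ ≤ q * Real.exp (-l) := by gcongr
              _ = Real.exp (Real.log q - l) := by
                rw [sub_eq_add_neg, Real.exp_add, Real.exp_log (by linarith)]
              _ ≤ _ := Real.exp_le_exp.2 (by linarith)
        · exact le_rfl
    _ = 2 ^ m * ∑ a : Fin (2 ^ n), _ := by
        rw [sum_iterate_childAvg (n := n) (fun W => if famBhat (splitFam P (n + W.1)
          (i * 2 ^ W.1) W.2) ≤ Real.exp (-l) ∨ famDev (splitFam P (n + W.1) (i * 2 ^ W.1) W.2) ≤
            Real.exp (-l) then (0 : ℝ) else 1) m j]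
        field_simp
    _ ≤ 2 ^ m * ∑ a : Fin (2 ^ n), ε := by
        gcongr with a
        exact hpol ⟨0, j, a⟩
    _ = ε * 2 ^ (n + m) := by
        rw [Finset.sum_const, Finset.card_univ, Fintype.card_fin, nsmul_eq_mul, pow_add]
        push_cast
        ring

end SplitPolarization

/-! ### The decoding order of two combined copies -/

section MergeKey

variable {a : ℕ}

/-- The number of entries of `p` below `x`. -/
def countLT (p : Fin a → ℕ) (x : ℕ) : ℕ := (Finset.univ.filter fun i => p i < x).card

/-- The number of entries of `p` that are at most `x`. -/
def countLE (p : Fin a → ℕ) (x : ℕ) : ℕ := (Finset.univ.filter fun i => p i ≤ x).card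

lemma countLT_le_countLE (p : Fin a → ℕ) (x : ℕ) : countLT p x ≤ countLE p x :=
  Finset.card_le_card (Finset.monotone_filter_right _ fun _ _ h => le_of_lt h)

lemma countLE_le_countLT (p : Fin a → ℕ) {x y : ℕ} (h : x < y) : countLE p x ≤ countLT p y :=
  Finset.card_le_card (Finset.monotone_filter_right _ fun _ _ h' => lt_of_le_of_lt h' h)

lemma countLE_le (p : Fin a → ℕ) (x : ℕ) : countLE p x ≤ a :=
  (Finset.card_le_univ _).trans_eq (Fintype.card_fin a)

lemma countLE_eq_zero {p : Fin a → ℕ} {x : ℕ} (h : ∀ i, x < p i) : countLE p x = 0 := by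
  rw [countLE, Finset.card_eq_zero, Finset.filter_eq_empty_iff]
  exact fun i _ => not_le.2 (h i)

lemma countLT_eq {p : Fin a → ℕ} {x : ℕ} (h : ∀ i, p i < x) : countLT p x = a := by
  rw [countLT, Finset.filter_true_of_mem fun i _ => h i, Finset.card_univ, Fintype.card_fin]

lemma countLT_apply {p : Fin a → ℕ} (hp : StrictMono p) (i : Fin a) : countLT p (p i) = i := by
  unfold countLT
  simp only [hp.lt_iff_lt]
  exact (congrArg Finset.card (Finset.filter_gt_eq_Iio)).trans (Fin.card_Iio i)

lemma countLE_apply {p : Fin a → ℕ} (hp : StrictMono p) (i : Fin a) :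
    countLE p (p i) = i + 1 := by
  unfold countLE
  simp only [hp.le_iff_le]
  exact (congrArg Finset.card (Finset.filter_ge_eq_Iic)).trans (Fin.card_Iic i)

lemma countLE_eq_countLT {p : Fin a → ℕ} {x : ℕ} (h : ∀ i, p i ≠ x) :
    countLE p x = countLT p x := by
  unfold countLE countLT
  congr 1
  exact Finset.filter_congr fun i _ => ⟨fun h' => lt_of_le_of_ne h' (h i), le_of_lt⟩

lemma countLT_congr {p p' : Fin a → ℕ} {x x' : ℕ} (h : ∀ i, p i < x ↔ p' i < x') :
    countLT p x = countLT p' x' := by simp only [countLT, h]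

lemma countLE_congr {p p' : Fin a → ℕ} {x x' : ℕ} (h : ∀ i, p i ≤ x ↔ p' i ≤ x') :
    countLE p x = countLE p' x' := by simp only [countLE, h]

/-- The key by which two copies of a list are merged, when position `p i` of the first copy has to
come right before position `r i` of the second copy. The entries of both copies that lie between the
pairs `i - 1` and `i` get the first component `3 i`, and the pair `i` itself gets `3 i + 1`
and `3 i + 2`. -/
def mergeKey (p r : Fin a → ℕ) : ℕ ⊕ ℕ → ℕ ×ₗ ℕ
  | .inl x => toLex (2 * countLT p x + countLE p x, 2 * x)
  | .inr x => toLex (countLT r x + 2 * countLE r x, 2 * x + 1)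

variable (p r : Fin a → ℕ)

lemma mergeKey_injective : Function.Injective (mergeKey p r) := by
  rintro (x | x) (y | y) h <;> simp only [mergeKey, EmbeddingLike.apply_eq_iff_eq,
    Prod.mk.injEq] at h
  · rw [show x = y by omega]
  · omega
  · omega
  · rw [show x = y by omega]

lemma mergeKey_inl_lt_of_lt {x y : ℕ} (h : x < y) :
    mergeKey p r (.inl x) < mergeKey p r (.inl y) := by
  have h1 := countLT_le_countLE p x
  have h2 := countLT_le_countLE p y
  have h3 := countLE_le_countLT p h
  simp only [mergeKey, Prod.Lex.toLex_lt_toLex]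
  omega

lemma mergeKey_inr_lt_of_lt {x y : ℕ} (h : x < y) :
    mergeKey p r (.inr x) < mergeKey p r (.inr y) := by
  have h1 := countLT_le_countLE r x
  have h2 := countLT_le_countLE r y
  have h3 := countLE_le_countLT r h
  simp only [mergeKey, Prod.Lex.toLex_lt_toLex]
  omega

lemma mergeKey_inl_lt {x y : ℕ} : mergeKey p r (.inl x) < mergeKey p r (.inl y) ↔ x < y :=
  (show StrictMono fun x => mergeKey p r (.inl x) from
    fun _ _ h => mergeKey_inl_lt_of_lt p r h).lt_iff_lt

lemma mergeKey_inr_lt {x y : ℕ} : mergeKey p r (.inr x) < mergeKey p r (.inr y) ↔ x < y :=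
  (show StrictMono fun x => mergeKey p r (.inr x) from
    fun _ _ h => mergeKey_inr_lt_of_lt p r h).lt_iff_lt

variable {p r}

/-- In the merged order nothing comes between the two members of a pair. -/
lemma mergeKey_adj (hp : StrictMono p) (hr : StrictMono r) (i : Fin a) (u : ℕ ⊕ ℕ) :
    mergeKey p r u < mergeKey p r (.inr (r i)) ↔
      mergeKey p r u < mergeKey p r (.inl (p i)) ∨ u = .inl (p i) := by
  rcases u with x | x
  · simp only [mergeKey, Prod.Lex.toLex_lt_toLex, countLT_apply hp, countLE_apply hp,
      countLT_apply hr, countLE_apply hr, Sum.inl.injEq]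
    by_cases h : ∃ i', p i' = x
    · obtain ⟨i', rfl⟩ := h
      rw [countLT_apply hp, countLE_apply hp, hp.injective.eq_iff, Fin.ext_iff]
      have := hp.lt_iff_lt (a := i') (b := i)
      rw [Fin.lt_def] at this
      omega
    · have h' : p i ≠ x := fun h' => h ⟨i, h'⟩
      rw [countLE_eq_countLT fun i' h' => h ⟨i', h'⟩]
      omega
  · simp only [mergeKey, Prod.Lex.toLex_lt_toLex, countLT_apply hp, countLE_apply hp,
      countLT_apply hr, countLE_apply hr, reduceCtorEq, or_false]
    by_cases h : ∃ i', r i' = x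
    · obtain ⟨i', rfl⟩ := h
      rw [countLT_apply hr, countLE_apply hr]
      have := hr.lt_iff_lt (a := i') (b := i)
      rw [Fin.lt_def] at this
      omega
    · rw [countLE_eq_countLT fun i' h' => h ⟨i', h'⟩]
      omega

/-- Twice the position, with the second copy directly after the first one. -/
def copyPos : ℕ ⊕ ℕ → ℕ := Sum.elim (fun x => 2 * x) fun x => 2 * x + 1

/-- Positions outside the range of all pairs are merged as if there were no pairs. -/
lemma mergeKey_lt_of_separated {u u' : ℕ ⊕ ℕ}
    (hu : (∀ i, u.elim id id < p i ∧ u.elim id id < r i) ∨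
      ∀ i, p i < u.elim id id ∧ r i < u.elim id id)
    (hu' : (∀ i, u'.elim id id < p i ∧ u'.elim id id < r i) ∨
      ∀ i, p i < u'.elim id id ∧ r i < u'.elim id id) :
    mergeKey p r u < mergeKey p r u' ↔ copyPos u < copyPos u' := by
  have key : ∀ u : ℕ ⊕ ℕ, (∀ i, u.elim id id < p i ∧ u.elim id id < r i) →
      mergeKey p r u = toLex (0, copyPos u) := by
    rintro (x | x) h
    · have h1 := countLE_eq_zero fun i => (h i).1
      have h2 := countLT_le_countLE p x
      simp only [Sum.elim_inl, id] at h1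
      simp only [mergeKey, copyPos, Sum.elim_inl]
      rw [show countLT p x = 0 by omega, h1]
    · have h1 := countLE_eq_zero fun i => (h i).2
      have h2 := countLT_le_countLE r x
      simp only [Sum.elim_inr, id] at h1
      simp only [mergeKey, copyPos, Sum.elim_inr]
      rw [show countLT r x = 0 by omega, h1]
  have key' : ∀ u : ℕ ⊕ ℕ, (∀ i, p i < u.elim id id ∧ r i < u.elim id id) →
      mergeKey p r u = toLex (3 * a, copyPos u) := by
    rintro (x | x) h
    · have h1 := countLT_eq fun i => (h i).1
      have h2 := countLT_le_countLE p x
      have h3 := countLE_le p x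
      simp only [Sum.elim_inl, id] at h1
      simp only [mergeKey, copyPos, Sum.elim_inl]
      rw [show countLE p x = a by omega, h1]
      congr 2; omega
    · have h1 := countLT_eq fun i => (h i).2
      have h2 := countLT_le_countLE r x
      have h3 := countLE_le r x
      simp only [Sum.elim_inr, id] at h1
      simp only [mergeKey, copyPos, Sum.elim_inr]
      rw [show countLE r x = a by omega, h1]
      congr 2; omega
  rcases Nat.eq_zero_or_pos a with ha | ha
  · subst ha
    rw [key u fun i => i.elim0, key u' fun i => i.elim0, Prod.Lex.toLex_lt_toLex]
    simp
  have hlt : ∀ u u' : ℕ ⊕ ℕ, u.elim id id < u'.elim id id → copyPos u < copyPos u' := by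
    rintro (x | x) (y | y) h <;> simp only [copyPos, Sum.elim_inl, Sum.elim_inr, id] at h ⊢ <;>
      omega
  rcases hu with h | h <;> rcases hu' with h' | h'
  · rw [key u h, key u' h', Prod.Lex.toLex_lt_toLex]
    simp
  · rw [key u h, key' u' h', Prod.Lex.toLex_lt_toLex]
    have := hlt u u' ((h ⟨0, ha⟩).1.trans (h' ⟨0, ha⟩).1)
    simp only
    omega
  · rw [key' u h, key u' h', Prod.Lex.toLex_lt_toLex]
    have := hlt u' u ((h' ⟨0, ha⟩).1.trans (h ⟨0, ha⟩).1)
    simp only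
    omega
  · rw [key' u h, key' u' h', Prod.Lex.toLex_lt_toLex]
    simp

lemma mergeKey_lt_of_forall_lt {u u' : ℕ ⊕ ℕ}
    (hu : ∀ i, u.elim id id < p i ∧ u.elim id id < r i) (h : u.elim id id < u'.elim id id) :
    mergeKey p r u < mergeKey p r u' := by
  rcases u with x | x
  · have h1 := countLE_eq_zero fun i => (hu i).1
    have h2 := countLT_le_countLE p x
    rcases u' with y | y <;> simp only [Sum.elim_inl, Sum.elim_inr, id] at h h1 <;>
      simp only [mergeKey, Prod.Lex.toLex_lt_toLex] <;> omega
  · have h1 := countLE_eq_zero fun i => (hu i).2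
    have h2 := countLT_le_countLE r x
    rcases u' with y | y <;> simp only [Sum.elim_inl, Sum.elim_inr, id] at h h1 <;>
      simp only [mergeKey, Prod.Lex.toLex_lt_toLex] <;> omega

lemma mergeKey_lt_of_forall_gt {u u' : ℕ ⊕ ℕ}
    (hu : ∀ i, p i < u'.elim id id ∧ r i < u'.elim id id) (h : u.elim id id < u'.elim id id) :
    mergeKey p r u < mergeKey p r u' := by
  rcases u' with x | x
  · have h1 := countLT_eq fun i => (hu i).1
    have h2 := countLT_le_countLE p x
    rcases u with y | y <;> simp only [Sum.elim_inl, Sum.elim_inr, id] at h h1 <;>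
      simp only [mergeKey, Prod.Lex.toLex_lt_toLex] 
    · have h3 := countLE_le p y
      have h4 := countLT_le_countLE p y
      omega
    · have h3 := countLE_le r y
      have h4 := countLT_le_countLE r y
      omega
  · have h1 := countLT_eq fun i => (hu i).2
    have h2 := countLT_le_countLE r x
    rcases u with y | y <;> simp only [Sum.elim_inl, Sum.elim_inr, id] at h h1 <;>
      simp only [mergeKey, Prod.Lex.toLex_lt_toLex] 
    · have h3 := countLE_le p y
      have h4 := countLT_le_countLE p y
      omega
    · have h3 := countLE_le r y
      have h4 := countLT_le_countLE r y
      omega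

/-- The merged order of some positions depends only on their order relative to each other and to
the pairs. -/
lemma mergeKey_lt_congr {V : Type*} {pos pos' : V → ℕ} {A : Set V}
    (hA : ∀ v ∈ A, ∀ w ∈ A, pos v < pos w ↔ pos' v < pos' w) {c d : Fin a → V}
    (hc : ∀ i, c i ∈ A) (hd : ∀ i, d i ∈ A) {u u' : V ⊕ V} (hu : u.elim id id ∈ A)
    (hu' : u'.elim id id ∈ A) :
    mergeKey (pos ∘ c) (pos ∘ d) (u.map pos pos) < mergeKey (pos ∘ c) (pos ∘ d) (u'.map pos pos) ↔
    mergeKey (pos' ∘ c) (pos' ∘ d) (u.map pos' pos') <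
      mergeKey (pos' ∘ c) (pos' ∘ d) (u'.map pos' pos') := by
  have hA' : ∀ v ∈ A, ∀ w ∈ A, pos v ≤ pos w ↔ pos' v ≤ pos' w := fun v hv w hw => by
    rw [← not_lt, ← not_lt, hA w hw v hv]
  have e1 : ∀ v ∈ A, countLT (pos ∘ c) (pos v) = countLT (pos' ∘ c) (pos' v) := fun v hv =>
    countLT_congr fun i => hA _ (hc i) _ hv
  have e2 : ∀ v ∈ A, countLT (pos ∘ d) (pos v) = countLT (pos' ∘ d) (pos' v) := fun v hv =>
    countLT_congr fun i => hA _ (hd i) _ hv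
  have e3 : ∀ v ∈ A, countLE (pos ∘ c) (pos v) = countLE (pos' ∘ c) (pos' v) := fun v hv =>
    countLE_congr fun i => hA' _ (hc i) _ hv
  have e4 : ∀ v ∈ A, countLE (pos ∘ d) (pos v) = countLE (pos' ∘ d) (pos' v) := fun v hv =>
    countLE_congr fun i => hA' _ (hd i) _ hv
  rcases u with v | v <;> rcases u' with w | w <;>
    simp only [Sum.elim_inl, Sum.elim_inr, id] at hu hu' <;>
    have h := hA v hu w hu' <;> have h' := hA' v hu w hu' <;>
    simp only [Sum.map_inl, Sum.map_inr, mergeKey, Prod.Lex.toLex_lt_toLex, e1 v hu, e2 v hu,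
      e3 v hu, e4 v hu, e1 w hu', e2 w hu', e3 w hu', e4 w hu'] <;> omega

end MergeKey

/-! ### One alignment step -/

section AlignStep

variable {q n k : ℕ} [NeZero q] {Y Z : Type*} [Fintype Y] [Fintype Z]

/-- The first copy is recovered by subtracting from it the symbols of the second copy. -/
lemma alignTransform_bijective (m : Idx n k → Option (Idx n k))
    {t : (Idx n k → ZMod q) → Idx n k → ZMod q} (ht : Function.Bijective t) :
    Function.Bijective (alignTransform m t) := by
  refine Finite.injective_iff_bijective.1 fun x x' h => ?_
  have h2 : t (fun a => x a.snd) = t (fun a => x' a.snd) :=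
    funext fun d => congrFun h (Idx.snd d)
  have h1 : t (fun a => x a.fst) = t (fun a => x' a.fst) := by
    funext c
    have h' : t (fun a => x a.fst) c + (m c).elim 0 (fun d => t (fun a => x a.snd) d) =
      t (fun a => x' a.fst) c + (m c).elim 0 (fun d => t (fun a => x' a.snd) d) :=
      congrFun h (Idx.fst c)
    rw [h2] at h'
    exact add_right_cancel h'
  have e1 := ht.1 h1
  have e2 := ht.1 h2
  funext a
  exact Sum.casesOn (motive := fun a : Idx n k ⊕ Idx n k => x a = x' a) a
    (fun b => congrFun e1 b) fun b => congrFun e2 b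

lemma IsAligned.isBijective {PY : ZMod q → ZMod q → PMF Y} {PZ : ZMod q → ZMod q → PMF Z} {β : ℝ}
    {s : Scheme q n k} (h : IsAligned PY PZ β n s) : s.IsBijective := by
  induction h with
  | base s i i' hi hi' ht hS hT => exact fun j => ht j ▸ polarTransform_bijective q n
  | step s s' j m hs hII hIII ht hS hT ih => 
    exact fun j' => ht j' ▸ alignTransform_bijective _ (ih j')

lemma Scheme.IsBijective.good_mono {s : Scheme q n k} (hs : s.IsBijective) {β β' : ℝ}
    (hβ : β ≤ β') {P : ZMod q → ZMod q → PMF Y} {S : Perm n k} {v : Var n k}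
    (h : s.Good β' P S v) : s.Good β P S v := by
  rw [Scheme.good_iff hs] at h ⊢
  exact h.trans_le (mul_le_mul_of_nonneg_right (threshold_anti n hβ) (Real.log_natCast_nonneg q))

lemma Scheme.IsBijective.bad_mono {s : Scheme q n k} (hs : s.IsBijective) {β β' : ℝ}
    (hβ : β ≤ β') {P : ZMod q → ZMod q → PMF Y} {S : Perm n k} {v : Var n k}
    (h : s.Bad β' P S v) : s.Bad β P S v := by
  rw [Scheme.bad_iff hs] at h ⊢
  exact h.trans_le (mul_le_mul_of_nonneg_right (threshold_anti n hβ) (Real.log_natCast_nonneg q))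

lemma IsAligned.mono {PY : ZMod q → ZMod q → PMF Y} {PZ : ZMod q → ZMod q → PMF Z} {β β' : ℝ}
    (hβ : β ≤ β') {s : Scheme q n k} (h : IsAligned PY PZ β' n s) : IsAligned PY PZ β n s := by
  induction h with
  | base s i i' hi hi' ht hS hT => exact .base s i i' hi hi' ht hS hT
  | step s s' j m hs hII hIII ht hS hT ih =>
    have hb := hs.isBijective
    exact .step s s' j m ih
      (fun c d h => ⟨hb.good_mono hβ (hII c d h).1, hb.bad_mono hβ (hII c d h).2⟩)
      (fun c d h => ⟨hb.bad_mono hβ (hIII c d h).1, hb.good_mono hβ (hIII c d h).2⟩) ht hS hT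

/-- The pairing `m` of symbols of sender `j`, as a pairing of the symbols of both senders. -/
def pairing (j : Fin 2) (m : Idx n k → Option (Idx n k)) (v : Var n k) : Option (Var n k) :=
  if v.1 = j then (m v.2).map (Prod.mk j) else none

lemma pairing_eq_some {j : Fin 2} {m : Idx n k → Option (Idx n k)} {v w : Var n k} :
    pairing j m v = some w ↔ v.1 = j ∧ w.1 = j ∧ m v.2 = some w.2 := by
  unfold pairing
  obtain ⟨i, a⟩ := v
  obtain ⟨i', b⟩ := w
  by_cases h : i = j
  · simp only [h, if_true, Option.map_eq_some_iff, Prod.mk.injEq]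
    constructor
    · rintro ⟨x, hx, rfl, rfl⟩; exact ⟨trivial, rfl, hx⟩
    · rintro ⟨-, rfl, hx⟩; exact ⟨b, hx, rfl, rfl⟩
  · simp [h]

lemma pairing_eq_none {j : Fin 2} {m : Idx n k → Option (Idx n k)} {v : Var n k}
    (h : v.1 = j → m v.2 = none) : pairing j m v = none := by
  unfold pairing
  split_ifs with hj
  · rw [h hj, Option.map_none]
  · rfl

lemma forall_idx_succ {p : Idx n (k + 1) → Prop} :
    (∀ a, p a) ↔ (∀ a : Idx n k, p a.fst) ∧ ∀ a : Idx n k, p a.snd :=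
  ⟨fun h => ⟨fun _ => h _, fun _ => h _⟩, fun h a =>
    Sum.casesOn (motive := fun a : Idx n k ⊕ Idx n k => p a) a h.1 h.2⟩

/-- One alignment step is a merge of two independent copies of the block of channel uses. -/
lemma mergeData_of_isMerge {s : Scheme q n k} {s' : Scheme q n (k + 1)} {j : Fin 2}
    {m : Idx n k → Option (Idx n k)}
    (ht : ∀ j', s'.transform j' =
      alignTransform (if j' = j then m else fun _ => none) (s.transform j'))
    (P : ZMod q → ZMod q → PMF Y) {S : Perm n k} {S' : Perm n (k + 1)} (hS : IsMerge j m S S') :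
    MergeData (chanWt P (Idx n k)) (chanWt P (Idx n (k + 1))) (fun v ω => s.symbol v ω.1)
      (fun v ω => s'.symbol v ω.1) (fun ω => ω.2) (fun ω => ω.2) S S'
      (fun v => (v.1, v.2.fst)) (fun v => (v.1, v.2.snd)) (pairing j m)
      (splitUses q Y (Equiv.refl (Idx n k ⊕ Idx n k))) where
  wt ω := chanWt_splitUses P (Equiv.refl (Idx n k ⊕ Idx n k)) ω
  sum_wt := sum_chanWt P _
  wt_nonneg := chanWt_nonneg P _
  out ω ω' := splitUses_out (Equiv.refl (Idx n k ⊕ Idx n k)) ω ω'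
  cover v' := by
    obtain ⟨j', b⟩ := v'
    revert b
    exact forall_idx_succ.2 ⟨fun a => Or.inl ⟨(j', a), rfl⟩, fun a => Or.inr ⟨(j', a), rfl⟩⟩
  ne v w h := Sum.inl_ne_inr (congrArg Prod.snd h)
  inj_r v w h := by
    have h' : ((v.1, v.2.snd) : Var n (k + 1)) = (w.1, w.2.snd) := h
    rw [Prod.mk.injEq] at h'
    exact Prod.ext h'.1 (Sum.inr_injective h'.2)
  inj := S'.injective
  pos_l := hS.1
  pos_r := hS.2.1
  adj c d hcd u := by
    obtain ⟨h1, h2, h3⟩ := pairing_eq_some.1 hcd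
    have h4 := hS.2.2 _ _ h3
    rw [← h1] at h4
    have h5 : d.1 = c.1 := h2.trans h1.symm
    rw [← S'.injective.eq_iff, h5, Fin.lt_def, Fin.lt_def, Fin.ext_iff, h4]
    omega
  sym_l v ω := by
    change s'.transform v.1 (ω.1 v.1) v.2.fst = _
    rw [ht]
    change s.transform v.1 _ v.2 + _ = _
    refine congrArg₂ (· + ·) rfl ?_
    unfold pairing
    split_ifs with h
    · cases hm : m v.2 with
      | none => rfl
      | some d => rw [← h]; rfl
    · rfl
  sym_r v ω := by
    change s'.transform v.1 (ω.1 v.1) v.2.snd = _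
    rw [ht]
    rfl

/-! ### Existence of merged orders -/

/-- The receivers decode the symbols of sender `j` in the same order. -/
def SameOrder (j : Fin 2) (S T : Perm n k) : Prop :=
  ∀ a b, S (j, a) < S (j, b) ↔ T (j, a) < T (j, b)

/-- No symbol of the other sender is decoded between two symbols of sender `j`. -/
def Contiguous (j : Fin 2) (S : Perm n k) : Prop :=
  ∀ v : Var n k, v.1 ≠ j → (∀ b, S v < S (j, b)) ∨ ∀ b, S (j, b) < S v

/-- A symbol of two copies of a superblock, as a symbol of one of the two copies. -/
def copyEquiv (n k : ℕ) : Var n (k + 1) ≃ Var n k ⊕ Var n k :=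
  Equiv.prodSumDistrib (Fin 2) (Idx n k) (Idx n k)

/-- The key of the merged order in which the symbol `c i` of the first copy comes right before the
symbol `d i` of the second copy. -/
def permKey {a : ℕ} (j : Fin 2) (c d : Fin a → Idx n k) (S : Perm n k) (v : Var n (k + 1)) :
    ℕ ×ₗ ℕ :=
  mergeKey (fun i => (S (j, c i) : ℕ)) (fun i => (S (j, d i) : ℕ))
    ((copyEquiv n k v).map (fun v => (S v : ℕ)) fun v => (S v : ℕ))

/-- A decoding order of the two copies in which the `i`-th pair, `c i` and `d i`, is adjacent. -/
lemma exists_merged_perm {a : ℕ} (j : Fin 2) (c d : Fin a → Idx n k) (S : Perm n k) :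
    ∃ S' : Perm n (k + 1), ∀ v w, S' v < S' w ↔ permKey j c d S v < permKey j c d S w := by
  have hS : Function.Injective fun v => (S v : ℕ) := Fin.val_injective.comp S.injective
  exact exists_perm_of_key _ ((mergeKey_injective _ _).comp
    ((Sum.map_injective.2 ⟨hS, hS⟩).comp (copyEquiv n k).injective))

open Classical in
/-- The pairing of `c i` with `d i`. -/
def pairMap {α : Type*} {a : ℕ} (c d : Fin a → α) (x : α) : Option α :=
  if h : ∃ i, c i = x then some (d h.choose) else none

lemma pairMap_eq_some {α : Type*} {a : ℕ} {c d : Fin a → α} (hc : Function.Injective c) {x y : α} :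
    pairMap c d x = some y ↔ ∃ i, c i = x ∧ d i = y := by
  unfold pairMap
  split_ifs with h
  · have h' := h.choose_spec
    rw [Option.some_inj]
    refine ⟨fun e => ⟨_, h', e⟩, ?_⟩
    rintro ⟨i, hi, rfl⟩
    rw [hc (h'.trans hi.symm)]
  · simp only [false_iff]
    rintro ⟨i, hi, -⟩
    exact h ⟨i, hi⟩

lemma pairMap_eq_none {α : Type*} {a : ℕ} {c d : Fin a → α} {x : α} :
    pairMap c d x = none ↔ ∀ i, c i ≠ x := by
  unfold pairMap
  split_ifs with h
  · simpa using h
  · simpa using h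

lemma equiv_fin_eq_succ {α : Type*} {m : ℕ} (e : α ≃ Fin m) {x y : α}
    (h : ∀ u, e u < e y ↔ e u < e x ∨ u = x) : (e y : ℕ) = e x + 1 := by
  have h1 : e x < e y := (h x).2 (Or.inr rfl)
  by_contra hne
  have h2 : (e x : ℕ) + 1 < m := lt_of_le_of_lt (Fin.lt_def.1 h1) (e y).2
  have h3 := h (e.symm ⟨e x + 1, h2⟩)
  rw [Equiv.apply_symm_apply, Fin.lt_def, Fin.lt_def] at h3
  rcases h3.1 (by simp only; rw [Fin.lt_def] at h1; omega) with h4 | h4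
  · simp only at h4; omega
  · have := congrArg (fun z => (e z : ℕ)) h4
    simp at this

section

variable {a : ℕ} {j : Fin 2} {c d : Fin a → Idx n k} {S T : Perm n k} {S' T' : Perm n (k + 1)}

/-- The merge needs `c` and `d` to be listed in decoding order, so that the pairs do not cross. -/
lemma isMerge_of_permKey (hc : StrictMono fun i => S (j, c i)) (hd : StrictMono fun i => S (j, d i))
    (hS' : ∀ v w, S' v < S' w ↔ permKey j c d S v < permKey j c d S w) :
    IsMerge j (pairMap c d) S S' := by
  have hcinj : Function.Injective c := fun i i' h => hc.injective (by simp only [h])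
  refine ⟨fun v w => (hS' _ _).trans (mergeKey_inl_lt _ _),
    fun v w => (hS' _ _).trans (mergeKey_inr_lt _ _), fun x y h => ?_⟩
  obtain ⟨i, rfl, rfl⟩ := (pairMap_eq_some hcinj).1 h
  refine equiv_fin_eq_succ S' fun u => ?_
  rw [hS', hS']
  refine (mergeKey_adj (fun i i' h => Fin.lt_def.1 (hc h)) (fun i i' h => Fin.lt_def.1 (hd h)) i
    _).trans (or_congr_right ?_)
  rw [← (copyEquiv n k).injective.eq_iff]
  have hS : Function.Injective fun v => (S v : ℕ) := Fin.val_injective.comp S.injective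
  exact (Sum.map_injective.2 ⟨hS, hS⟩).eq_iff (b := Sum.inl (j, c i))

lemma isMonotone_of_isMerge {m : Idx n k → Option (Idx n k)} (hm : IsMerge j m S S')
    (h : IsMonotone S) : IsMonotone S' := by
  intro j' x y hxy
  revert x y
  refine forall_idx_succ.2 ⟨fun x => forall_idx_succ.2 ⟨fun y hxy => ?_, fun y hxy => ?_⟩,
    fun x => forall_idx_succ.2 ⟨fun y hxy => ?_, fun y hxy => ?_⟩⟩
  · exact (hm.1 (j', x) (j', y)).2 (h j' x y hxy)
  · exact hxy.elim
  · exact hxy.elim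
  · exact (hm.2.1 (j', x) (j', y)).2 (h j' x y hxy)

/-- For the aligned sender, both receivers keep a common order: the merged order of its symbols
depends only on their original order. -/
lemma sameOrder_merged (h : SameOrder j S T)
    (hS' : ∀ v w, S' v < S' w ↔ permKey j c d S v < permKey j c d S w)
    (hT' : ∀ v w, T' v < T' w ↔ permKey j c d T v < permKey j c d T w) : SameOrder j S' T' := by
  intro x y
  rw [hS', hT']
  have hA : ∀ x : Idx n (k + 1), (copyEquiv n k (j, x)).elim id id ∈ {v : Var n k | v.1 = j} :=
    forall_idx_succ.2 ⟨fun _ => rfl, fun _ => rfl⟩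
  refine mergeKey_lt_congr (A := {v : Var n k | v.1 = j}) (pos := fun v => (S v : ℕ))
    (pos' := fun v => (T v : ℕ)) ?_ (c := fun i => (j, c i)) (d := fun i => (j, d i))
    (fun i => rfl) (fun i => rfl) (hA x) (hA y)
  rintro ⟨_, v⟩ rfl ⟨_, w⟩ hw
  obtain rfl : _ = _ := hw
  exact h v w

lemma Contiguous.separated (h : Contiguous j S) {j' : Fin 2} (hj : j' ≠ j) (x : Idx n (k + 1)) :
    let u := (copyEquiv n k (j', x)).map (fun v => (S v : ℕ)) fun v => (S v : ℕ)
    (∀ b, u.elim id id < S (j, b)) ∨ ∀ b, S (j, b) < u.elim id id := by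
  revert x
  exact forall_idx_succ.2 ⟨fun x => h (j', x) hj, fun x => h (j', x) hj⟩

lemma permKey_lt_of_contiguous (h : Contiguous j S) {j' : Fin 2} (hj : j' ≠ j)
    (x y : Idx n (k + 1)) :
    permKey j c d S (j', x) < permKey j c d S (j', y) ↔
      copyPos ((copyEquiv n k (j', x)).map (fun v => (S v : ℕ)) fun v => (S v : ℕ)) <
      copyPos ((copyEquiv n k (j', y)).map (fun v => (S v : ℕ)) fun v => (S v : ℕ)) := by
  refine mergeKey_lt_of_separated ?_ ?_
  · exact (h.separated hj x).imp (fun h i => ⟨h _, h _⟩) fun h i => ⟨h _, h _⟩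
  · exact (h.separated hj y).imp (fun h i => ⟨h _, h _⟩) fun h i => ⟨h _, h _⟩

/-- The symbols of the sender that is not aligned keep a common order: all pairs lie on the same
side of each of them. -/
lemma sameOrder_merged_of_contiguous (hS : Contiguous j S) (hT : Contiguous j T) {j' : Fin 2}
    (hj : j' ≠ j) (h : SameOrder j' S T)
    (hS' : ∀ v w, S' v < S' w ↔ permKey j c d S v < permKey j c d S w)
    (hT' : ∀ v w, T' v < T' w ↔ permKey j c d T v < permKey j c d T w) : SameOrder j' S' T' := by
  intro x y
  rw [hS', hT', permKey_lt_of_contiguous hS hj, permKey_lt_of_contiguous hT hj]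
  have key : ∀ a b : Idx n k, ((S (j', a) : ℕ) < S (j', b) ↔ (T (j', a) : ℕ) < T (j', b)) ∧
      ((S (j', b) : ℕ) < S (j', a) ↔ (T (j', b) : ℕ) < T (j', a)) := fun a b =>
    ⟨h a b, h b a⟩
  revert x y
  refine forall_idx_succ.2 ⟨fun x => forall_idx_succ.2 ⟨fun y => ?_, fun y => ?_⟩,
    fun x => forall_idx_succ.2 ⟨fun y => ?_, fun y => ?_⟩⟩
  · change 2 * (S (j', x) : ℕ) < 2 * (S (j', y) : ℕ) ↔ 2 * (T (j', x) : ℕ) < 2 * (T (j', y) : ℕ)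
    have := key x y; omega
  · change 2 * (S (j', x) : ℕ) < 2 * (S (j', y) : ℕ) + 1 ↔
      2 * (T (j', x) : ℕ) < 2 * (T (j', y) : ℕ) + 1
    have := key x y; omega
  · change 2 * (S (j', x) : ℕ) + 1 < 2 * (S (j', y) : ℕ) ↔
      2 * (T (j', x) : ℕ) + 1 < 2 * (T (j', y) : ℕ)
    have := key x y; omega
  · change 2 * (S (j', x) : ℕ) + 1 < 2 * (S (j', y) : ℕ) + 1 ↔
      2 * (T (j', x) : ℕ) + 1 < 2 * (T (j', y) : ℕ) + 1
    have := key x y; omega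

/-- The symbols of the aligned sender stay contiguous, so that further alignment steps are possible. -/
lemma contiguous_merged (hS : Contiguous j S)
    (hS' : ∀ v w, S' v < S' w ↔ permKey j c d S v < permKey j c d S w) : Contiguous j S' := by
  rintro ⟨j', x⟩ hj
  rcases hS.separated hj x with h | h
  · refine Or.inl fun b => (hS' _ _).2 (mergeKey_lt_of_forall_lt (fun i => ⟨h _, h _⟩) ?_)
    revert b
    exact forall_idx_succ.2 ⟨fun b => h b, fun b => h b⟩
  · refine Or.inr fun b => (hS' _ _).2 (mergeKey_lt_of_forall_gt (fun i => ⟨h _, h _⟩) ?_)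
    revert b
    exact forall_idx_succ.2 ⟨fun b => h b, fun b => h b⟩

end

end AlignStep

/-! ### The effect of one alignment step on entropies -/

section EntMerge

variable {n k : ℕ}

lemma sum_idx_succ (f : Idx n (k + 1) → ℝ) :
    ∑ x, f x = ∑ x : Idx n k, f x.fst + ∑ x : Idx n k, f x.snd :=
  Fintype.sum_sum_type (α₁ := Idx n k) (α₂ := Idx n k) f

open Classical in
/-- The number of elements with the property `p`. -/
def countOf {α : Type*} [Fintype α] (p : α → Prop) : ℕ := (Finset.univ.filter p).card

lemma card_filter_eq_countOf {α : Type*} [Fintype α] (p : α → Prop) [DecidablePred p] :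
    (Finset.univ.filter p).card = countOf p := by
  unfold countOf
  congr

lemma countOf_mono {α : Type*} [Fintype α] {p p' : α → Prop} (h : ∀ x, p x → p' x) :
    countOf p ≤ countOf p' := by
  classical
  rw [← card_filter_eq_countOf, ← card_filter_eq_countOf]
  exact Finset.card_le_card (Finset.monotone_filter_right _ fun x _ => h x)

lemma countOf_add_le {α : Type*} [Fintype α] {p p' : α → Prop} {a : ℕ} {d : Fin a → α}
    (hd : Function.Injective d) (h : ∀ x, p x → p' x) (hp : ∀ i, ¬ p (d i))
    (hp' : ∀ i, p' (d i)) : countOf p + a ≤ countOf p' := by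
  classical
  have ha : (Finset.univ.image d).card = a := by
    rw [Finset.card_image_of_injective _ hd, Finset.card_univ, Fintype.card_fin]
  have hdisj : Disjoint (Finset.univ.filter p) (Finset.univ.image d) := by
    rw [Finset.disjoint_left]
    intro x hx hx'
    obtain ⟨i, -, rfl⟩ := Finset.mem_image.1 hx'
    exact hp i (Finset.mem_filter.1 hx).2
  rw [← card_filter_eq_countOf, ← card_filter_eq_countOf]
  conv_lhs => rw [← ha]
  rw [← Finset.card_union_of_disjoint hdisj]
  refine Finset.card_le_card fun x hx => Finset.mem_filter.2 ⟨Finset.mem_univ _, ?_⟩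
  rcases Finset.mem_union.1 hx with hx | hx
  · exact h x (Finset.mem_filter.1 hx).2
  · obtain ⟨i, -, rfl⟩ := Finset.mem_image.1 hx
    exact hp' i

lemma countOf_idx_succ (p : Idx n (k + 1) → Prop) :
    countOf p = (countOf fun x : Idx n k => p x.fst) + countOf fun x : Idx n k => p x.snd := by
  classical
  simp only [countOf, Finset.card_filter]
  exact Fintype.sum_sum_type (α₁ := Idx n k) (α₂ := Idx n k) fun x => if p x then 1 else 0

/-- How the conditional entropies `h'` of two aligned copies arise from the conditional entropies
`h` of one copy, when the symbols `c i` of the first copy are combined with `d i` of the second. -/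
structure EntMerge {a : ℕ} (j : Fin 2) (c d : Fin a → Idx n k) (h : Var n k → ℝ)
    (h' : Var n (k + 1) → ℝ) : Prop where
  fst_eq : ∀ j' x, (j' = j → ∀ i, c i ≠ x) → h' (j', x.fst) = h (j', x)
  snd_eq : ∀ j' x, (j' = j → ∀ i, d i ≠ x) → h' (j', x.snd) = h (j', x)
  add : ∀ i, h' (j, (c i).fst) + h' (j, (d i).snd) = h (j, c i) + h (j, d i)
  le : ∀ i, h (j, c i) ≤ h' (j, (c i).fst) ∧ h (j, d i) ≤ h' (j, (c i).fst)

variable {a : ℕ} {j : Fin 2} {c d : Fin a → Idx n k}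

lemma sum_eq_add_sum_of_injective {α : Type*} [Fintype α] {c : Fin a → α}
    (hc : Function.Injective c) {f g : α → ℝ} (h : ∀ x, (∀ i, c i ≠ x) → f x = g x) :
    ∑ x, f x = ∑ x, g x + ∑ i, (f (c i) - g (c i)) := by
  rw [Fintype.sum_of_injective c hc (fun i => f (c i) - g (c i)) (fun x => f x - g x)
    (fun x hx => by rw [h x fun i hi => hx ⟨i, hi⟩, sub_self]) fun i => rfl,
    Finset.sum_sub_distrib]
  ring

/-- Alignment preserves the mean entropy of each sender, hence the rates. -/
lemma EntMerge.sum_eq (hc : Function.Injective c) (hd : Function.Injective d)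
    {h : Var n k → ℝ} {h' : Var n (k + 1) → ℝ} (H : EntMerge j c d h h') (j' : Fin 2) :
    ∑ x, h' (j', x) = 2 * ∑ x, h (j', x) := by
  rw [sum_idx_succ]
  by_cases hj : j' = j
  · subst hj
    rw [sum_eq_add_sum_of_injective hc (f := fun x : Idx n k => h' (j', x.fst))
      (g := fun x => h (j', x)) fun x hx => H.fst_eq _ x fun _ => hx,
      sum_eq_add_sum_of_injective hd (f := fun x : Idx n k => h' (j', x.snd))
      (g := fun x => h (j', x)) fun x hx => H.snd_eq _ x fun _ => hx]
    have : ∑ i, (h' (j', (c i).fst) - h (j', c i)) + ∑ i, (h' (j', (d i).snd) - h (j', d i)) = 0 := by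
      rw [← Finset.sum_add_distrib]
      exact Finset.sum_eq_zero fun i _ => by linarith [H.add i]
    linarith
  · rw [Finset.sum_congr rfl fun x _ => H.fst_eq j' x fun h => absurd h hj,
      Finset.sum_congr rfl fun x _ => H.snd_eq j' x fun h => absurd h hj, two_mul]

variable {hY hZ : Var n k → ℝ} {hY' hZ' : Var n (k + 1) → ℝ} {L θ : ℝ}

/-- The first symbols of the pairs become bad for both receivers, the second ones good for both. -/
lemma EntMerge.commonGood_le (hd : Function.Injective d)
    (HY : EntMerge j c d hY hY') (HZ : EntMerge j c d hZ hZ') (hθ : 2 * θ ≤ L)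
    (h1 : ∀ i, hY (j, c i) < θ ∧ L - hZ (j, c i) < θ)
    (h2 : ∀ i, L - hY (j, d i) < θ ∧ hZ (j, d i) < θ) :
    2 * (countOf fun x => hY (j, x) < θ ∧ hZ (j, x) < θ) + a ≤
      (countOf fun x => hY' (j, x) < θ ∧ hZ' (j, x) < θ) := by
  rw [countOf_idx_succ, two_mul, add_assoc]
  refine add_le_add (countOf_mono fun x hx => ?_) (countOf_add_le hd (fun x hx => ?_) (fun i => ?_)
    fun i => ?_)
  · have hne : ∀ i, c i ≠ x := fun i hi => by
      have := h1 i
      rw [hi] at this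
      linarith [this.2, hx.2]
    rw [HY.fst_eq _ _ fun _ => hne, HZ.fst_eq _ _ fun _ => hne]
    exact hx
  · have hne : ∀ i, d i ≠ x := fun i hi => by
      have := h2 i
      rw [hi] at this
      linarith [this.1, hx.1]
    rw [HY.snd_eq _ _ fun _ => hne, HZ.snd_eq _ _ fun _ => hne]
    exact hx
  · intro h
    linarith [(h2 i).1, h.1]
  · constructor
    · linarith [HY.add i, (HY.le i).2, (h1 i).1]
    · linarith [HZ.add i, (HZ.le i).1, (h2 i).2]

/-- In the second copy no good-bad symbol is used, so that at least as many are left for another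
step. -/
lemma EntMerge.card_le_snd (HY : EntMerge j c d hY hY') (HZ : EntMerge j c d hZ hZ')
    (hθ : 2 * θ ≤ L) (h2 : ∀ i, L - hY (j, d i) < θ ∧ hZ (j, d i) < θ) :
    (countOf fun x => hY (j, x) < θ ∧ L - hZ (j, x) < θ) ≤
      (countOf fun x => hY' (j, x) < θ ∧ L - hZ' (j, x) < θ) := by
  rw [countOf_idx_succ]
  refine le_add_left (countOf_mono fun x hx => ?_)
  have hne : ∀ i, d i ≠ x := fun i hi => by
    have := h2 i
    rw [hi] at this
    linarith [this.1, hx.1]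
  rw [HY.snd_eq _ _ fun _ => hne, HZ.snd_eq _ _ fun _ => hne]
  exact hx

/-- In the first copy no bad-good symbol is used, so that at least as many are left for another
step. -/
lemma EntMerge.card_le_fst (HY : EntMerge j c d hY hY') (HZ : EntMerge j c d hZ hZ')
    (hθ : 2 * θ ≤ L) (h1 : ∀ i, hY (j, c i) < θ ∧ L - hZ (j, c i) < θ) :
    (countOf fun x => hZ (j, x) < θ ∧ L - hY (j, x) < θ) ≤
      (countOf fun x => hZ' (j, x) < θ ∧ L - hY' (j, x) < θ) := by
  rw [countOf_idx_succ]
  refine le_add_right (countOf_mono fun x hx => ?_)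
  have hne : ∀ i, c i ≠ x := fun i hi => by
    have := h1 i
    rw [hi] at this
    linarith [this.1, hx.2]
  rw [HY.fst_eq _ _ fun _ => hne, HZ.fst_eq _ _ fun _ => hne]
  exact hx

/-- The symbols of the sender that is not aligned are not affected. -/
lemma EntMerge.card_other (HY : EntMerge j c d hY hY') (HZ : EntMerge j c d hZ hZ')
    {j' : Fin 2} (hj : j' ≠ j) (p : ℝ → ℝ → Prop) :
    (countOf fun x => p (hY' (j', x)) (hZ' (j', x))) =
      2 * (countOf fun x => p (hY (j', x)) (hZ (j', x))) := by
  rw [countOf_idx_succ, two_mul]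
  simp only [HY.fst_eq j' _ fun h => absurd h hj, HZ.fst_eq j' _ fun h => absurd h hj,
    HY.snd_eq j' _ fun h => absurd h hj, HZ.snd_eq j' _ fun h => absurd h hj]

end EntMerge

/-! ### Repeated alignment -/

section Align

variable {q n k : ℕ} [NeZero q] {Y Z : Type*} [Fintype Y] [Fintype Z]

/-- The sum of the conditional entropies of the symbols of sender `j`. -/
def Scheme.senderEnt (s : Scheme q n k) (P : ZMod q → ZMod q → PMF Y) (S : Perm n k)
    (j : Fin 2) : ℝ := ∑ i, s.symbolEnt P S (j, i)

open Classical in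
/-- The symbols of sender `j` that are good for one receiver and bad for the other. -/
def Scheme.goodBad (s : Scheme q n k) (β : ℝ) (P : ZMod q → ZMod q → PMF Y) (S : Perm n k)
    (P' : ZMod q → ZMod q → PMF Z) (S' : Perm n k) (j : Fin 2) : Finset (Idx n k) :=
  {i | s.Good β P S (j, i) ∧ s.Bad β P' S' (j, i)}

lemma Scheme.card_commonGood {s : Scheme q n k} (hs : s.IsBijective) (β : ℝ)
    (PY : ZMod q → ZMod q → PMF Y) (PZ : ZMod q → ZMod q → PMF Z) (j : Fin 2) :
    (s.commonGood β PY PZ j).card = countOf fun x =>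
      s.symbolEnt PY s.S (j, x) < threshold n β * Real.log q ∧
        s.symbolEnt PZ s.T (j, x) < threshold n β * Real.log q := by
  unfold Scheme.commonGood
  rw [card_filter_eq_countOf]
  simp only [Scheme.good_iff hs]

lemma Scheme.card_goodBad {s : Scheme q n k} (hs : s.IsBijective) (β : ℝ)
    (P : ZMod q → ZMod q → PMF Y) (S : Perm n k) (P' : ZMod q → ZMod q → PMF Z) (S' : Perm n k)
    (j : Fin 2) :
    (s.goodBad β P S P' S' j).card = countOf fun x =>
      s.symbolEnt P S (j, x) < threshold n β * Real.log q ∧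
        Real.log q - s.symbolEnt P' S' (j, x) < threshold n β * Real.log q := by
  unfold Scheme.goodBad
  rw [card_filter_eq_countOf]
  simp only [Scheme.good_iff hs, Scheme.bad_iff hs]

lemma exists_strictMono_of_le_card {α L : Type*} [LinearOrder L] {f : α → L}
    (hf : Function.Injective f) {s : Finset α} {a : ℕ} (h : a ≤ s.card) :
    ∃ c : Fin a → α, StrictMono (fun i => f (c i)) ∧ ∀ i, c i ∈ s := by
  classical
  obtain ⟨t, hts, ht⟩ := Finset.exists_subset_card_eq h
  have hcard : (t.image f).card = a := by rw [Finset.card_image_of_injective _ hf, ht]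
  have hmem : ∀ i, ∃ x ∈ t, f x = (t.image f).orderEmbOfFin hcard i := fun i =>
    Finset.mem_image.1 ((t.image f).orderEmbOfFin_mem hcard i)
  choose c hc hfc using hmem
  refine ⟨c, fun i i' hi => ?_, fun i => hts (hc i)⟩
  simp only [hfc]
  exact ((t.image f).orderEmbOfFin hcard).strictMono hi

/-- The entropies of the symbols after one alignment step, for either receiver. -/
lemma entMerge_of_isMerge {s : Scheme q n k} {s' : Scheme q n (k + 1)} {j : Fin 2} {a : ℕ}
    {c d : Fin a → Idx n k} (hc : Function.Injective c)
    (ht : ∀ j', s'.transform j' =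
      alignTransform (if j' = j then pairMap c d else fun _ => none) (s.transform j'))
    (P : ZMod q → ZMod q → PMF Y) {S : Perm n k} {S' : Perm n (k + 1)}
    (hS : IsMerge j (pairMap c d) S S') :
    EntMerge j c d (s.symbolEnt P S) (s'.symbolEnt P S') := by
  have hM := mergeData_of_isMerge ht P hS
  have hcd : ∀ i, pairing j (pairMap c d) (j, c i) = some (j, d i) := fun i =>
    pairing_eq_some.2 ⟨rfl, rfl, (pairMap_eq_some hc).2 ⟨i, rfl, rfl⟩⟩
  have hl : ∀ v, pairing j (pairMap c d) v = none →
      s'.symbolEnt P S' (v.1, v.2.fst) = s.symbolEnt P S v := fun v hv => hM.famEnt_l hv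
  have hr : ∀ v, (∀ w, pairing j (pairMap c d) w ≠ some v) →
      s'.symbolEnt P S' (v.1, v.2.snd) = s.symbolEnt P S v := fun v hv => hM.famEnt_r hv
  have hadd : ∀ v w, pairing j (pairMap c d) v = some w →
      s'.symbolEnt P S' (v.1, v.2.fst) + s'.symbolEnt P S' (w.1, w.2.snd) =
        s.symbolEnt P S v + s.symbolEnt P S w := fun v w hv => hM.famEnt_add hv
  have hle : ∀ v w, pairing j (pairMap c d) v = some w →
      s.symbolEnt P S v ≤ s'.symbolEnt P S' (v.1, v.2.fst) ∧
        s.symbolEnt P S w ≤ s'.symbolEnt P S' (v.1, v.2.fst) := fun v w hv => hM.famEnt_le_l hv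
  clear hM
  generalize s.symbolEnt P S = h at *
  generalize s'.symbolEnt P S' = h' at *
  refine ⟨fun j' x hx => hl (j', x) ?_, fun j' x hx => hr (j', x) ?_,
    fun i => hadd _ _ (hcd i), fun i => hle _ _ (hcd i)⟩
  · exact pairing_eq_none fun hj => pairMap_eq_none.2 (hx hj)
  · intro v hv
    obtain ⟨-, h2, h3⟩ := pairing_eq_some.1 hv
    obtain ⟨i, -, hi⟩ := (pairMap_eq_some hc).1 h3
    exact hx h2 i hi

variable {PY : ZMod q → ZMod q → PMF Y} {PZ : ZMod q → ZMod q → PMF Z} {β : ℝ}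

/-- The scheme `s'` arises from `2 ^ r` copies of `s` by `r` alignment steps for sender `j`, with
`a` pairs of symbols in each step. The field `commonGood` counts the pairs in all copies,
`1 + 2 + ⋯ + 2 ^ (r - 1) = 2 ^ r - 1` times `a`; the fields `goodBad` and `badGood` say that
enough symbols are left for another step; `other` and `other_order` say that the symbols of the
other sender are copied and can be aligned afterwards. -/
structure Aligns (PY : ZMod q → ZMod q → PMF Y) (PZ : ZMod q → ZMod q → PMF Z) (β : ℝ)
    (j : Fin 2) (a r : ℕ) {k k' : ℕ} (s : Scheme q n k) (s' : Scheme q n k') : Prop where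
  aligned : IsAligned PY PZ β n s'
  monoS : IsMonotone s'.S
  monoT : IsMonotone s'.T
  sameOrder : SameOrder j s'.S s'.T
  entS : ∀ j', s'.senderEnt PY s'.S j' = 2 ^ r * s.senderEnt PY s.S j'
  entT : ∀ j', s'.senderEnt PZ s'.T j' = 2 ^ r * s.senderEnt PZ s.T j'
  commonGood : 2 ^ r * (s.commonGood β PY PZ j).card + (2 ^ r - 1) * a ≤
    (s'.commonGood β PY PZ j).card
  goodBad : (s.goodBad β PY s.S PZ s.T j).card ≤ (s'.goodBad β PY s'.S PZ s'.T j).card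
  badGood : (s.goodBad β PZ s.T PY s.S j).card ≤ (s'.goodBad β PZ s'.T PY s'.S j).card
  other : ∀ j' ≠ j,
    (s'.commonGood β PY PZ j').card = 2 ^ r * (s.commonGood β PY PZ j').card ∧
    (s'.goodBad β PY s'.S PZ s'.T j').card = 2 ^ r * (s.goodBad β PY s.S PZ s.T j').card ∧
    (s'.goodBad β PZ s'.T PY s'.S j').card = 2 ^ r * (s.goodBad β PZ s.T PY s.S j').card
  other_order : Contiguous j s.S → Contiguous j s.T → (∀ j', SameOrder j' s.S s.T) →
    Contiguous j s'.S ∧ Contiguous j s'.T ∧ ∀ j', SameOrder j' s'.S s'.T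

/-- Symbols good for `Y` only are paired with symbols good for `Z` only, both taken in decoding order.
Since both receivers share the order of these symbols, both merged orders exist. -/
lemma exists_aligns_one (hβ : 0 ≤ β) {j : Fin 2} {s : Scheme q n k}
    (hs : IsAligned PY PZ β n s) (hmS : IsMonotone s.S) (hmT : IsMonotone s.T)
    (hST : SameOrder j s.S s.T) {a : ℕ} (h1 : a ≤ (s.goodBad β PY s.S PZ s.T j).card)
    (h2 : a ≤ (s.goodBad β PZ s.T PY s.S j).card) :
    ∃ s' : Scheme q n (k + 1), Aligns PY PZ β j a 1 s s' := by
  classical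
  have hinj : Function.Injective fun x => s.S (j, x) := fun x y h =>
    congrArg Prod.snd (s.S.injective h)
  obtain ⟨c, hcS, hc⟩ := exists_strictMono_of_le_card hinj h1
  obtain ⟨d, hdS, hd⟩ := exists_strictMono_of_le_card hinj h2
  have hcT : StrictMono fun i => s.T (j, c i) := fun i i' h => (hST _ _).1 (hcS h)
  have hdT : StrictMono fun i => s.T (j, d i) := fun i i' h => (hST _ _).1 (hdS h)
  have hcinj : Function.Injective c := fun i i' h => hcS.injective (by simp only [h])
  have hdinj : Function.Injective d := fun i i' h => hdS.injective (by simp only [h])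
  obtain ⟨S', hS'⟩ := exists_merged_perm j c d s.S
  obtain ⟨T', hT'⟩ := exists_merged_perm j c d s.T
  have hmergeS := isMerge_of_permKey hcS hdS hS'
  have hmergeT := isMerge_of_permKey hcT hdT hT'
  let s' : Scheme q n (k + 1) := ⟨fun j' =>
    alignTransform (if j' = j then pairMap c d else fun _ => none) (s.transform j'), S', T'⟩
  have hc' : ∀ i, s.Good β PY s.S (j, c i) ∧ s.Bad β PZ s.T (j, c i) := fun i =>
    (Finset.mem_filter.1 (hc i)).2
  have hd' : ∀ i, s.Good β PZ s.T (j, d i) ∧ s.Bad β PY s.S (j, d i) := fun i =>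
    (Finset.mem_filter.1 (hd i)).2
  have hal : IsAligned PY PZ β n s' := by
    refine .step s s' j (pairMap c d) hs (fun x y h => ?_) (fun x y h => ?_) (fun _ => rfl) hmergeS
      hmergeT
    · obtain ⟨i, rfl, rfl⟩ := (pairMap_eq_some hcinj).1 h
      exact hc' i
    · obtain ⟨i, rfl, rfl⟩ := (pairMap_eq_some hcinj).1 h
      exact (hd' i).symm
  have HY : EntMerge j c d (s.symbolEnt PY s.S) (s'.symbolEnt PY S') :=
    entMerge_of_isMerge hcinj (fun _ => rfl) PY hmergeS
  have HZ : EntMerge j c d (s.symbolEnt PZ s.T) (s'.symbolEnt PZ T') :=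
    entMerge_of_isMerge hcinj (fun _ => rfl) PZ hmergeT
  have hb := hs.isBijective
  have hb' := hal.isBijective
  have hθ : 2 * (threshold n β * Real.log q) ≤ Real.log q := by
    have := threshold_le_half n hβ
    have := Real.log_natCast_nonneg q
    nlinarith
  simp only [Scheme.good_iff hb, Scheme.bad_iff hb] at hc' hd'
  refine ⟨s', hal, isMonotone_of_isMerge hmergeS hmS, isMonotone_of_isMerge hmergeT hmT,
    sameOrder_merged hST hS' hT', fun j' => ?_, fun j' => ?_, ?_, ?_, ?_, fun j' hj' => ?_,
    fun hcS' hcT' hso => ⟨contiguous_merged hcS' hS', contiguous_merged hcT' hT', fun j' => ?_⟩⟩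
  · rw [pow_one]
    exact HY.sum_eq hcinj hdinj j'
  · rw [pow_one]
    exact HZ.sum_eq hcinj hdinj j'
  · rw [Scheme.card_commonGood hb, Scheme.card_commonGood hb', pow_one, Nat.add_one_sub_one, one_mul]
    exact HY.commonGood_le hdinj HZ hθ hc' fun i => (hd' i).symm
  · rw [Scheme.card_goodBad hb, Scheme.card_goodBad hb']
    exact HY.card_le_snd HZ hθ fun i => (hd' i).symm
  · rw [Scheme.card_goodBad hb, Scheme.card_goodBad hb']
    exact HY.card_le_fst HZ hθ hc'
  · rw [Scheme.card_commonGood hb, Scheme.card_commonGood hb', Scheme.card_goodBad hb,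
      Scheme.card_goodBad hb', Scheme.card_goodBad hb, Scheme.card_goodBad hb', pow_one]
    exact ⟨HY.card_other HZ hj' fun y z => y < threshold n β * Real.log q ∧
        z < threshold n β * Real.log q,
      HY.card_other HZ hj' fun y z => y < threshold n β * Real.log q ∧
        Real.log q - z < threshold n β * Real.log q,
      HY.card_other HZ hj' fun y z => z < threshold n β * Real.log q ∧
        Real.log q - y < threshold n β * Real.log q⟩
  · by_cases hj' : j' = j
    · rw [hj']; exact sameOrder_merged hST hS' hT'
    · exact sameOrder_merged_of_contiguous hcS' hcT' hj' (hso j') hS' hT'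

/-- Since unpaired symbols remain available in one of the two copies, alignment can be
repeated with the same number of pairs. -/
lemma exists_aligns (hβ : 0 ≤ β) {j : Fin 2} {s : Scheme q n k}
    (hs : IsAligned PY PZ β n s) (hmS : IsMonotone s.S) (hmT : IsMonotone s.T)
    (hST : SameOrder j s.S s.T) {a : ℕ} (h1 : a ≤ (s.goodBad β PY s.S PZ s.T j).card)
    (h2 : a ≤ (s.goodBad β PZ s.T PY s.S j).card) (r : ℕ) :
    ∃ s' : Scheme q n (k + r), Aligns PY PZ β j a r s s' := by
  induction r with
  | zero =>
    exact ⟨s, hs, hmS, hmT, hST, fun _ => by simp, fun _ => by simp, by simp, le_rfl, le_rfl,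
      fun _ _ => by simp, fun h h' h'' => ⟨h, h', h''⟩⟩
  | succ r ih =>
    obtain ⟨t, ht⟩ := ih
    obtain ⟨s', hs'⟩ := exists_aligns_one hβ ht.aligned ht.monoS ht.monoT ht.sameOrder
      (h1.trans ht.goodBad) (h2.trans ht.badGood)
    refine ⟨s', hs'.aligned, hs'.monoS, hs'.monoT, hs'.sameOrder, fun j' => ?_, fun j' => ?_, ?_,
      ht.goodBad.trans hs'.goodBad, ht.badGood.trans hs'.badGood, fun j' hj' => ?_,
      fun hcS hcT hso => ?_⟩
    · rw [hs'.entS, ht.entS]; ring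
    · rw [hs'.entT, ht.entT]; ring
    · have e1 := hs'.commonGood
      have e2 := ht.commonGood
      have e3 : 1 ≤ 2 ^ r := Nat.one_le_two_pow
      obtain ⟨b, hb⟩ := Nat.exists_eq_add_of_le e3
      rw [pow_one, Nat.add_one_sub_one, one_mul] at e1
      rw [pow_succ]
      rw [hb] at e2 ⊢
      rw [show (1 + b) * 2 - 1 = 2 * b + 1 by omega]
      rw [show 1 + b - 1 = b by omega] at e2
      nlinarith
    · obtain ⟨o1, o2, o3⟩ := ht.other j' hj'
      obtain ⟨o1', o2', o3'⟩ := hs'.other j' hj'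
      rw [o1', o2', o3', o1, o2, o3]
      refine ⟨?_, ?_, ?_⟩ <;> ring
    · obtain ⟨o1, o2, o3⟩ := ht.other_order hcS hcT hso
      exact hs'.other_order o1 o2 o3

end Align

/-! ### Aligned schemes for arbitrary points of the dominant faces -/

/-- The thresholds decrease faster than any fixed multiple of the inverse block length. -/
lemma tendsto_pow_mul_threshold {β : ℝ} (hβ : 0 < β) :
    Filter.Tendsto (fun n : ℕ => (2 : ℝ) ^ n * threshold n β) Filter.atTop (nhds 0) := by
  have h1 := tendsto_rpow_mul_exp_neg_mul_atTop_nhds_zero β⁻¹ (Real.log 2)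
    (Real.log_pos (by norm_num))
  have h2 : Filter.Tendsto (fun n : ℕ => ((2 : ℝ) ^ n) ^ β) Filter.atTop Filter.atTop :=
    (tendsto_rpow_atTop hβ).comp (tendsto_pow_atTop_atTop_of_one_lt (by norm_num))
  refine (h1.comp h2).congr fun n => ?_
  have h0 : (0 : ℝ) ≤ 2 ^ n := by positivity
  simp only [Function.comp_apply]
  rw [← Real.rpow_mul h0, mul_inv_cancel₀ hβ.ne', Real.rpow_one, threshold,
    Real.rpow_def_of_pos (show (0 : ℝ) < 2 by norm_num)]
  congr 2
  ring

lemma threshold_le_pow_mul (n : ℕ) (β : ℝ) : threshold n β ≤ 2 ^ n * threshold n β :=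
  le_mul_of_one_le_left (threshold_pos n β).le (one_le_pow₀ (by norm_num))

section Count

variable {α : Type*} [Fintype α]

lemma sum_indicator_countOf (p : α → Prop) (c : ℝ) [DecidablePred p] :
    ∑ x, (if p x then c else 0) = c * countOf p := by
  rw [← Finset.sum_filter, Finset.sum_const, card_filter_eq_countOf, nsmul_eq_mul, mul_comm]

/-- If almost all symbols are good or bad for each receiver, the sum of the information that the
symbols carry for the first receiver is almost `L` times the number of symbols that are good for it,
which are either good or bad for the second receiver. -/
lemma sum_sub_le_countOf {hY hZ : α → ℝ} {L θ δ : ℝ} (hθ : 0 ≤ θ) (hL : 0 ≤ L)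
    (hY0 : ∀ x, 0 ≤ hY x) (hYδ : (countOf fun x => ¬ (hY x < θ ∨ L - hY x < θ) : ℝ) ≤ δ)
    (hZδ : (countOf fun x => ¬ (hZ x < θ ∨ L - hZ x < θ) : ℝ) ≤ δ) :
    ∑ x, (L - hY x) ≤ L * ((countOf fun x => hY x < θ ∧ hZ x < θ) +
      (countOf fun x => hY x < θ ∧ L - hZ x < θ) : ℝ) + θ * Fintype.card α + 2 * L * δ := by
  classical
  have h : ∀ x, L - hY x ≤ (if hY x < θ ∧ hZ x < θ then L else 0) +
      (if hY x < θ ∧ L - hZ x < θ then L else 0) + θ +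
      (if ¬ (hY x < θ ∨ L - hY x < θ) then L else 0) +
      (if ¬ (hZ x < θ ∨ L - hZ x < θ) then L else 0) := by
    intro x
    have := hY0 x
    by_cases h1 : hY x < θ <;> by_cases h2 : hZ x < θ <;> by_cases h3 : L - hY x < θ <;>
      by_cases h4 : L - hZ x < θ <;> simp only [h1, h2, h3, h4, and_self, and_true,
        and_false, or_self, or_true, or_false, not_true, not_false_iff, if_true, if_false] <;> linarith
  refine (Finset.sum_le_sum fun x _ => h x).trans ?_
  simp only [Finset.sum_add_distrib, sum_indicator_countOf, Finset.sum_const, Finset.card_univ,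
    nsmul_eq_mul]
  nlinarith

end Count

section Core

variable {q : ℕ} {Y Z : Type*} [Fintype Y] [Fintype Z]

lemma IsSplit.isMonotone {n i : ℕ} {S : Perm n 0} (h : IsSplit i S) : IsMonotone S := by
  intro j a b hab
  fin_cases j
  · exact (h.1 a b).2 hab
  · exact (h.2.1 a b).2 hab

lemma IsSplit.sameOrder {n i i' : ℕ} {S T : Perm n 0} (hS : IsSplit i S) (hT : IsSplit i' T)
    (j : Fin 2) : SameOrder j S T := by
  intro a b
  fin_cases j
  · exact (hS.1 a b).trans (hT.1 a b).symm
  · exact (hS.2.1 a b).trans (hT.2.1 a b).symm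

/-- In a split the word of the second sender is listed in one piece. -/
lemma IsSplit.contiguous {n i : ℕ} {S : Perm n 0} (h : IsSplit i S) : Contiguous 1 S := by
  rintro ⟨j, a⟩ hj
  obtain rfl : j = 0 := by fin_cases j <;> simp_all
  by_cases ha : (show Fin (2 ^ n) from a : ℕ) < i
  · exact Or.inl fun b => (h.2.2 a b).2 ha
  · refine Or.inr fun b => ?_
    refine lt_of_le_of_ne (not_lt.1 fun hlt => ha ((h.2.2 a b).1 hlt)) fun he => ?_
    simpa using congrArg Prod.fst (S.injective he)

lemma senderEnt_of_isSplit [NeZero q] (P : ZMod q → ZMod q → PMF Y) {n i : ℕ} {s : Scheme q n 0}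
    (hs : ∀ j, s.transform j = polarTransform q n) {S : Perm n 0} (hS : IsSplit i S) (j : Fin 2) :
    s.senderEnt P S j = splitEnt P n i j :=
  Finset.sum_congr rfl fun a _ => symbolEnt_of_isSplit P hs hS (j, a)

/-- Aligning first sender 2 and then sender 1 makes almost all of the symbols that are good for
just one of the receivers good for both. -/
lemma exists_aligned_of_split [NeZero q] {PY : ZMod q → ZMod q → PMF Y} {PZ : ZMod q → ZMod q → PMF Z}
    {β : ℝ} (hβ : 0 ≤ β) {n : ℕ} {s : Scheme q n 0} (hs : IsAligned PY PZ β n s) {i i' : ℕ}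
    (hS : IsSplit i s.S) (hT : IsSplit i' s.T) (r : ℕ) :
    ∃ s' : Scheme q n (0 + r + r), IsAligned PY PZ β n s' ∧ IsMonotone s'.S ∧ IsMonotone s'.T ∧
      ∀ j, s'.senderEnt PY s'.S j = 2 ^ (0 + r + r) * s.senderEnt PY s.S j ∧
        s'.senderEnt PZ s'.T j = 2 ^ (0 + r + r) * s.senderEnt PZ s.T j ∧
        2 ^ r * (2 ^ r * (s.commonGood β PY PZ j).card + (2 ^ r - 1) *
          min (s.goodBad β PY s.S PZ s.T j).card (s.goodBad β PZ s.T PY s.S j).card) ≤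
          (s'.commonGood β PY PZ j).card := by
  -- The symbols of sender 2 are contiguous, hence aligning them preserves the common order of the
  -- symbols of sender 1.
  obtain ⟨t, ht⟩ := exists_aligns hβ hs hS.isMonotone hT.isMonotone (hS.sameOrder hT 1)
    (min_le_left _ _) (min_le_right _ _) r
  obtain ⟨-, -, hST⟩ := ht.other_order hS.contiguous hT.contiguous (hS.sameOrder hT)
  obtain ⟨o1, o2, o3⟩ := ht.other 0 (by simp)
  set a := min (s.goodBad β PY s.S PZ s.T 0).card (s.goodBad β PZ s.T PY s.S 0).card with ha
  obtain ⟨s', hs'⟩ := exists_aligns hβ ht.aligned ht.monoS ht.monoT (hST 0) (a := 2 ^ r * a)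
    (by rw [o2]; exact Nat.mul_le_mul_left _ (min_le_left _ _))
    (by rw [o3]; exact Nat.mul_le_mul_left _ (min_le_right _ _)) r
  refine ⟨s', hs'.aligned, hs'.monoS, hs'.monoT, fun j => ⟨?_, ?_, ?_⟩⟩
  · rw [hs'.entS, ht.entS]; ring
  · rw [hs'.entT, ht.entT]; ring
  · fin_cases j
    · refine le_trans (le_of_eq ?_) hs'.commonGood
      simp only [Fin.zero_eta]
      rw [o1]
      ring
    · simp only [Fin.mk_one]
      rw [(hs'.other 1 (by simp)).1]
      exact Nat.mul_le_mul_left _ ht.commonGood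

open Classical in
/-- For any two points on the dominant faces of the two pentagons, described by the conditional
entropies `gY`, `gZ` of the first sender, there are aligned schemes of all large lengths that
approximate these points and make their componentwise minimum available as common good symbols. -/
theorem exists_aligned_scheme [Fact q.Prime] (PY : ZMod q → ZMod q → PMF Y)
    (PZ : ZMod q → ZMod q → PMF Z) {gY gZ β ε : ℝ} (hY1 : entFst PY ≤ gY)
    (hY2 : gY ≤ entSum PY - entSnd PY) (hZ1 : entFst PZ ≤ gZ) (hZ2 : gZ ≤ entSum PZ - entSnd PZ)
    (hβ0 : 0 < β) (hβ : β < 1 / 2) (hε : 0 < ε) :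
    ∃ k n₁ : ℕ, ∀ n ≥ n₁, ∃ s : Scheme q n k,
      IsAligned PY PZ β n s ∧ IsMonotone s.S ∧ IsMonotone s.T ∧ ∀ j : Fin 2,
        |s.senderEnt PY s.S j / (2 ^ k * 2 ^ n) - ![gY, entSum PY - gY] j| < ε ∧
        |s.senderEnt PZ s.T j / (2 ^ k * 2 ^ n) - ![gZ, entSum PZ - gZ] j| < ε ∧
        min (Real.log q - s.senderEnt PY s.S j / (2 ^ k * 2 ^ n))
          (Real.log q - s.senderEnt PZ s.T j / (2 ^ k * 2 ^ n)) - ε <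
          (s.commonGood β PY PZ j).card / (2 ^ k * 2 ^ n) * Real.log q := by
  have hL : 0 < Real.log q := Real.log_pos (by exact_mod_cast (Fact.out : q.Prime).one_lt)
  set L := Real.log q with hLdef
  have hpow : Filter.Tendsto (fun r : ℕ => L / 2 ^ r) Filter.atTop (nhds 0) :=
    tendsto_const_nhds.div_atTop (tendsto_pow_atTop_atTop_of_one_lt (by norm_num))
  -- the number of alignment steps and the resolution of the split do not depend on the length
  obtain ⟨r, hr⟩ := (hpow.eventually_lt_const (show (0 : ℝ) < ε / 4 by positivity)).exists
  obtain ⟨n₀, hn₀⟩ := (hpow.eventually_lt_const hε).exists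
  obtain ⟨i, hi, hiY, hiY'⟩ := exists_split_approx PY n₀ hY1 hY2
  obtain ⟨i', hi', hiZ, hiZ'⟩ := exists_split_approx PZ n₀ hZ1 hZ2
  have hδ : 0 < ε / (8 * L) := by positivity
  obtain ⟨mY, hmY⟩ := exists_split_polarization PY hβ0.le hβ hδ n₀ i
  obtain ⟨mZ, hmZ⟩ := exists_split_polarization PZ hβ0.le hβ hδ n₀ i'
  obtain ⟨n₂, hn₂⟩ := Filter.eventually_atTop.1 ((tendsto_pow_mul_threshold hβ0).eventually_lt_const
    (show (0 : ℝ) < ε / (4 * L) by positivity))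
  refine ⟨0 + r + r, max (n₀ + max mY mZ) n₂, fun n hn => ?_⟩
  obtain ⟨m, rfl⟩ : ∃ m, n = n₀ + m := ⟨n - n₀, by omega⟩
  have hθ := (threshold_le_pow_mul (n₀ + m) β).trans_lt (hn₂ _ (le_trans (le_max_right _ _) hn))
  have hmY' := hmY m (by omega)
  have hmZ' := hmZ m (by omega)
  let s := splitScheme q (n₀ + m) (i * 2 ^ m) (i' * 2 ^ m)
  have hS : IsSplit (i * 2 ^ m) s.S := isSplit_splitPerm _ _
  have hT : IsSplit (i' * 2 ^ m) s.T := isSplit_splitPerm _ _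
  have hs : IsAligned PY PZ β (n₀ + m) s :=
    .base s _ _ (by rw [pow_add]; exact Nat.mul_le_mul_right _ hi)
      (by rw [pow_add]; exact Nat.mul_le_mul_right _ hi') (fun _ => rfl) hS hT
  obtain ⟨s', hal, hmS, hmT, hs'⟩ := exists_aligned_of_split hβ0.le hs hS hT r
  refine ⟨s', hal, hmS, hmT, fun j => ?_⟩
  obtain ⟨eY, eZ, hc⟩ := hs' j
  have hN : (0 : ℝ) < 2 ^ (n₀ + m) := by positivity
  have hK : (0 : ℝ) < 2 ^ (0 + r + r) := by positivity
  have eY' : s'.senderEnt PY s'.S j / (2 ^ (0 + r + r) * 2 ^ (n₀ + m)) =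
      splitEnt PY n₀ i j / 2 ^ n₀ := by
    rw [eY, mul_div_mul_left _ _ hK.ne', senderEnt_of_isSplit PY (fun _ => rfl) hS,
      splitEnt_pow_mul, pow_add]
    field_simp
  have eZ' : s'.senderEnt PZ s'.T j / (2 ^ (0 + r + r) * 2 ^ (n₀ + m)) =
      splitEnt PZ n₀ i' j / 2 ^ n₀ := by
    rw [eZ, mul_div_mul_left _ _ hK.ne', senderEnt_of_isSplit PZ (fun _ => rfl) hT,
      splitEnt_pow_mul, pow_add]
    field_simp
  refine ⟨?_, ?_, ?_⟩
  · rw [eY']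
    fin_cases j
    · exact hiY.trans_lt hn₀
    · simp only [Fin.mk_one, Matrix.cons_val_one, Matrix.cons_val_zero]
      rw [hiY', show entSum PY - splitEnt PY n₀ i 0 / 2 ^ n₀ - (entSum PY - gY) =
        -(splitEnt PY n₀ i 0 / 2 ^ n₀ - gY) by ring, abs_neg]
      exact hiY.trans_lt hn₀
  · rw [eZ']
    fin_cases j
    · exact hiZ.trans_lt hn₀
    · simp only [Fin.mk_one, Matrix.cons_val_one, Matrix.cons_val_zero]
      rw [hiZ', show entSum PZ - splitEnt PZ n₀ i' 0 / 2 ^ n₀ - (entSum PZ - gZ) =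
        -(splitEnt PZ n₀ i' 0 / 2 ^ n₀ - gZ) by ring, abs_neg]
      exact hiZ.trans_lt hn₀
  · have hb := hs.isBijective
    have hEY : ∀ a : Fin (2 ^ (n₀ + m)), s.symbolEnt PY s.S (j, a) =
        famEnt (splitFam PY (n₀ + m) (i * 2 ^ m) (j, a)) := fun a =>
      symbolEnt_of_isSplit PY (fun _ => rfl) hS (j, a)
    have hEZ : ∀ a : Fin (2 ^ (n₀ + m)), s.symbolEnt PZ s.T (j, a) =
        famEnt (splitFam PZ (n₀ + m) (i' * 2 ^ m) (j, a)) := fun a =>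
      symbolEnt_of_isSplit PZ (fun _ => rfl) hT (j, a)
    set θ := threshold (n₀ + m) β * L with hθdef
    have hθ0 : 0 ≤ θ := mul_nonneg (threshold_pos _ _).le hL.le
    have hθ' : θ ≤ ε / 4 := by
      calc θ ≤ ε / (4 * L) * L := mul_le_mul_of_nonneg_right hθ.le hL.le
        _ = ε / 4 := by field_simp
    have hpY : (countOf fun x : Idx (n₀ + m) 0 => ¬ (s.symbolEnt PY s.S (j, x) < θ ∨
        L - s.symbolEnt PY s.S (j, x) < θ) : ℝ) ≤ ε / (8 * L) * 2 ^ (n₀ + m) := by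
      refine le_trans (le_of_eq ?_) (hmY' j)
      rw [card_filter_eq_countOf]
      congr 1
      exact congrArg (countOf (α := Fin (2 ^ (n₀ + m)))) (funext fun a =>
        congrArg (fun e => ¬ (e < θ ∨ L - e < θ)) (hEY a))
    have hpZ : (countOf fun x : Idx (n₀ + m) 0 => ¬ (s.symbolEnt PZ s.T (j, x) < θ ∨
        L - s.symbolEnt PZ s.T (j, x) < θ) : ℝ) ≤ ε / (8 * L) * 2 ^ (n₀ + m) := by
      refine le_trans (le_of_eq ?_) (hmZ' j)
      rw [card_filter_eq_countOf]
      congr 1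
      exact congrArg (countOf (α := Fin (2 ^ (n₀ + m)))) (funext fun a =>
        congrArg (fun e => ¬ (e < θ ∨ L - e < θ)) (hEZ a))
    have c1 := sum_sub_le_countOf hθ0 hL.le (fun x => s.symbolEnt_nonneg PY s.S (j, x)) hpY hpZ
    have c2 := sum_sub_le_countOf hθ0 hL.le (fun x => s.symbolEnt_nonneg PZ s.T (j, x)) hpZ hpY
    have hswap : (countOf fun x => s.symbolEnt PZ s.T (j, x) < θ ∧ s.symbolEnt PY s.S (j, x) < θ) =
        countOf fun x => s.symbolEnt PY s.S (j, x) < θ ∧ s.symbolEnt PZ s.T (j, x) < θ := by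
      simp only [and_comm]
    rw [hswap] at c2
    rw [← Scheme.card_commonGood hb, ← Scheme.card_goodBad hb, Finset.sum_sub_distrib,
      Finset.sum_const, Finset.card_univ, card_idx, nsmul_eq_mul] at c1 c2
    change _ - s.senderEnt PY s.S j ≤ _ at c1
    change _ - s.senderEnt PZ s.T j ≤ _ at c2
    have hd : 2 * L * (ε / (8 * L) * 2 ^ (n₀ + m)) = ε / 4 * 2 ^ (n₀ + m) := by
      field_simp; norm_num
    rw [hd] at c1 c2
    rw [eY, eZ, mul_div_mul_left _ _ hK.ne', mul_div_mul_left _ _ hK.ne']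
    set C := (s.commonGood β PY PZ j).card
    set A := (s.goodBad β PY s.S PZ s.T j).card
    set B := (s.goodBad β PZ s.T PY s.S j).card
    set N : ℝ := 2 ^ (n₀ + m) with hNdef
    push_cast at c1 c2
    rw [one_mul, ← hNdef] at c1 c2
    have hAN : (min A B : ℝ) ≤ N := by
      refine (min_le_left _ _).trans ?_
      have : A ≤ Fintype.card (Idx (n₀ + m) 0) := Finset.card_le_univ _
      rw [card_idx] at this
      rw [hNdef]
      exact_mod_cast this.trans_eq (by simp)
    have hR : (1 : ℝ) ≤ 2 ^ r := one_le_pow₀ (by norm_num)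
    have hc' : (2 : ℝ) ^ r * (2 ^ r * C + (2 ^ r - 1) * min (A : ℝ) B) ≤
        (s'.commonGood β PY PZ j).card := by
      have h := hc
      have h' : ((2 ^ r * (2 ^ r * C + (2 ^ r - 1) * min A B) : ℕ) : ℝ) ≤
        (s'.commonGood β PY PZ j).card := by exact_mod_cast h
      push_cast [Nat.cast_sub Nat.one_le_two_pow] at h'
      exact h'
    -- of the pairs, a fraction `2 ^ (-r)` stays unaligned
    have hfrac : (C + min (A : ℝ) B) / N * L - L / 2 ^ r ≤
        (s'.commonGood β PY PZ j).card / (2 ^ (0 + r + r) * N) * L := by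
      have h1 : (2 : ℝ) ^ (0 + r + r) = 2 ^ r * 2 ^ r := by rw [zero_add, pow_add]
      rw [h1]
      have h2 : (C + min (A : ℝ) B) / N - 1 / 2 ^ r ≤
          (s'.commonGood β PY PZ j).card / (2 ^ r * 2 ^ r * N) := by
        rw [le_div_iff₀ (by positivity)]
        refine le_trans ?_ hc'
        have : ((C + min (A : ℝ) B) / N - 1 / 2 ^ r) * (2 ^ r * 2 ^ r * N) =
          2 ^ r * (2 ^ r * (C + min (A : ℝ) B) - N) := by field_simp
        rw [this]
        refine mul_le_mul_of_nonneg_left ?_ (by positivity)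
        linarith
      have h3 := mul_le_mul_of_nonneg_right h2 hL.le
      refine le_trans (le_of_eq ?_) h3
      ring
    refine lt_of_lt_of_le ?_ hfrac
    -- the smaller of the two rates belongs to the receiver with fewer symbols good for it alone
    have hmin : min (L - s.senderEnt PY s.S j / N) (L - s.senderEnt PZ s.T j / N) ≤
        (C + min (A : ℝ) B) / N * L + ε / 2 := by
      have conv : ∀ {E D : ℝ}, N * L - E ≤ L * (C + D) + θ * N + ε / 4 * N →
          L - E / N ≤ (C + D) / N * L + ε / 2 := by
        intro E D h
        rw [show L - E / N = (N * L - E) / N by field_simp,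
          show (C + D) / N * L + ε / 2 = (L * (C + D) + ε / 2 * N) / N by field_simp]
        have hθN := mul_le_mul_of_nonneg_right hθ' hN.le
        refine div_le_div_of_nonneg_right (h.trans ?_) hN.le
        linarith
      rcases le_total (A : ℝ) B with hAB | hAB
      · rw [min_eq_left hAB]
        exact (min_le_left _ _).trans (conv c1)
      · rw [min_eq_right hAB]
        exact (min_le_right _ _).trans (conv c2)
    linarith

end Core

/-! ### Pentagons -/

section Pentagon

variable {T X W Y : Type*} [Fintype T] [Fintype X] [Fintype W] [Fintype Y]

/-- The pentagon with the bounds `a 0`, `a 1` on the two rates and `a 2` on their sum. -/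
def pentagon (a : Fin 3 → ℝ) : Set (Fin 2 → ℝ) :=
  {R | 0 ≤ R 0 ∧ 0 ≤ R 1 ∧ R 0 ≤ a 0 ∧ R 1 ≤ a 1 ∧ R 0 + R 1 ≤ a 2}

/-- The three mutual informations that bound the rate region. -/
def rateBounds (pQ : PMF T) (pX : T → PMF X) (pW : T → PMF W) (P : X → W → PMF Y) : Fin 3 → ℝ :=
  ![condMutualInfo (jointLaw pQ pX pW P)
      (fun ω => ω.2.1) (fun ω => (ω.2.2.2, ω.2.2.1)) (fun ω => ω.1),
    condMutualInfo (jointLaw pQ pX pW P)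
      (fun ω => ω.2.2.1) (fun ω => (ω.2.2.2, ω.2.1)) (fun ω => ω.1),
    condMutualInfo (jointLaw pQ pX pW P)
      (fun ω => (ω.2.1, ω.2.2.1)) (fun ω => ω.2.2.2) (fun ω => ω.1)]

lemma rateRegion_eq_pentagon (pQ : PMF T) (pX : T → PMF X) (pW : T → PMF W) (P : X → W → PMF Y) :
    rateRegion pQ pX pW P = pentagon (rateBounds pQ pX pW P) := rfl

lemma toReal_jointLaw (pQ : PMF T) (pX : T → PMF X) (pW : T → PMF W) (P : X → W → PMF Y)
    (ω : T × X × W × Y) : (jointLaw pQ pX pW P ω).toReal =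
      (pQ ω.1).toReal * ((pX ω.1 ω.2.1).toReal * (pW ω.1 ω.2.2.1).toReal *
        (P ω.2.1 ω.2.2.1 ω.2.2.2).toReal) := by
  classical
  obtain ⟨t, x, w, y⟩ := ω
  have h : jointLaw pQ pX pW P (t, x, w, y) = pQ t * (pX t x * (pW t w * P x w y)) := by
    simp only [jointLaw, PMF.bind_apply, PMF.map_apply, tsum_fintype, Prod.mk.injEq, ite_and,
      Finset.sum_ite_irrel, Finset.sum_const_zero, Finset.sum_ite_eq, Finset.mem_univ, if_true,
      mul_ite, mul_zero]
  simp only [h, ENNReal.toReal_mul]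
  ring

/-- `H(Y | W)` for independent inputs with the laws `α`, `γ` and the transition function `c`. -/
def outEntFst (c : X → W → Y → ℝ) (α : X → ℝ) (γ : W → ℝ) : ℝ :=
  ∑ w, γ w * ∑ y, Real.negMulLog (∑ x, α x * c x w y)

/-- `H(Y | X)` for independent inputs with the laws `α`, `γ` and the transition function `c`. -/
def outEntSnd (c : X → W → Y → ℝ) (α : X → ℝ) (γ : W → ℝ) : ℝ :=
  ∑ x, α x * ∑ y, Real.negMulLog (∑ w, γ w * c x w y)

/-- `H(Y)` for independent inputs with the laws `α`, `γ` and the transition function `c`. -/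
def outEntSum (c : X → W → Y → ℝ) (α : X → ℝ) (γ : W → ℝ) : ℝ :=
  ∑ y, Real.negMulLog (∑ x, ∑ w, α x * γ w * c x w y)

/-- `H(Y | X, W)` for independent inputs with the laws `α`, `γ` and the transition function `c`. -/
def outEntBoth (c : X → W → Y → ℝ) (α : X → ℝ) (γ : W → ℝ) : ℝ :=
  ∑ x, ∑ w, α x * γ w * ∑ y, Real.negMulLog (c x w y)

/-- The bounds of the pentagon, in nats, for constant `Q`. -/
def chanBounds (c : X → W → Y → ℝ) (α : X → ℝ) (γ : W → ℝ) : Fin 3 → ℝ :=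
  ![outEntFst c α γ - outEntBoth c α γ, outEntSnd c α γ - outEntBoth c α γ,
    outEntSum c α γ - outEntBoth c α γ]

lemma sum_negMulLog_mul {ι : Type*} [Fintype ι] (c : ℝ) {v : ι → ℝ} (hv : ∑ i, v i = 1) :
    ∑ i, Real.negMulLog (c * v i) = Real.negMulLog c + c * ∑ i, Real.negMulLog (v i) := by
  simp only [Real.negMulLog_mul, Finset.sum_add_distrib, ← Finset.sum_mul, ← Finset.mul_sum, hv,
    one_mul]

open Classical in
/-- The chain rule for an entropy with the time-sharing variable as a component. -/
lemma entropy_eq_sum_cond {Ω A A' : Type*} [Fintype Ω] [Fintype A] [Fintype A'] (μ : PMF Ω)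
    (f : Ω → A) (g : T × A' ≃ A) {p : T → ℝ} {κ : T → A' → ℝ} (hκ : ∀ t, ∑ a, κ t a = 1)
    (h : ∀ t a, ∑ ω, (if f ω = g (t, a) then (μ ω).toReal else 0) = p t * κ t a) :
    entropy μ f = (∑ t, (Real.negMulLog (p t) + p t * ∑ a, Real.negMulLog (κ t a))) /
      Real.log 2 := by
  rw [entropy_eq_sum, ← Equiv.sum_comp g, Fintype.sum_prod_type]
  simp only [h, sum_negMulLog_mul _ (hκ _)]

variable {c : X → W → Y → ℝ} {α : X → ℝ} {γ : W → ℝ}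

lemma sum_outFst (hα : ∑ x, α x = 1) (hc : ∀ x w, ∑ y, c x w y = 1) (w : W) :
    ∑ y, ∑ x, α x * c x w y = 1 := by
  rw [Finset.sum_comm]
  simp only [← Finset.mul_sum, hc, mul_one, hα]

lemma sum_outSnd (hγ : ∑ w, γ w = 1) (hc : ∀ x w, ∑ y, c x w y = 1) (x : X) :
    ∑ y, ∑ w, γ w * c x w y = 1 := by
  rw [Finset.sum_comm]
  simp only [← Finset.mul_sum, hc, mul_one, hγ]

lemma sum_outSum (hα : ∑ x, α x = 1) (hγ : ∑ w, γ w = 1) (hc : ∀ x w, ∑ y, c x w y = 1) :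
    ∑ y, ∑ x, ∑ w, α x * γ w * c x w y = 1 := by
  rw [Finset.sum_comm]
  simp only [mul_assoc, ← Finset.mul_sum, sum_outSnd hγ hc, mul_one, hα]

lemma negMulLog_sum_mul {ι κ : Type*} [Fintype ι] [Fintype κ] {u : ι → ℝ} {v : ι → κ → ℝ}
    (hv : ∀ i, ∑ a, v i a = 1) :
    ∑ i, ∑ a, Real.negMulLog (u i * v i a) =
      ∑ i, Real.negMulLog (u i) + ∑ i, u i * ∑ a, Real.negMulLog (v i a) := by
  simp only [sum_negMulLog_mul _ (hv _), Finset.sum_add_distrib]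

/-- The mutual informations of the pentagon as differences of output entropies. -/
lemma rateBounds_eq (pQ : PMF T) (pX : T → PMF X) (pW : T → PMF W) (P : X → W → PMF Y) (i : Fin 3) :
    rateBounds pQ pX pW P i = (∑ t, (pQ t).toReal *
      chanBounds (fun x w y => (P x w y).toReal) (fun x => (pX t x).toReal)
        (fun w => (pW t w).toReal) i) / Real.log 2 := by
  classical
  set p : T → ℝ := fun t => (pQ t).toReal with hp
  set α : T → X → ℝ := fun t x => (pX t x).toReal with hαdef
  set γ : T → W → ℝ := fun t w => (pW t w).toReal with hγdef
  set c : X → W → Y → ℝ := fun x w y => (P x w y).toReal with hcdef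
  have hα : ∀ t, ∑ x, α t x = 1 := fun t => sum_toReal_eq_one _
  have hγ : ∀ t, ∑ w, γ t w = 1 := fun t => sum_toReal_eq_one _
  have hc : ∀ x w, ∑ y, c x w y = 1 := fun x w => sum_toReal_eq_one _
  have hμ : ∀ ω, (jointLaw pQ pX pW P ω).toReal =
    p ω.1 * (α ω.1 ω.2.1 * γ ω.1 ω.2.2.1 * c ω.2.1 ω.2.2.1 ω.2.2.2) := toReal_jointLaw pQ pX pW P
  have eQ : entropy (jointLaw pQ pX pW P) (fun ω => ω.1) =
      (∑ t, (Real.negMulLog (p t) + p t * 0)) / Real.log 2 := by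
    rw [entropy_eq_sum_cond (A' := Unit) (p := p) (κ := fun _ _ => 1) _ _
      (Equiv.prodPUnit T) (by simp)]
    · simp
    · intro t a
      simp only [Fintype.sum_prod_type, hμ, Equiv.prodPUnit_apply, Finset.sum_ite_irrel,
        Finset.sum_const_zero, Finset.sum_ite_eq', Finset.mem_univ, if_true, ← Finset.mul_sum, hc,
        mul_one, hγ, hα]
  have eXQ : entropy (jointLaw pQ pX pW P) (fun ω => (ω.2.1, ω.1)) =
      (∑ t, (Real.negMulLog (p t) + p t * ∑ x, Real.negMulLog (α t x))) / Real.log 2 := by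
    refine entropy_eq_sum_cond (p := p) (κ := α) _ _ (Equiv.prodComm T X) hα ?_
    intro t a
    simp only [Fintype.sum_prod_type, hμ, Equiv.prodComm_apply, Prod.swap_prod_mk, Prod.mk.injEq,
      ite_and, Finset.sum_ite_irrel,
      Finset.sum_const_zero, Finset.sum_ite_eq', Finset.mem_univ, if_true, ← Finset.mul_sum, hc,
      mul_one, hγ]
  have eWQ : entropy (jointLaw pQ pX pW P) (fun ω => (ω.2.2.1, ω.1)) =
      (∑ t, (Real.negMulLog (p t) + p t * ∑ w, Real.negMulLog (γ t w))) / Real.log 2 := by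
    refine entropy_eq_sum_cond (p := p) (κ := γ) _ _ (Equiv.prodComm T W) hγ ?_
    intro t a
    simp only [Fintype.sum_prod_type, hμ, Equiv.prodComm_apply, Prod.swap_prod_mk, Prod.mk.injEq,
      ite_and, Finset.sum_ite_irrel,
      Finset.sum_const_zero, Finset.sum_ite_eq', Finset.mem_univ, if_true, ← Finset.mul_sum, hc,
      mul_one]
    rw [← Finset.sum_mul, hα, one_mul]
  have eXWQ : entropy (jointLaw pQ pX pW P) (fun ω => ((ω.2.1, ω.2.2.1), ω.1)) =
      (∑ t, (Real.negMulLog (p t) + p t * (∑ x, Real.negMulLog (α t x) +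
        ∑ w, Real.negMulLog (γ t w)))) / Real.log 2 := by
    rw [entropy_eq_sum_cond (p := p) (κ := fun t (a : X × W) => α t a.1 * γ t a.2) _ _
      (Equiv.prodComm T (X × W))]
    · simp only [Fintype.sum_prod_type, negMulLog_sum_mul fun _ => hγ _, ← Finset.sum_mul, hα,
        one_mul]
    · intro t
      simp only [Fintype.sum_prod_type, ← Finset.mul_sum, hγ, mul_one, hα]
    · intro t a
      obtain ⟨x, w⟩ := a
      simp only [Fintype.sum_prod_type, hμ, Equiv.prodComm_apply, Prod.swap_prod_mk, Prod.mk.injEq,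
        ite_and, Finset.sum_ite_irrel,
        Finset.sum_const_zero, Finset.sum_ite_eq', Finset.mem_univ, if_true, ← Finset.mul_sum, hc,
        mul_one]
  have eYQ : entropy (jointLaw pQ pX pW P) (fun ω => (ω.2.2.2, ω.1)) =
      (∑ t, (Real.negMulLog (p t) + p t * outEntSum c (α t) (γ t))) / Real.log 2 := by
    refine entropy_eq_sum_cond (p := p) (κ := fun t y => ∑ x, ∑ w, α t x * γ t w * c x w y) _ _
      (Equiv.prodComm T Y) (fun t => sum_outSum (hα t) (hγ t) hc) ?_
    intro t a
    simp only [Fintype.sum_prod_type, hμ, Equiv.prodComm_apply, Prod.swap_prod_mk, Prod.mk.injEq,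
      ite_and, Finset.sum_ite_irrel,
      Finset.sum_const_zero, Finset.sum_ite_eq', Finset.mem_univ, if_true, ← Finset.mul_sum]
  have eYWQ : entropy (jointLaw pQ pX pW P) (fun ω => ((ω.2.2.2, ω.2.2.1), ω.1)) =
      (∑ t, (Real.negMulLog (p t) + p t * (∑ w, Real.negMulLog (γ t w) +
        outEntFst c (α t) (γ t)))) / Real.log 2 := by
    rw [entropy_eq_sum_cond (p := p) (κ := fun t (a : Y × W) => γ t a.2 * ∑ x, α t x * c x a.2 a.1)
      _ _ (Equiv.prodComm T (Y × W))]
    · simp only [Fintype.sum_prod_type]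
      simp only [Finset.sum_comm (γ := Y), negMulLog_sum_mul fun w => sum_outFst (hα _) hc w]
      rfl
    · intro t
      simp only [Fintype.sum_prod_type]
      rw [Finset.sum_comm]
      simp only [← Finset.mul_sum, sum_outFst (hα _) hc, mul_one, hγ]
    · intro t a
      obtain ⟨y, w⟩ := a
      simp only [Fintype.sum_prod_type, hμ, Equiv.prodComm_apply, Prod.swap_prod_mk, Prod.mk.injEq,
        ite_and, Finset.sum_ite_irrel,
        Finset.sum_const_zero, Finset.sum_ite_eq', Finset.mem_univ, if_true, Finset.mul_sum]
      exact Finset.sum_congr rfl fun x _ => by ring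
  have eYXQ : entropy (jointLaw pQ pX pW P) (fun ω => ((ω.2.2.2, ω.2.1), ω.1)) =
      (∑ t, (Real.negMulLog (p t) + p t * (∑ x, Real.negMulLog (α t x) +
        outEntSnd c (α t) (γ t)))) / Real.log 2 := by
    rw [entropy_eq_sum_cond (p := p) (κ := fun t (a : Y × X) => α t a.2 * ∑ w, γ t w * c a.2 w a.1)
      _ _ (Equiv.prodComm T (Y × X))]
    · simp only [Fintype.sum_prod_type]
      simp only [Finset.sum_comm (γ := Y), negMulLog_sum_mul fun x => sum_outSnd (hγ _) hc x]
      rfl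
    · intro t
      simp only [Fintype.sum_prod_type]
      rw [Finset.sum_comm]
      simp only [← Finset.mul_sum, sum_outSnd (hγ _) hc, mul_one, hα]
    · intro t a
      obtain ⟨y, x⟩ := a
      simp only [Fintype.sum_prod_type, hμ, Equiv.prodComm_apply, Prod.swap_prod_mk, Prod.mk.injEq,
        ite_and, Finset.sum_ite_irrel,
        Finset.sum_const_zero, Finset.sum_ite_eq', Finset.mem_univ, if_true, Finset.mul_sum]
      exact Finset.sum_congr rfl fun x _ => by ring
  -- the entropy of all variables, up to the order of the components
  have eAll : ∀ {A : Type _} [Fintype A] (f : T × X × W × Y → A) (g : T × (X × W × Y) ≃ A),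
      (∀ ω, f ω = g ω) → entropy (jointLaw pQ pX pW P) f =
      (∑ t, (Real.negMulLog (p t) + p t * (∑ x, Real.negMulLog (α t x) +
        ∑ w, Real.negMulLog (γ t w) + outEntBoth c (α t) (γ t)))) / Real.log 2 := by
    intro A _ f g hfg
    rw [entropy_eq_sum_cond (p := p) (κ := fun t (a : X × W × Y) =>
      α t a.1 * γ t a.2.1 * c a.1 a.2.1 a.2.2) _ _ g]
    · congr 1
      refine Finset.sum_congr rfl fun t _ => ?_
      congr 2
      simp only [Fintype.sum_prod_type]
      have h1 : ∀ x, ∑ w, ∑ y, Real.negMulLog (α t x * γ t w * c x w y) =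
          ∑ w, Real.negMulLog (α t x * γ t w) +
            ∑ w, α t x * γ t w * ∑ y, Real.negMulLog (c x w y) :=
        fun x => negMulLog_sum_mul fun w => hc x w
      simp only [h1, Finset.sum_add_distrib]
      congr 1
      rw [negMulLog_sum_mul fun _ => hγ t, ← Finset.sum_mul, hα, one_mul]
    · intro t
      simp only [Fintype.sum_prod_type, ← Finset.mul_sum, hc, hγ, mul_one, hα]
    · rintro t ⟨x, w, y⟩
      simp only [hfg, EmbeddingLike.apply_eq_iff_eq, hμ]
      rw [Finset.sum_ite_eq' Finset.univ (t, x, w, y)]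
      simp
  have h1 : entropy (jointLaw pQ pX pW P) (fun ω => (ω.2.1, (ω.2.2.2, ω.2.2.1), ω.1)) = _ :=
    eAll _ ⟨fun ω => (ω.2.1, (ω.2.2.2, ω.2.2.1), ω.1), fun a => (a.2.2, a.1, a.2.1.2, a.2.1.1),
      fun _ => rfl, fun _ => rfl⟩ fun _ => rfl
  have h2 : entropy (jointLaw pQ pX pW P) (fun ω => (ω.2.2.1, (ω.2.2.2, ω.2.1), ω.1)) = _ :=
    eAll _ ⟨fun ω => (ω.2.2.1, (ω.2.2.2, ω.2.1), ω.1), fun a => (a.2.2, a.2.1.2, a.1, a.2.1.1),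
      fun _ => rfl, fun _ => rfl⟩ fun _ => rfl
  have h3 : entropy (jointLaw pQ pX pW P) (fun ω => ((ω.2.1, ω.2.2.1), ω.2.2.2, ω.1)) = _ :=
    eAll _ ⟨fun ω => ((ω.2.1, ω.2.2.1), ω.2.2.2, ω.1), fun a => (a.2.2, a.1.1, a.1.2, a.2.1),
      fun _ => rfl, fun _ => rfl⟩ fun _ => rfl
  fin_cases i
  · change condMutualInfo _ _ _ _ = (∑ t, p t * (outEntFst c (α t) (γ t) -
      outEntBoth c (α t) (γ t))) / Real.log 2
    rw [condMutualInfo, eXQ, eYWQ, h1, eQ, ← add_div, ← sub_div, ← sub_div,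
      ← Finset.sum_add_distrib, ← Finset.sum_sub_distrib, ← Finset.sum_sub_distrib]
    congr 1
    exact Finset.sum_congr rfl fun t _ => by ring
  · change condMutualInfo _ _ _ _ = (∑ t, p t * (outEntSnd c (α t) (γ t) -
      outEntBoth c (α t) (γ t))) / Real.log 2
    rw [condMutualInfo, eWQ, eYXQ, h2, eQ, ← add_div, ← sub_div, ← sub_div,
      ← Finset.sum_add_distrib, ← Finset.sum_sub_distrib, ← Finset.sum_sub_distrib]
    congr 1
    exact Finset.sum_congr rfl fun t _ => by ring
  · change condMutualInfo _ _ _ _ = (∑ t, p t * (outEntSum c (α t) (γ t) -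
      outEntBoth c (α t) (γ t))) / Real.log 2
    rw [condMutualInfo, eXWQ, eYQ, h3, eQ, ← add_div, ← sub_div, ← sub_div,
      ← Finset.sum_add_distrib, ← Finset.sum_sub_distrib, ← Finset.sum_sub_distrib]
    congr 1
    exact Finset.sum_congr rfl fun t _ => by ring

end Pentagon

/-! ### Pentagons for uniform inputs -/

section Uniform

variable {q : ℕ} [NeZero q] {Y : Type*} [Fintype Y]

/-- The bounds of the pentagon for uniform inputs. -/
def uniformBounds (P : ZMod q → ZMod q → PMF Y) : Fin 3 → ℝ :=
  rateBounds (PMF.pure ()) (fun _ => PMF.uniformOfFintype (ZMod q))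
    (fun _ => PMF.uniformOfFintype (ZMod q)) P

lemma uniformRegion_eq_pentagon (P : ZMod q → ZMod q → PMF Y) :
    uniformRegion P = pentagon (uniformBounds P) := rfl

lemma uniformBounds_eq_chanBounds (P : ZMod q → ZMod q → PMF Y) (i : Fin 3) :
    uniformBounds P i = chanBounds (fun x w y => (P x w y).toReal) (fun _ => (q : ℝ)⁻¹)
      (fun _ => (q : ℝ)⁻¹) i / Real.log 2 := by
  rw [uniformBounds, rateBounds_eq]
  simp [PMF.uniformOfFintype_apply, ZMod.card]

/-- The joint law of one use of the channel with uniform inputs. -/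
def uniformLaw (P : ZMod q → ZMod q → PMF Y) : PMF (Unit × ZMod q × ZMod q × Y) :=
  jointLaw (PMF.pure ()) (fun _ => PMF.uniformOfFintype (ZMod q))
    (fun _ => PMF.uniformOfFintype (ZMod q)) P

lemma toReal_uniformLaw (P : ZMod q → ZMod q → PMF Y) (ω : Unit × ZMod q × ZMod q × Y) :
    (uniformLaw P ω).toReal = (q : ℝ)⁻¹ * (q : ℝ)⁻¹ * (P ω.2.1 ω.2.2.1 ω.2.2.2).toReal := by
  rw [uniformLaw, toReal_jointLaw]
  simp [PMF.uniformOfFintype_apply, ZMod.card]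

/-- The two inputs of one use of the channel. -/
def inputSym (j : Fin 2) (ω : Unit × ZMod q × ZMod q × Y) : ZMod q := ![ω.2.1, ω.2.2.1] j

/-- The transform of a block of length one is the identity. -/
lemma famEnt_splitFam_zero (P : ZMod q → ZMod q → PMF Y) (i : ℕ) (j : Fin 2) {B : Type*} [Fintype B]
    (g : Unit × ZMod q × ZMod q × Y → B)
    (hg : ∀ ω ω', g ω = g ω' ↔ ω.2.2.2 = ω'.2.2.2 ∧ ∀ j' : Fin 2,
      splitKey (n := 0) i (j', 0) < splitKey (n := 0) i (j, 0) →
        inputSym j' ω = inputSym j' ω') :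
    splitEnt P 0 i j = famEnt (fam (fun ω => (uniformLaw P ω).toReal) (inputSym j) g) := by
  let e : (Unit × ZMod q × ZMod q × Y) ≃ (Fin 2 → Fin (2 ^ 0) → ZMod q) × (Fin (2 ^ 0) → Y) :=
    { toFun := fun ω => (fun j _ => inputSym j ω, fun _ => ω.2.2.2)
      invFun := fun ω => ((), ω.1 0 0, ω.1 1 0, ω.2 0)
      left_inv := fun ω => rfl
      right_inv := fun ω => by
        ext j a
        · obtain rfl : a = 0 := Subsingleton.elim (α := Fin 1) _ _
          fin_cases j <;> rfl
        · obtain rfl : j = 0 := Subsingleton.elim (α := Fin 1) _ _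
          rfl }
  have e1 : (fun ω => chanWt P (Fin (2 ^ 0)) (e ω)) = fun ω => (uniformLaw P ω).toReal := by
    funext ω
    rw [toReal_uniformLaw]
    simp only [chanWt, Fintype.card_fin, pow_zero, mul_one]
    rw [show ∏ t : Fin (2 ^ 0), (P ((e ω).1 0 t) ((e ω).1 1 t) ((e ω).2 t)).toReal =
      (P ω.2.1 ω.2.2.1 ω.2.2.2).toReal from Fin.prod_univ_one _, pow_two, mul_inv]
  have e2 : ∀ (j : Fin 2) (a : Fin (2 ^ 0)) ω, polarSym q 0 Y (j, a) (e ω) = inputSym j ω := by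
    intro j a ω
    obtain rfl : a = 0 := Subsingleton.elim (α := Fin 1) _ _
    change ∑ b : Fin 1, inputSym j ω * polarMatrix q 0 b 0 = _
    rw [Fin.sum_univ_one]
    simp [polarMatrix]
  have e3 : splitEnt P 0 i j = famEnt (splitFam P 0 i (j, 0)) := Fin.sum_univ_one _
  rw [e3]
  unfold splitFam symFam
  rw [← fam_comp_equiv e, e1, show (fun ω => polarSym q 0 Y (j, 0) (e ω)) = inputSym j from
    funext fun ω => e2 j 0 ω]
  refine (famEquiv_of_ker _ _ fun ω ω' => ?_).famEnt
  rw [pastInfo_eq_iff, hg]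
  refine and_congr ⟨fun h => congrFun h 0, fun h => funext fun _ => h⟩ ⟨fun h j' hj' => ?_,
    fun h w hw => ?_⟩
  · have := h (j', 0) hj'
    rwa [e2, e2] at this
  · obtain ⟨j', a⟩ := w
    obtain rfl : a = 0 := Subsingleton.elim (α := Fin 1) _ _
    rw [e2, e2]
    exact h j' hw

lemma entFst_eq (P : ZMod q → ZMod q → PMF Y) :
    entFst P = famEnt (fam (fun ω => (uniformLaw P ω).toReal) (fun ω => ω.2.1)
      (fun ω => ((ω.2.2.2, ω.2.2.1), ω.1))) := by
  refine famEnt_splitFam_zero P 0 0 _ fun ω ω' => ?_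
  rw [Fin.forall_fin_two]
  simp [splitKey, inputSym]

lemma entSnd_eq (P : ZMod q → ZMod q → PMF Y) :
    entSnd P = famEnt (fam (fun ω => (uniformLaw P ω).toReal) (fun ω => ω.2.2.1)
      (fun ω => ((ω.2.2.2, ω.2.1), ω.1))) := by
  refine famEnt_splitFam_zero P 1 1 _ fun ω ω' => ?_
  rw [Fin.forall_fin_two]
  simp [splitKey, inputSym]

lemma splitEnt_zero_one_eq (P : ZMod q → ZMod q → PMF Y) :
    splitEnt P 0 0 1 = famEnt (fam (fun ω => (uniformLaw P ω).toReal) (fun ω => ω.2.2.1)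
      (fun ω => (ω.2.2.2, ω.1))) := by
  refine famEnt_splitFam_zero P 0 1 _ fun ω ω' => ?_
  rw [Fin.forall_fin_two]
  simp [splitKey, inputSym]

lemma isLaw_uniformLaw {B : Type*} [Fintype B] (P : ZMod q → ZMod q → PMF Y)
    (X : Unit × ZMod q × ZMod q × Y → ZMod q) (g : Unit × ZMod q × ZMod q × Y → B) :
    IsLaw (fam (fun ω => (uniformLaw P ω).toReal) X g) :=
  isLaw_fam (fun _ => ENNReal.toReal_nonneg) (sum_toReal_eq_one _) _ _

lemma famEnt_fst_unit (P : ZMod q → ZMod q → PMF Y) :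
    famEnt (fam (fun ω => (uniformLaw P ω).toReal) (fun ω => ω.2.1) (fun ω => ω.1)) =
      Real.log q := by
  refine famEnt_eq_log (isLaw_uniformLaw P _ _) fun b x => ?_
  classical
  simp [fam, Fintype.sum_prod_type, toReal_uniformLaw, Finset.sum_ite_irrel,
    ← Finset.mul_sum, sum_toReal_eq_one]

lemma famEnt_snd_unit (P : ZMod q → ZMod q → PMF Y) :
    famEnt (fam (fun ω => (uniformLaw P ω).toReal) (fun ω => ω.2.2.1) (fun ω => ω.1)) =
      Real.log q := by
  refine famEnt_eq_log (isLaw_uniformLaw P _ _) fun b x => ?_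
  classical
  simp [fam, Fintype.sum_prod_type, toReal_uniformLaw, Finset.sum_ite_irrel,
    ← Finset.mul_sum, sum_toReal_eq_one]

lemma famEnt_fst_snd (P : ZMod q → ZMod q → PMF Y) :
    famEnt (fam (fun ω => (uniformLaw P ω).toReal) (fun ω => ω.2.1) (fun ω => (ω.2.2.1, ω.1))) =
      Real.log q := by
  refine famEnt_eq_log (isLaw_uniformLaw P _ _) fun b x => ?_
  obtain ⟨w, u⟩ := b
  classical
  simp [fam, Fintype.sum_prod_type, toReal_uniformLaw, ite_and, Finset.sum_ite_irrel,
    ← Finset.mul_sum, sum_toReal_eq_one]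

lemma uniformBounds_zero (P : ZMod q → ZMod q → PMF Y) :
    uniformBounds P 0 = (Real.log q - entFst P) / Real.log 2 := by
  rw [entFst_eq, ← famEnt_fst_unit P]
  exact condMutualInfo_eq (uniformLaw P) _ _ _

lemma uniformBounds_one (P : ZMod q → ZMod q → PMF Y) :
    uniformBounds P 1 = (Real.log q - entSnd P) / Real.log 2 := by
  rw [entSnd_eq, ← famEnt_snd_unit P]
  exact condMutualInfo_eq (uniformLaw P) _ _ _

lemma uniformBounds_two (P : ZMod q → ZMod q → PMF Y) :
    uniformBounds P 2 = (2 * Real.log q - entSum P) / Real.log 2 := by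
  have h2 : Real.log 2 ≠ 0 := (Real.log_pos (by norm_num)).ne'
  have a1 := entFst_eq P
  have a2 := splitEnt_zero_one_eq P
  have a3 := famEnt_fst_snd P
  have a4 := famEnt_snd_unit P
  rw [famEnt_fam_eq] at a1 a2 a3 a4
  have e1 : entropy (uniformLaw P) (fun ω => (ω.2.1, (ω.2.2.2, ω.2.2.1), ω.1)) =
      entropy (uniformLaw P) (fun ω => ((ω.2.1, ω.2.2.1), ω.2.2.2, ω.1)) :=
    (entropy_comp_equiv (uniformLaw P) (fun ω => (ω.2.1, (ω.2.2.2, ω.2.2.1), ω.1))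
      ⟨fun a => ((a.1, a.2.1.2), a.2.1.1, a.2.2), fun a => (a.1.1, (a.2.1, a.1.2), a.2.2),
        fun _ => rfl, fun _ => rfl⟩).symm
  have e2 : entropy (uniformLaw P) (fun ω => ((ω.2.2.2, ω.2.2.1), ω.1)) =
      entropy (uniformLaw P) (fun ω => (ω.2.2.1, ω.2.2.2, ω.1)) :=
    (entropy_comp_equiv (uniformLaw P) (fun ω => ((ω.2.2.2, ω.2.2.1), ω.1))
      ⟨fun a => (a.1.2, a.1.1, a.2), fun a => ((a.2.1, a.1), a.2.2),
        fun _ => rfl, fun _ => rfl⟩).symm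
  have e3 : entropy (uniformLaw P) (fun ω => (ω.2.1, ω.2.2.1, ω.1)) =
      entropy (uniformLaw P) (fun ω => ((ω.2.1, ω.2.2.1), ω.1)) :=
    (entropy_comp_equiv (uniformLaw P) (fun ω => (ω.2.1, ω.2.2.1, ω.1))
      ⟨fun a => ((a.1, a.2.1), a.2.2), fun a => (a.1.1, a.1.2, a.2),
        fun _ => rfl, fun _ => rfl⟩).symm
  rw [e1, e2] at a1
  rw [e3] at a3
  have hs : entSum P = entFst P + splitEnt P 0 0 1 := rfl
  rw [hs, a1, a2, two_mul]
  nth_rewrite 1 [← a3]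
  rw [← a4]
  change condMutualInfo (uniformLaw P) _ _ _ = _
  rw [condMutualInfo]
  field_simp
  ring

end Uniform

/-! ### Channels induced by symbol maps -/

section Induced

variable {q : ℕ} [NeZero q] {X W Y : Type*} [Fintype X] [Fintype W] [Fintype Y]

/-- The law of `f x'` for uniform `x'`. -/
def countingLaw (f : ZMod q → X) (x : X) : ℝ := (countOf fun x' => f x' = x) / q

/-- Averages over `𝔽_q` of a function of `f x'` are averages under the counting law. -/
lemma sum_comp_eq (f : ZMod q → X) (F : X → ℝ) :
    ∑ x', (q : ℝ)⁻¹ * F (f x') = ∑ x, countingLaw f x * F x := by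
  classical
  rw [← Finset.mul_sum, ← Finset.sum_fiberwise Finset.univ f, Finset.mul_sum]
  refine Finset.sum_congr rfl fun x _ => ?_
  rw [Finset.sum_congr rfl fun x' hx' => by rw [(Finset.mem_filter.1 hx').2], Finset.sum_const,
    card_filter_eq_countOf, nsmul_eq_mul, countingLaw]
  ring

lemma sum_countingLaw (f : ZMod q → X) : ∑ x, countingLaw f x = 1 := by
  have h := sum_comp_eq f fun _ => 1
  have hq : (q : ℝ) ≠ 0 := by exact_mod_cast NeZero.ne q
  simp only [mul_one, Finset.sum_const, Finset.card_univ, ZMod.card, nsmul_eq_mul] at h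
  rw [← h, mul_inv_cancel₀ hq]

variable {m : ℕ} (pQ : PMF (Fin m)) (fx : ZMod q → Fin m → X) (fw : ZMod q → Fin m → W)
  (P : X → W → PMF Y)

lemma toReal_inducedMAC (x' w' : ZMod q) (y : Y) (t : Fin m) :
    (inducedMAC pQ fx fw P x' w' (y, t)).toReal =
      (pQ t).toReal * (P (fx x' t) (fw w' t) y).toReal := by
  classical
  have h : inducedMAC pQ fx fw P x' w' (y, t) = pQ t * P (fx x' t) (fw w' t) y := by
    simp only [inducedMAC, PMF.bind_apply, PMF.map_apply, tsum_fintype, Prod.mk.injEq,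
      ite_and, Finset.sum_ite_eq, Finset.mem_univ, if_true, mul_ite, mul_zero]
  rw [h, ENNReal.toReal_mul]

/-- The pentagon of the induced channel is that of the counting laws of the symbol maps. -/
lemma uniformBounds_inducedMAC (i : Fin 3) :
    uniformBounds (inducedMAC pQ fx fw P) i = (∑ t, (pQ t).toReal *
      chanBounds (fun x w y => (P x w y).toReal) (countingLaw fun x' => fx x' t)
        (countingLaw fun w' => fw w' t) i) / Real.log 2 := by
  rw [uniformBounds_eq_chanBounds]
  congr 1
  set p : Fin m → ℝ := fun t => (pQ t).toReal with hp
  set c : X → W → Y → ℝ := fun x w y => (P x w y).toReal with hcdef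
  set u : ℝ := (q : ℝ)⁻¹ with hu
  have hq : (q : ℝ) ≠ 0 := by exact_mod_cast NeZero.ne q
  have huu : ∑ _x : ZMod q, u = 1 := by
    rw [Finset.sum_const, Finset.card_univ, ZMod.card, nsmul_eq_mul, hu, mul_inv_cancel₀ hq]
  have hc : ∀ x w, ∑ y, c x w y = 1 := fun x w => sum_toReal_eq_one _
  have hα : ∀ t, ∑ x, countingLaw (fun x' => fx x' t) x = 1 := fun t => sum_countingLaw _
  have hγ : ∀ t, ∑ w, countingLaw (fun w' => fw w' t) w = 1 := fun t => sum_countingLaw _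
  have hind : (fun x' w' (y : Y × Fin m) => (inducedMAC pQ fx fw P x' w' y).toReal) =
      fun x' w' y => p y.2 * c (fx x' y.2) (fw w' y.2) y.1 :=
    funext fun x' => funext fun w' => funext fun y => toReal_inducedMAC pQ fx fw P x' w' y.1 y.2
  have hX : ∀ (t : Fin m) (F : X → ℝ), ∑ x', u * F (fx x' t) =
      ∑ x, countingLaw (fun x' => fx x' t) x * F x := fun t F => sum_comp_eq (fun x' => fx x' t) F
  have hW : ∀ (t : Fin m) (F : W → ℝ), ∑ w', u * F (fw w' t) =
      ∑ w, countingLaw (fun w' => fw w' t) w * F w := fun t F => sum_comp_eq (fun w' => fw w' t) F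
  have hXW : ∀ (t : Fin m) (F : X → W → ℝ), ∑ x', ∑ w', u * u * F (fx x' t) (fw w' t) =
      ∑ x, ∑ w, countingLaw (fun x' => fx x' t) x * countingLaw (fun w' => fw w' t) w * F x w := by
    intro t F
    calc _ = ∑ x', u * ∑ w, countingLaw (fun w' => fw w' t) w * F (fx x' t) w :=
          Finset.sum_congr rfl fun x' _ => by
            rw [← hW t fun w => F (fx x' t) w, Finset.mul_sum]
            exact Finset.sum_congr rfl fun _ _ => by ring
      _ = _ := (hX t fun x => ∑ w, countingLaw (fun w' => fw w' t) w * F x w).trans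
          (Finset.sum_congr rfl fun x _ => by
            rw [Finset.mul_sum]
            exact Finset.sum_congr rfl fun _ _ => by ring)
  rw [hind]
  have e1 : outEntFst (fun x' w' (y : Y × Fin m) => p y.2 * c (fx x' y.2) (fw w' y.2) y.1)
      (fun _ => u) (fun _ => u) = ∑ t, (Real.negMulLog (p t) +
        p t * outEntFst c (countingLaw fun x' => fx x' t) (countingLaw fun w' => fw w' t)) := by
    have h : ∀ w' t, ∑ y, Real.negMulLog (∑ x', u * (p t * c (fx x' t) (fw w' t) y)) =
        Real.negMulLog (p t) + p t * ∑ y, Real.negMulLog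
          (∑ x, countingLaw (fun x' => fx x' t) x * c x (fw w' t) y) := fun w' t => by
      rw [← sum_negMulLog_mul _ (sum_outFst (hα t) hc _)]
      refine Finset.sum_congr rfl fun y _ => congrArg _ ?_
      rw [← hX t fun x => c x (fw w' t) y, Finset.mul_sum]
      exact Finset.sum_congr rfl fun _ _ => by ring
    unfold outEntFst
    simp only [Fintype.sum_prod_type_right, h]
    rw [Finset.sum_congr rfl fun w' _ => Finset.mul_sum _ _ _, Finset.sum_comm]
    refine Finset.sum_congr rfl fun t _ => ?_
    rw [hW t fun w => Real.negMulLog (p t) + p t * ∑ y,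
      Real.negMulLog (∑ x, countingLaw (fun x' => fx x' t) x * c x w y)]
    simp only [mul_add, Finset.sum_add_distrib, ← Finset.sum_mul, hγ, one_mul]
    rw [Finset.mul_sum]
    exact congrArg _ (Finset.sum_congr rfl fun _ _ => by ring)
  have e2 : outEntSnd (fun x' w' (y : Y × Fin m) => p y.2 * c (fx x' y.2) (fw w' y.2) y.1)
      (fun _ => u) (fun _ => u) = ∑ t, (Real.negMulLog (p t) +
        p t * outEntSnd c (countingLaw fun x' => fx x' t) (countingLaw fun w' => fw w' t)) := by
    have h : ∀ x' t, ∑ y, Real.negMulLog (∑ w', u * (p t * c (fx x' t) (fw w' t) y)) =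
        Real.negMulLog (p t) + p t * ∑ y, Real.negMulLog
          (∑ w, countingLaw (fun w' => fw w' t) w * c (fx x' t) w y) := fun x' t => by
      rw [← sum_negMulLog_mul _ (sum_outSnd (hγ t) hc _)]
      refine Finset.sum_congr rfl fun y _ => congrArg _ ?_
      rw [← hW t fun w => c (fx x' t) w y, Finset.mul_sum]
      exact Finset.sum_congr rfl fun _ _ => by ring
    unfold outEntSnd
    simp only [Fintype.sum_prod_type_right, h]
    rw [Finset.sum_congr rfl fun x' _ => Finset.mul_sum _ _ _, Finset.sum_comm]
    refine Finset.sum_congr rfl fun t _ => ?_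
    rw [hX t fun x => Real.negMulLog (p t) + p t * ∑ y,
      Real.negMulLog (∑ w, countingLaw (fun w' => fw w' t) w * c x w y)]
    simp only [mul_add, Finset.sum_add_distrib, ← Finset.sum_mul, hα, one_mul]
    rw [Finset.mul_sum]
    exact congrArg _ (Finset.sum_congr rfl fun _ _ => by ring)
  have e12 : outEntSum (fun x' w' (y : Y × Fin m) => p y.2 * c (fx x' y.2) (fw w' y.2) y.1)
      (fun _ => u) (fun _ => u) = ∑ t, (Real.negMulLog (p t) +
        p t * outEntSum c (countingLaw fun x' => fx x' t) (countingLaw fun w' => fw w' t)) := by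
    unfold outEntSum
    simp only [Fintype.sum_prod_type_right]
    refine Finset.sum_congr rfl fun t _ => ?_
    rw [← sum_negMulLog_mul _ (sum_outSum (hα t) (hγ t) hc)]
    refine Finset.sum_congr rfl fun y _ => congrArg _ ?_
    rw [hXW t fun x w => p t * c x w y, Finset.mul_sum]
    refine Finset.sum_congr rfl fun x _ => ?_
    rw [Finset.mul_sum]
    exact Finset.sum_congr rfl fun _ _ => by ring
  have e0 : outEntBoth (fun x' w' (y : Y × Fin m) => p y.2 * c (fx x' y.2) (fw w' y.2) y.1)
      (fun _ => u) (fun _ => u) = ∑ t, (Real.negMulLog (p t) +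
        p t * outEntBoth c (countingLaw fun x' => fx x' t) (countingLaw fun w' => fw w' t)) := by
    unfold outEntBoth
    simp only [Fintype.sum_prod_type_right, sum_negMulLog_mul _ (hc _ _)]
    rw [Finset.sum_congr rfl fun x' _ => (Finset.sum_congr rfl fun w' _ =>
      Finset.mul_sum _ _ _).trans Finset.sum_comm, Finset.sum_comm]
    refine Finset.sum_congr rfl fun t _ => ?_
    rw [hXW t fun x w => Real.negMulLog (p t) + p t * ∑ y, Real.negMulLog (c x w y)]
    simp only [mul_add, Finset.sum_add_distrib, ← Finset.sum_mul, ← Finset.mul_sum, hγ, hα, one_mul,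
      mul_one]
    rw [Finset.mul_sum]
    refine congrArg _ (Finset.sum_congr rfl fun x _ => ?_)
    rw [Finset.mul_sum]
    exact Finset.sum_congr rfl fun _ _ => by ring
  fin_cases i
  · change outEntFst _ _ _ - outEntBoth _ _ _ = ∑ t, p t * (outEntFst _ _ _ - outEntBoth _ _ _)
    rw [e1, e0, ← Finset.sum_sub_distrib]
    exact Finset.sum_congr rfl fun t _ => by ring
  · change outEntSnd _ _ _ - outEntBoth _ _ _ = ∑ t, p t * (outEntSnd _ _ _ - outEntBoth _ _ _)
    rw [e2, e0, ← Finset.sum_sub_distrib]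
    exact Finset.sum_congr rfl fun t _ => by ring
  · change outEntSum _ _ _ - outEntBoth _ _ _ = ∑ t, p t * (outEntSum _ _ _ - outEntBoth _ _ _)
    rw [e12, e0, ← Finset.sum_sub_distrib]
    exact Finset.sum_congr rfl fun t _ => by ring

end Induced

/-! ### Approximating input laws by symbol maps -/

section Approximation

variable {X W Y Z : Type*} [Fintype X] [Fintype W] [Fintype Y] [Fintype Z]

lemma exists_map_card_eq {q : ℕ} [NeZero q] {K : X → ℕ} (hK : ∑ x, K x = q) :
    ∃ f : ZMod q → X, ∀ x, countOf (fun i => f i = x) = K x := by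
  classical
  have hcard : Fintype.card (Σ x, Fin (K x)) = Fintype.card (ZMod q) := by
    simp [Fintype.card_sigma, hK, ZMod.card]
  let e : (Σ x, Fin (K x)) ≃ ZMod q := Fintype.equivOfCardEq hcard
  refine ⟨fun i => (e.symm i).1, fun x => ?_⟩
  rw [← card_filter_eq_countOf, ← Fintype.card_subtype,
    Fintype.card_congr ((e.symm.subtypeEquiv fun i => Iff.rfl).trans (Equiv.sigmaSubtype x)),
    Fintype.card_fin]

/-- Rounding `q p(x)` down, with the excess given to one symbol, approximates `p` by the image of
the uniform law on `𝔽_q` under a map. -/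
lemma exists_countingLaw_approx (q : ℕ) [NeZero q] (p : PMF X) :
    ∃ f : ZMod q → X, ∀ x, |countingLaw f x - (p x).toReal| ≤ Fintype.card X / q := by
  classical
  obtain ⟨x₀, -⟩ := p.support_nonempty
  have hq : (0 : ℝ) < q := by exact_mod_cast NeZero.pos q
  set v : X → ℝ := fun x => q * (p x).toReal with hv
  have hv0 : ∀ x, 0 ≤ v x := fun x => mul_nonneg hq.le ENNReal.toReal_nonneg
  have hvs : ∑ x, v x = q := by rw [← Finset.mul_sum, sum_toReal_eq_one, mul_one]
  have hle : ∑ x, ⌊v x⌋₊ ≤ q := by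
    have : ((∑ x, ⌊v x⌋₊ : ℕ) : ℝ) ≤ q := by
      rw [Nat.cast_sum, ← hvs]
      exact Finset.sum_le_sum fun x _ => Nat.floor_le (hv0 x)
    exact_mod_cast this
  obtain ⟨r, hr⟩ := Nat.exists_eq_add_of_le hle
  have hrle : (r : ℝ) ≤ Fintype.card X := by
    have h1 : (r : ℝ) = ∑ x, (v x - ⌊v x⌋₊) := by
      rw [Finset.sum_sub_distrib, hvs, ← Nat.cast_sum]
      nth_rewrite 1 [hr]
      push_cast
      ring
    rw [h1]
    refine (Finset.sum_le_sum fun x _ => (show v x - ⌊v x⌋₊ ≤ 1 by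
      linarith [Nat.lt_floor_add_one (v x)])).trans ?_
    simp
  obtain ⟨f, hf⟩ := exists_map_card_eq (X := X) (q := q)
    (K := fun x => ⌊v x⌋₊ + if x = x₀ then r else 0) (by
      rw [Finset.sum_add_distrib, Finset.sum_ite_eq' Finset.univ x₀]
      simpa using hr.symm)
  refine ⟨f, fun x => ?_⟩
  have hc1 : (1 : ℝ) ≤ Fintype.card X := by
    exact_mod_cast Fintype.card_pos_iff.2 ⟨x₀⟩
  have h1 : countingLaw f x - (p x).toReal =
      ((⌊v x⌋₊ : ℝ) + (if x = x₀ then (r : ℝ) else 0) - v x) / q := by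
    rw [countingLaw, hf]
    push_cast
    rw [hv]
    field_simp
  rw [h1, abs_div, abs_of_pos hq]
  refine div_le_div_of_nonneg_right (abs_le.2 ?_) hq.le
  have h2 := Nat.floor_le (hv0 x)
  have h3 := Nat.lt_floor_add_one (v x)
  have hr0 : (0 : ℝ) ≤ r := Nat.cast_nonneg r
  split_ifs <;> constructor <;> linarith

lemma continuous_chanBounds {m : ℕ} (p : Fin m → ℝ) (c : X → W → Y → ℝ) (i : Fin 3) :
    Continuous fun l : (Fin m → X → ℝ) × (Fin m → W → ℝ) =>
      (∑ t, p t * chanBounds c (l.1 t) (l.2 t) i) / Real.log 2 := by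
  fin_cases i <;> simp only [chanBounds, outEntFst, outEntSnd, outEntSum, outEntBoth] <;>
    simp only [Fin.isValue, Fin.mk_one, Fin.reduceFinMk, Fin.zero_eta, Matrix.cons_val,
      Matrix.cons_val_zero, Matrix.cons_val_one] <;> fun_prop

/-- Symbol maps on a large enough prime field reproduce the pentagon of any input law. -/
lemma exists_induced_approx (PY : X → W → PMF Y) (PZ : X → W → PMF Z) {m : ℕ} (pQ : PMF (Fin m))
    (pX : Fin m → PMF X) (pW : Fin m → PMF W) {η : ℝ} (hη : 0 < η) :
    ∃ (q : ℕ) (_ : Fact q.Prime) (fx : ZMod q → Fin m → X) (fw : ZMod q → Fin m → W),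
      (∀ i, |uniformBounds (inducedMAC pQ fx fw PY) i - rateBounds pQ pX pW PY i| ≤ η) ∧
      ∀ i, |uniformBounds (inducedMAC pQ fx fw PZ) i - rateBounds pQ pX pW PZ i| ≤ η := by
  set l₀ : (Fin m → X → ℝ) × (Fin m → W → ℝ) :=
    (fun t x => (pX t x).toReal, fun t w => (pW t w).toReal) with hl₀
  have hcY := fun i => (continuous_chanBounds (fun t => (pQ t).toReal)
    (fun x w y => (PY x w y).toReal) i).continuousAt (x := l₀)
  have hcZ := fun i => (continuous_chanBounds (fun t => (pQ t).toReal)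
    (fun x w y => (PZ x w y).toReal) i).continuousAt (x := l₀)
  have hev := (Filter.eventually_all.2 fun i => Metric.tendsto_nhds.1 (hcY i) η hη).and
    (Filter.eventually_all.2 fun i => Metric.tendsto_nhds.1 (hcZ i) η hη)
  -- the bounds are continuous in the input laws, and counting laws come arbitrarily close to these
  obtain ⟨ζ, hζ, hball⟩ := Metric.eventually_nhds_iff.1 hev
  have htend : Filter.Tendsto (fun q : ℕ => ((Fintype.card X + Fintype.card W : ℕ) : ℝ) / q)
      Filter.atTop (nhds 0) := tendsto_const_div_atTop_nhds_zero_nat _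
  obtain ⟨q₀, hq₀⟩ := Filter.eventually_atTop.1 (htend.eventually_lt_const hζ)
  obtain ⟨q, hqle, hqp⟩ := Nat.exists_infinite_primes q₀
  have : Fact q.Prime := ⟨hqp⟩
  have hq : (0 : ℝ) < q := by exact_mod_cast NeZero.pos q
  choose gx hgx using fun t => exists_countingLaw_approx q (pX t)
  choose gw hgw using fun t => exists_countingLaw_approx q (pW t)
  have hlt := hq₀ q hqle
  have hdist : dist ((fun t => countingLaw fun x' => gx t x', fun t => countingLaw fun w' => gw t w')
      : (Fin m → X → ℝ) × (Fin m → W → ℝ)) l₀ < ζ := by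
    rw [Prod.dist_eq, max_lt_iff]
    refine ⟨(dist_pi_lt_iff hζ).2 fun t => (dist_pi_lt_iff hζ).2 fun x => ?_,
      (dist_pi_lt_iff hζ).2 fun t => (dist_pi_lt_iff hζ).2 fun w => ?_⟩
    · refine ((hgx t x).trans ?_).trans_lt hlt
      gcongr
      omega
    · refine ((hgw t w).trans ?_).trans_lt hlt
      gcongr
      omega
  obtain ⟨h1, h2⟩ := hball hdist
  refine ⟨q, this, fun x' t => gx t x', fun w' t => gw t w', fun i => ?_, fun i => ?_⟩
  · rw [uniformBounds_inducedMAC, rateBounds_eq, ← Real.dist_eq]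
    exact (h1 i).le
  · rw [uniformBounds_inducedMAC, rateBounds_eq, ← Real.dist_eq]
    exact (h2 i).le

/-- The pentagon of independent uniform inputs has a dominant face: the sum rate bound is at most the
sum of the two other bounds. -/
lemma uniformBounds_two_le {q : ℕ} [NeZero q] (P : ZMod q → ZMod q → PMF Y) :
    uniformBounds P 2 ≤ uniformBounds P 0 + uniformBounds P 1 := by
  rw [uniformBounds_zero, uniformBounds_one, uniformBounds_two, ← add_div]
  refine div_le_div_of_nonneg_right ?_ (Real.log_pos (by norm_num)).le
  linarith [entFst_add_entSnd_le (P := P)]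

/-- Inherited from uniform inputs by approximation with induced channels. -/
lemma rateBounds_two_le (P : X → W → PMF Y) {m : ℕ} (pQ : PMF (Fin m))
    (pX : Fin m → PMF X) (pW : Fin m → PMF W) :
    rateBounds pQ pX pW P 2 ≤ rateBounds pQ pX pW P 0 + rateBounds pQ pX pW P 1 := by
  refine le_of_forall_pos_le_add fun ε hε => ?_
  -- three approximate bounds enter the inequality
  obtain ⟨q, hq, fx, fw, h, -⟩ := exists_induced_approx P P pQ pX pW (div_pos hε three_pos)
  have h0 := abs_le.1 (h 0)
  have h1 := abs_le.1 (h 1)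
  have h2 := abs_le.1 (h 2)
  have := uniformBounds_two_le (inducedMAC pQ fx fw P)
  linarith [h0.1, h0.2, h1.1, h1.2, h2.1, h2.2]

end Approximation

/-! ### Schemes for a point of the rate region -/

section Dominant

/-- The point of the dominant face of the pentagon `a` with first coordinate closest to `x`. -/
def facePoint (a : Fin 3 → ℝ) (x : ℝ) : Fin 2 → ℝ :=
  ![min (max x (a 2 - a 1)) (a 0), a 2 - min (max x (a 2 - a 1)) (a 0)]

variable {a b : Fin 3 → ℝ} {I : Fin 2 → ℝ}

lemma facePoint_zero_le (x : ℝ) : facePoint a x 0 ≤ a 0 := min_le_right _ _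

lemma le_facePoint_zero (ha : a 2 ≤ a 0 + a 1) (x : ℝ) : a 2 - a 1 ≤ facePoint a x 0 :=
  le_min (le_max_right _ _) (by linarith)

lemma facePoint_zero_add_one (x : ℝ) : facePoint a x 0 + facePoint a x 1 = a 2 :=
  add_sub_cancel _ _

/-- The dominant face contains a point above each point of the pentagon. -/
lemma le_facePoint (hI : I ∈ pentagon a) (j : Fin 2) :
    I j ≤ facePoint a (I 0) j := by
  obtain ⟨-, -, h0, h1, h2⟩ := hI
  have h3 : facePoint a (I 0) 0 ≤ max (I 0) (a 2 - a 1) := min_le_left _ _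
  have h4 := facePoint_zero_add_one (a := a) (I 0)
  fin_cases j
  · exact le_min (le_max_left _ _) h0
  · change I 1 ≤ facePoint a (I 0) 1
    have : max (I 0) (a 2 - a 1) ≤ a 2 - I 1 := max_le (by linarith) (by linarith)
    linarith

lemma abs_facePoint_sub_le {η : ℝ} (h : ∀ i, |b i - a i| ≤ η) (x : ℝ) (j : Fin 2) :
    |facePoint b x j - facePoint a x j| ≤ 3 * η := by
  have h0 := abs_le.1 (h 0)
  have h1 := abs_le.1 (h 1)
  have h2 := abs_le.1 (h 2)
  have hη : 0 ≤ η := (abs_nonneg _).trans (h 0)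
  have key : |facePoint b x 0 - facePoint a x 0| ≤ 2 * η := by
    refine (abs_min_sub_min_le_max _ _ _ _).trans (max_le ?_ (by linarith [h 0]))
    refine (abs_max_sub_max_le_max _ _ _ _).trans (max_le (by simpa using hη) ?_)
    rw [abs_le]
    constructor <;> linarith [h1.1, h1.2, h2.1, h2.2]
  fin_cases j
  · exact key.trans (by linarith)
  · have e1 := facePoint_zero_add_one (a := a) x
    have e2 := facePoint_zero_add_one (a := b) x
    have := abs_le.1 key
    change |facePoint b x 1 - facePoint a x 1| ≤ 3 * η
    rw [abs_le]
    constructor <;> linarith [h2.1, h2.2, this.1, this.2]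

/-- The componentwise minimum of the two points on the dominant faces lies in both pentagons, so it
cannot exceed a maximal point. -/
lemma min_facePoint_eq_of_maximal (ha : a 2 ≤ a 0 + a 1) (hb : b 2 ≤ b 0 + b 1)
    (hI : Maximal (· ∈ pentagon a ∩ pentagon b) I) (j : Fin 2) :
    min (facePoint a (I 0) j) (facePoint b (I 0) j) = I j := by
  have hIa := hI.prop.1
  have hIb := hI.prop.2
  have hle : I ≤ fun j => min (facePoint a (I 0) j) (facePoint b (I 0) j) :=
    fun j => le_min (le_facePoint hIa j) (le_facePoint hIb j)
  have hmem : ∀ {c : Fin 3 → ℝ} {J : Fin 2 → ℝ}, c 2 ≤ c 0 + c 1 →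
      (∀ j, J j ≤ facePoint c (I 0) j) → I ≤ J → J ∈ pentagon c := by
    intro c J hc hJ hIJ
    have e := facePoint_zero_add_one (a := c) (I 0)
    have e' := le_facePoint_zero hc (I 0)
    exact ⟨hIa.1.trans (hIJ 0), hIa.2.1.trans (hIJ 1), (hJ 0).trans (facePoint_zero_le _),
      by linarith [hJ 1], by linarith [hJ 0, hJ 1]⟩
  have := hI.eq_of_le (y := fun j => min (facePoint a (I 0) j) (facePoint b (I 0) j))
    ⟨hmem ha (fun j => min_le_left _ _) hle, hmem hb (fun j => min_le_right _ _) hle⟩ hle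
  exact (congrFun this j).symm

variable {q : ℕ} {Y Z : Type*} [Fintype Y] [Fintype Z]

lemma Scheme.IsBijective.rate_eq_senderEnt [NeZero q] {n k : ℕ} {s : Scheme q n k}
    (hs : s.IsBijective) (P : ZMod q → ZMod q → PMF Y) (S : Perm n k) (j : Fin 2) :
    s.rate P S j = (Real.log q - s.senderEnt P S j / (2 ^ k * 2 ^ n)) / Real.log 2 := by
  rw [Scheme.rate_eq hs, Finset.sum_sub_distrib, Finset.sum_const, Finset.card_univ, card_idx,
    nsmul_eq_mul, sub_div]
  have : (2 : ℝ) ^ k * 2 ^ n ≠ 0 := by positivity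
  push_cast
  rw [mul_div_cancel_left₀ _ this]
  rfl

/-- The point on the dominant face in terms of the conditional entropy of the first sender, which
ranges between decoding the first sender last and decoding it first. -/
lemma facePoint_mem_range [NeZero q] (P : ZMod q → ZMod q → PMF Y) (x : ℝ) :
    entFst P ≤ Real.log q - facePoint (uniformBounds P) x 0 * Real.log 2 ∧
    Real.log q - facePoint (uniformBounds P) x 0 * Real.log 2 ≤ entSum P - entSnd P := by
  have hl2 : 0 < Real.log 2 := Real.log_pos (by norm_num)
  have h1 := mul_le_mul_of_nonneg_right (facePoint_zero_le (a := uniformBounds P) x) hl2.le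
  have h2 := mul_le_mul_of_nonneg_right (le_facePoint_zero (uniformBounds_two_le P) x) hl2.le
  rw [uniformBounds_zero, div_mul_cancel₀ _ hl2.ne'] at h1
  rw [uniformBounds_two, uniformBounds_one, ← sub_div, div_mul_cancel₀ _ hl2.ne'] at h2
  constructor <;> linarith

lemma facePoint_target [NeZero q] (P : ZMod q → ZMod q → PMF Y) (x : ℝ) (j : Fin 2) :
    (![Real.log q - facePoint (uniformBounds P) x 0 * Real.log 2,
      entSum P - (Real.log q - facePoint (uniformBounds P) x 0 * Real.log 2)] : Fin 2 → ℝ) j =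
    Real.log q - facePoint (uniformBounds P) x j * Real.log 2 := by
  have hl2 : 0 < Real.log 2 := Real.log_pos (by norm_num)
  have h1 : facePoint (uniformBounds P) x 1 = uniformBounds P 2 - facePoint (uniformBounds P) x 0 :=
    rfl
  fin_cases j
  · rfl
  · change entSum P - (Real.log q - facePoint (uniformBounds P) x 0 * Real.log 2) =
      Real.log q - facePoint (uniformBounds P) x 1 * Real.log 2
    rw [h1, uniformBounds_two, sub_mul, div_mul_cancel₀ _ hl2.ne']
    ring

lemma Scheme.IsBijective.abs_rate_sub_lt [NeZero q] {n k : ℕ} {s : Scheme q n k}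
    (hs : s.IsBijective) (P : ZMod q → ZMod q → PMF Y) (S : Perm n k) (j : Fin 2) {J ε : ℝ}
    (h : |s.senderEnt P S j / (2 ^ k * 2 ^ n) - (Real.log q - J * Real.log 2)| <
      ε * Real.log 2) : |s.rate P S j - J| < ε := by
  have hl2 : 0 < Real.log 2 := Real.log_pos (by norm_num)
  have e : s.rate P S j - J = -((s.senderEnt P S j / (2 ^ k * 2 ^ n) -
      (Real.log q - J * Real.log 2)) / Real.log 2) := by
    rw [hs.rate_eq_senderEnt]
    field_simp
    ring
  rwa [e, abs_neg, abs_div, abs_of_pos hl2, div_lt_iff₀ hl2]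

/-- If the pentagons of two channels are close to `aY` and `aZ`, every point of the intersection of
`aY` and `aZ` is served by aligned schemes, of a fixed depth `k` and all large block lengths. Each
receiver is given the split that corresponds to a point of the dominant face of its pentagon above
the required one. -/
theorem exists_scheme_of_close [Fact q.Prime] (PY : ZMod q → ZMod q → PMF Y)
    (PZ : ZMod q → ZMod q → PMF Z) {aY aZ : Fin 3 → ℝ} (haY : aY 2 ≤ aY 0 + aY 1)
    (haZ : aZ 2 ≤ aZ 0 + aZ 1) (hI : I ∈ pentagon aY ∩ pentagon aZ) {η ε β : ℝ}
    (hY : ∀ i, |uniformBounds PY i - aY i| ≤ η) (hZ : ∀ i, |uniformBounds PZ i - aZ i| ≤ η)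
    (hε : 0 < ε) (hη : 6 * η ≤ ε) (hβ0 : 0 < β) (hβ : β < 1 / 2) :
    ∃ k n₁ : ℕ, ∀ n ≥ n₁, ∃ s : Scheme q n k,
      IsAligned PY PZ β n s ∧ IsMonotone s.S ∧ IsMonotone s.T ∧ ∀ j : Fin 2,
        I j - ε < min (s.rate PY s.S j) (s.rate PZ s.T j) ∧
        (Maximal (· ∈ pentagon aY ∩ pentagon aZ) I →
          |min (s.rate PY s.S j) (s.rate PZ s.T j) - I j| < ε) ∧
        min (s.rate PY s.S j) (s.rate PZ s.T j) - ε <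
          ((s.commonGood β PY PZ j).card : ℝ) / (2 ^ k * 2 ^ n) * Real.logb 2 q := by
  have hl2 : 0 < Real.log 2 := Real.log_pos (by norm_num)
  set JY := facePoint (uniformBounds PY) (I 0) with hJY
  set JZ := facePoint (uniformBounds PZ) (I 0) with hJZ
  have hε' : 0 < ε / 4 * Real.log 2 := by positivity
  obtain ⟨k, n₁, h⟩ := exists_aligned_scheme PY PZ (facePoint_mem_range PY (I 0)).1
    (facePoint_mem_range PY (I 0)).2 (facePoint_mem_range PZ (I 0)).1
    (facePoint_mem_range PZ (I 0)).2 hβ0 hβ hε'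
  refine ⟨k, n₁, fun n hn => ?_⟩
  obtain ⟨s, hs, hmS, hmT, hj⟩ := h n hn
  refine ⟨s, hs, hmS, hmT, fun j => ?_⟩
  obtain ⟨h1, h2, h3⟩ := hj j
  rw [facePoint_target] at h1 h2
  have hrY := hs.isBijective.abs_rate_sub_lt PY s.S j h1
  have hrZ := hs.isBijective.abs_rate_sub_lt PZ s.T j h2
  have hmin : |min (s.rate PY s.S j) (s.rate PZ s.T j) -
      min (facePoint aY (I 0) j) (facePoint aZ (I 0) j)| < ε := by
    refine (abs_min_sub_min_le_max _ _ _ _).trans_lt (max_lt ?_ ?_)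
    · have := abs_sub_le (s.rate PY s.S j) (JY j) (facePoint aY (I 0) j)
      linarith [abs_facePoint_sub_le hY (I 0) j]
    · have := abs_sub_le (s.rate PZ s.T j) (JZ j) (facePoint aZ (I 0) j)
      linarith [abs_facePoint_sub_le hZ (I 0) j]
  refine ⟨?_, fun hmax => ?_, ?_⟩
  · have := le_min (le_facePoint hI.1 j) (le_facePoint hI.2 j)
    linarith [(abs_lt.1 hmin).1]
  · rwa [← min_facePoint_eq_of_maximal haY haZ hmax j]
  · rw [hs.isBijective.rate_eq_senderEnt, hs.isBijective.rate_eq_senderEnt,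
      min_div_div_right hl2.le, Real.logb, ← mul_div_assoc, sub_lt_iff_lt_add, div_lt_iff₀ hl2,
      add_mul, div_mul_cancel₀ _ hl2.ne']
    nlinarith [h3, mul_pos hε hl2]

lemma commonGood_anti [NeZero q] {n k : ℕ} {s : Scheme q n k} (hs : s.IsBijective) {β β' : ℝ}
    (h : β ≤ β') (PY : ZMod q → ZMod q → PMF Y) (PZ : ZMod q → ZMod q → PMF Z) (j : Fin 2) :
    s.commonGood β' PY PZ j ⊆ s.commonGood β PY PZ j := by
  intro i hi
  simp only [Scheme.commonGood, Finset.mem_filter, Finset.mem_univ, true_and] at hi ⊢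
  exact ⟨hs.good_mono h hi.1, hs.good_mono h hi.2⟩

/-- `exists_scheme_of_close` for all `β < 1 / 2`, where `β ≤ 0` is allowed as well. -/
theorem hasAlignedScheme_of_close [Fact q.Prime] (PY : ZMod q → ZMod q → PMF Y)
    (PZ : ZMod q → ZMod q → PMF Z) {aY aZ : Fin 3 → ℝ} (haY : aY 2 ≤ aY 0 + aY 1)
    (haZ : aZ 2 ≤ aZ 0 + aZ 1) (hI : I ∈ pentagon aY ∩ pentagon aZ) {η ε β : ℝ}
    (hY : ∀ i, |uniformBounds PY i - aY i| ≤ η) (hZ : ∀ i, |uniformBounds PZ i - aZ i| ≤ η)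
    (hε : 0 < ε) (hη : 6 * η ≤ ε) (hβ : β < 1 / 2) (n₀ : ℕ) :
    HasAlignedScheme PY PZ (pentagon aY ∩ pentagon aZ) I ε β n₀ := by
  -- goodness and badness for a larger `β` are stronger, so `β` may be taken positive
  have hβ' : max β (1 / 4) < 1 / 2 := max_lt hβ (by norm_num)
  obtain ⟨k, n₁, h⟩ := exists_scheme_of_close PY PZ haY haZ hI hY hZ hε hη
    (lt_of_lt_of_le (by norm_num) (le_max_right β (1 / 4))) hβ'
  obtain ⟨s, hs, hmS, hmT, hj⟩ := h (max n₀ n₁) (le_max_right _ _)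
  refine ⟨_, k, s, le_max_left _ _, hs.mono (le_max_left _ _), hmS, hmT, fun j => ?_⟩
  obtain ⟨h1, h2, h3⟩ := hj j
  refine ⟨h1, h2, h3.trans_le ?_⟩
  have hq : 0 ≤ Real.logb 2 q :=
    Real.logb_nonneg (by norm_num) (by exact_mod_cast (Fact.out : q.Prime).one_le)
  gcongr
  exact commonGood_anti hs.isBijective (le_max_left _ _) PY PZ j

end Dominant

/-! ### Successive cancellation decoding -/

section Decoding

/-- Words can be defined symbol by symbol along a decoding order. -/
lemma exists_recursive_word {V F : Type*} {N : ℕ} (pos : V → Fin N)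
    (pick : ∀ v, ({w // pos w < pos v} → F) → F) :
    ∃ d : V → F, ∀ v, d v = pick v fun w => d w := by
  have wf : WellFounded fun v w : V => pos v < pos w := InvImage.wf pos wellFounded_lt
  exact ⟨wf.fix fun v d => pick v fun w => d w w.2, fun v => wf.fix_eq _ v⟩

open Classical in
lemma toOuterMeasure_eq_ofReal {Ω : Type*} [Fintype Ω] (μ : PMF Ω) (E : Set Ω) :
    μ.toOuterMeasure E = ENNReal.ofReal (∑ ω, if ω ∈ E then (μ ω).toReal else 0) := by
  rw [PMF.toOuterMeasure_apply_fintype, ENNReal.ofReal_sum_of_nonneg]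
  · refine Finset.sum_congr rfl fun ω _ => ?_
    by_cases h : ω ∈ E
    · rw [Set.indicator_of_mem h, if_pos h, ENNReal.ofReal_toReal (μ.apply_ne_top ω)]
    · rw [Set.indicator_of_notMem h, if_neg h, ENNReal.ofReal_zero]
  · intro ω _
    split_ifs <;> simp

variable {q : ℕ} [NeZero q]

open Classical in
/-- The error probability of guessing a symbol from the side information by maximum likelihood is
at most the conditional entropy, in nats. -/
lemma sum_guess_error_le {Ω B : Type*} [Fintype Ω] [Fintype B] {μ : Ω → ℝ} (hμ : ∀ ω, 0 ≤ μ ω)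
    (X : Ω → ZMod q) (Y : Ω → B) {a : B → ZMod q} (ha : ∀ b x, fam μ X Y b x ≤ fam μ X Y b (a b)) :
    ∑ ω, (if a (Y ω) ≠ X ω then μ ω else 0) ≤ famEnt (fam μ X Y) := by
  have h1 : ∑ b, fam μ X Y b (a b) = ∑ ω, if X ω = a (Y ω) then μ ω else 0 := by
    unfold fam
    rw [Finset.sum_comm]
    refine Finset.sum_congr rfl fun ω _ => ?_
    rw [Finset.sum_eq_single (Y ω) (fun b _ hb => if_neg fun h => hb h.2.symm) (by simp)]
    simp
  have h2 : ∑ ω, (if a (Y ω) ≠ X ω then μ ω else 0) =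
      ∑ b, (tot (fam μ X Y b) - fam μ X Y b (a b)) := by
    rw [Finset.sum_sub_distrib, sum_tot_fam, h1, ← Finset.sum_sub_distrib]
    refine Finset.sum_congr rfl fun ω _ => ?_
    by_cases h : a (Y ω) = X ω
    · simp [h]
    · simp [h, Ne.symm h]
  rw [h2]
  exact Finset.sum_le_sum fun b _ => tot_sub_le_cent (fam_nonneg hμ X Y b) (ha b)

variable {n k : ℕ} {Y : Type*} [Fintype Y] (s : Scheme q n k) (P : ZMod q → ZMod q → PMF Y)
  (S : Perm n k) (A : Fin 2 → Finset (Idx n k))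

/-- A most likely value of the symbol `v`, given the output and the preceding symbols. -/
def Scheme.mapSymbol (v : Var n k) (b : (Idx n k → Y) × ({w // S w < S v} → ZMod q)) : ZMod q :=
  (Finite.exists_max
    (symFam (chanWt P (Idx n k)) (fun v ω => s.symbol v ω.1) (fun ω => ω.2) S v b)).choose

lemma Scheme.le_mapSymbol (v : Var n k) (b : (Idx n k → Y) × ({w // S w < S v} → ZMod q))
    (a : ZMod q) :
    symFam (chanWt P (Idx n k)) (fun v ω => s.symbol v ω.1) (fun ω => ω.2) S v b a ≤
      symFam (chanWt P (Idx n k)) (fun v ω => s.symbol v ω.1) (fun ω => ω.2) S v b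
        (s.mapSymbol P S v b) :=
  (Finite.exists_max
    (symFam (chanWt P (Idx n k)) (fun v ω => s.symbol v ω.1) (fun ω => ω.2) S v b)).choose_spec a

open Classical in
/-- The successive cancellation decoder with information sets `A` and frozen values `f`. -/
def Scheme.scDecoder (f : Var n k → ZMod q) (y : Idx n k → Y) : Var n k → ZMod q :=
  (exists_recursive_word S fun v past =>
    if v.2 ∈ A v.1 then s.mapSymbol P S v (y, past) else f v).choose

lemma Scheme.scDecoder_frozen (f : Var n k → ZMod q) (y : Idx n k → Y) {v : Var n k}
    (hv : v.2 ∉ A v.1) : s.scDecoder P S A f y v = f v := by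
  classical
  rw [Scheme.scDecoder, (exists_recursive_word S fun v past =>
    if v.2 ∈ A v.1 then s.mapSymbol P S v (y, past) else f v).choose_spec v, if_neg hv]

lemma Scheme.scDecoder_info (f : Var n k → ZMod q) (y : Idx n k → Y) {v : Var n k}
    (hv : v.2 ∈ A v.1) : s.scDecoder P S A f y v =
      s.mapSymbol P S v (y, fun w => s.scDecoder P S A f y w) := by
  classical
  have h := (exists_recursive_word S fun v past =>
    if v.2 ∈ A v.1 then s.mapSymbol P S v (y, past) else f v).choose_spec v
  rw [if_pos hv] at h
  exact h

lemma isSCDecoder_scDecoder (f : Var n k → ZMod q) :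
    IsSCDecoder s P S A f (s.scDecoder P S A f) := by
  classical
  refine fun y v => ⟨fun hv => s.scDecoder_frozen P S A f y hv, fun hv a => ?_⟩
  have key : ∀ a : ZMod q, (blockLaw n k P).toOuterMeasure
      {ω | ω.2 = y ∧ (∀ w, S w < S v → s.symbol w ω.1 = s.scDecoder P S A f y w) ∧
        s.symbol v ω.1 = a} = ENNReal.ofReal (symFam (chanWt P (Idx n k))
          (fun v ω => s.symbol v ω.1) (fun ω => ω.2) S v
          (y, fun w => s.scDecoder P S A f y w) a) := by
    intro a
    rw [toOuterMeasure_eq_ofReal]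
    congr 1
    unfold symFam fam
    refine Finset.sum_congr rfl fun ω _ => ?_
    rw [toReal_blockLaw]
    have hiff : ω ∈ {ω : (Fin 2 → Idx n k → ZMod q) × (Idx n k → Y) | ω.2 = y ∧
        (∀ w, S w < S v → s.symbol w ω.1 = s.scDecoder P S A f y w) ∧ s.symbol v ω.1 = a} ↔
        s.symbol v ω.1 = a ∧ pastInfo (fun v ω => s.symbol v ω.1) (fun ω => ω.2) S v ω =
          (y, fun w : {w // S w < S v} => s.scDecoder P S A f y w) := by
      simp only [pastInfo, Set.mem_ofPred_eq, Prod.mk.injEq, funext_iff, Subtype.forall]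
      tauto
    by_cases h : s.symbol v ω.1 = a ∧ pastInfo (fun v ω => s.symbol v ω.1) (fun ω => ω.2) S v ω =
        (y, fun w : {w // S w < S v} => s.scDecoder P S A f y w)
    · rw [if_pos h, if_pos (hiff.2 h)]
    · rw [if_neg h, if_neg fun h' => h (hiff.1 h')]
  rw [key, key, s.scDecoder_info P S A f y hv]
  exact ENNReal.ofReal_le_ofReal (s.le_mapSymbol P S v _ a)

/-- Only the frozen symbols of `f` matter. -/
lemma Scheme.scDecoder_congr {f f' : Var n k → ZMod q} (h : ∀ v, v.2 ∉ A v.1 → f v = f' v)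
    (y : Idx n k → Y) : s.scDecoder P S A f y = s.scDecoder P S A f' y := by
  funext v
  induction v using (InvImage.wf S wellFounded_lt).induction with
  | _ v ih =>
    by_cases hv : v.2 ∈ A v.1
    · rw [s.scDecoder_info P S A f y hv, s.scDecoder_info P S A f' y hv,
        show (fun w : {w // S w < S v} => s.scDecoder P S A f y w) =
          fun w : {w // S w < S v} => s.scDecoder P S A f' y w from
          funext fun w : {w // S w < S v} => ih w w.2]
    · rw [s.scDecoder_frozen P S A f y hv, s.scDecoder_frozen P S A f' y hv, h v hv]

/-- The decoder makes no error if every information symbol is the most likely one given the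
correct preceding symbols. -/
lemma Scheme.scDecoder_eq {g : Var n k → ZMod q} {y : Idx n k → Y}
    (h : ∀ v, v.2 ∈ A v.1 → s.mapSymbol P S v (y, fun w => g w) = g v) :
    s.scDecoder P S A g y = g := by
  funext v
  induction v using (InvImage.wf S wellFounded_lt).induction with
  | _ v ih =>
    by_cases hv : v.2 ∈ A v.1
    · rw [s.scDecoder_info P S A g y hv, show (fun w : {w // S w < S v} =>
        s.scDecoder P S A g y w) = fun w : {w // S w < S v} => g w from
        funext fun w : {w // S w < S v} => ih w w.2, h v hv]
    · exact s.scDecoder_frozen P S A g y hv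

open Classical in
/-- The information symbols, as symbols of either sender. -/
def infoSymbols : Finset (Var n k) := Finset.univ.filter fun v => v.2 ∈ A v.1

open Classical in
/-- Union bound: with uniform frozen values, the error probability of successive cancellation
decoding is at most the sum of the conditional entropies of the information symbols. -/
lemma sum_scDecoder_error_le :
    ∑ ω, (if ∃ v, v.2 ∈ A v.1 ∧ s.scDecoder P S A (fun v => s.symbol v ω.1) ω.2 v ≠
      s.symbol v ω.1 then chanWt P (Idx n k) ω else 0) ≤
      ∑ v ∈ infoSymbols A, s.symbolEnt P S v := by
  have h : ∀ v, ∑ ω, (if s.mapSymbol P S v (pastInfo (fun v ω => s.symbol v ω.1)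
      (fun ω => ω.2) S v ω) ≠ s.symbol v ω.1 then chanWt P (Idx n k) ω else 0) ≤
      s.symbolEnt P S v := fun v =>
    sum_guess_error_le (chanWt_nonneg P _) (fun ω => s.symbol v ω.1) _ (s.le_mapSymbol P S v)
  refine le_trans ?_ (Finset.sum_le_sum fun v _ => h v)
  rw [Finset.sum_comm]
  refine Finset.sum_le_sum fun ω _ => ?_
  have h0 : ∀ v ∈ infoSymbols A, 0 ≤ if s.mapSymbol P S v (pastInfo (fun v ω => s.symbol v ω.1)
      (fun ω => ω.2) S v ω) ≠ s.symbol v ω.1 then chanWt P (Idx n k) ω else 0 := fun v _ => by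
    split_ifs
    exacts [chanWt_nonneg P _ ω, le_rfl]
  split_ifs with hE
  · by_cases hex : ∀ v, v.2 ∈ A v.1 → s.mapSymbol P S v (ω.2, fun w => s.symbol w ω.1) =
      s.symbol v ω.1
    · obtain ⟨v, hv, hne⟩ := hE
      exact absurd (congrFun (s.scDecoder_eq P S A hex) v) hne
    · push Not at hex
      obtain ⟨v, hv, hne⟩ := hex
      refine le_trans (le_of_eq ?_) (Finset.single_le_sum h0
        (show v ∈ infoSymbols A by simpa [infoSymbols] using hv))
      exact (if_pos hne).symm
  · exact Finset.sum_nonneg h0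

end Decoding

/-! ### Averaging over the frozen values and the time-sharing sequence -/

section Averaging

lemma exists_le_of_sum_mul_le {ι : Type*} [Fintype ι] {w e : ι → ℝ} {δ : ℝ} (hw : ∀ i, 0 ≤ w i)
    (h1 : ∑ i, w i = 1) (h : ∑ i, w i * e i ≤ δ) : ∃ i, e i ≤ δ := by
  by_contra! hlt
  have h2 : ∑ i, w i * (e i - δ) ≤ 0 := by
    simp only [mul_sub, Finset.sum_sub_distrib, ← Finset.sum_mul, h1, one_mul]
    linarith
  have h3 : ∀ i ∈ Finset.univ, w i * (e i - δ) = 0 :=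
    (Finset.sum_eq_zero_iff_of_nonneg fun i _ => mul_nonneg (hw i) (sub_pos.2 (hlt i)).le).1
      (le_antisymm h2 (Finset.sum_nonneg fun i _ => mul_nonneg (hw i) (sub_pos.2 (hlt i)).le))
  have h4 : ∑ i, w i = 0 := Finset.sum_eq_zero fun i hi =>
    (mul_eq_zero.1 (h3 i hi)).resolve_right (sub_pos.2 (hlt i)).ne'
  linarith

lemma toReal_bind_map {D B : Type*} [Fintype D] [Fintype B] (p : PMF D) (κ : D → PMF B) (d : D)
    (b : B) : ((p.bind fun d => (κ d).map fun b => (d, b)) (d, b)).toReal =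
      (p d).toReal * (κ d b).toReal := by
  classical
  have h : (p.bind fun d => (κ d).map fun b => (d, b)) (d, b) = p d * κ d b := by
    simp only [PMF.bind_apply, PMF.map_apply, tsum_fintype, Prod.mk.injEq, ite_and,
      Finset.sum_ite_irrel, Finset.sum_const_zero, Finset.sum_ite_eq, Finset.mem_univ, if_true,
      mul_ite, mul_zero]
  rw [h, ENNReal.toReal_mul]

variable {q n k : ℕ} (A : Fin 2 → Finset (Idx n k))

/-- The transformed symbols that carry the message `d` and the frozen values `f`. -/
def codeword (f : Var n k → ZMod q) (d : (j : Fin 2) → A j → ZMod q) (v : Var n k) : ZMod q :=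
  if h : v.2 ∈ A v.1 then d v.1 ⟨v.2, h⟩ else f v

lemma codeword_frozen (f : Var n k → ZMod q) (d : (j : Fin 2) → A j → ZMod q) {v : Var n k}
    (h : v.2 ∉ A v.1) : codeword A f d v = f v := dif_neg h

lemma codeword_info (f : Var n k → ZMod q) (d : (j : Fin 2) → A j → ZMod q) (j : Fin 2)
    (i : A j) : codeword A f d (j, i) = d j i := dif_pos i.2

/-- Pairs of a word and a message are in involution: the word receives the message on the
information symbols, and the values that it had there become the message. -/
def swapMessage : Equiv.Perm ((Var n k → ZMod q) × ((j : Fin 2) → A j → ZMod q)) :=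
  Function.Involutive.toPerm (fun p => (codeword A p.1 p.2, fun j i => p.1 (j, i))) (by
    rintro ⟨f, d⟩
    refine Prod.ext (funext fun v => ?_) (funext fun j => funext fun i => codeword_info A f d j i)
    by_cases h : v.2 ∈ A v.1
    · exact dif_pos h
    · exact (dif_neg h).trans (dif_neg h))

/-- With uniform message and uniform frozen values, the word of transformed symbols is uniform. -/
lemma sum_codeword [NeZero q] (φ : (Var n k → ZMod q) → ℝ) :
    ∑ f, (Fintype.card ((j : Fin 2) → A j → ZMod q) : ℝ)⁻¹ * ∑ d, φ (codeword A f d) =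
      ∑ g, φ g := by
  have hD : (Fintype.card ((j : Fin 2) → A j → ZMod q) : ℝ) ≠ 0 := by
    exact_mod_cast Fintype.card_ne_zero
  have h := Equiv.sum_comp (swapMessage (q := q) A) fun p => φ p.1
  rw [Fintype.sum_prod_type, Fintype.sum_prod_type] at h
  rw [← Finset.mul_sum]
  rw [show ∑ f, ∑ d, φ (codeword A f d) = _ from h]
  simp only [Finset.sum_const, Finset.card_univ, nsmul_eq_mul, ← Finset.mul_sum]
  rw [inv_mul_cancel_left₀ hD]

/-- Input words correspond to words of transformed symbols of both senders. -/
def Scheme.IsBijective.symbolEquiv {s : Scheme q n k} (hs : s.IsBijective) :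
    (Fin 2 → Idx n k → ZMod q) ≃ (Var n k → ZMod q) :=
  hs.equiv.trans (Equiv.curry _ _ _).symm

lemma Scheme.IsBijective.symbol_symbolEquiv_symm {s : Scheme q n k} (hs : s.IsBijective)
    (g : Var n k → ZMod q) (v : Var n k) : s.symbol v (hs.symbolEquiv.symm g) = g v :=
  congrFun (hs.symbolEquiv.apply_symm_apply g) v

/-- The encoder: the inverse of the transform, applied to the message and the frozen values. -/
def Scheme.IsBijective.encoder {s : Scheme q n k} (hs : s.IsBijective) (f : Var n k → ZMod q)
    (j : Fin 2) (d : A j → ZMod q) : Idx n k → ZMod q :=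
  (Equiv.ofBijective _ (hs j)).symm fun i => if h : i ∈ A j then d ⟨i, h⟩ else f (j, i)

lemma Scheme.IsBijective.encoder_eq {s : Scheme q n k} (hs : s.IsBijective)
    (f : Var n k → ZMod q) (d : (j : Fin 2) → A j → ZMod q) (j : Fin 2) :
    hs.encoder A f j (d j) = hs.symbolEquiv.symm (codeword A f d) j := rfl

lemma Scheme.IsBijective.isEncoder {s : Scheme q n k} (hs : s.IsBijective)
    (f : Var n k → ZMod q) : IsEncoder s A f (hs.encoder A f) := by
  intro j d
  have h : s.transform j (hs.encoder A f j d) =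
      fun i => if h : i ∈ A j then d ⟨i, h⟩ else f (j, i) :=
    (Equiv.ofBijective _ (hs j)).apply_symm_apply _
  exact ⟨fun i => by rw [h]; exact dif_pos i.2, fun i hi => by rw [h]; exact dif_neg hi⟩

variable {m : ℕ} {X W Y : Type*} [Fintype X] [Fintype W] [Fintype Y] [NeZero q] (pQ : PMF (Fin m))
  (fx : ZMod q → Fin m → X) (fw : ZMod q → Fin m → W) (P : X → W → PMF Y)
  {s : Scheme q n k} (hs : s.IsBijective) (S : Perm n k)

open Classical in
/-- The probability of a decoding error when the word of transformed symbols is `g` and the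
time-sharing sequence is `τ`. -/
def wordError (τ : Idx n k → Fin m) (g : Var n k → ZMod q) : ℝ :=
  ∑ y : Idx n k → Y, if ∃ v, v.2 ∈ A v.1 ∧
      s.scDecoder (inducedMAC pQ fx fw P) S A g (fun t => (y t, τ t)) v ≠ g v then
    ∏ t, (P (fx (hs.symbolEquiv.symm g 0 t) (τ t)) (fw (hs.symbolEquiv.symm g 1 t) (τ t))
      (y t)).toReal else 0

lemma wordError_nonneg (τ : Idx n k → Fin m) (g : Var n k → ZMod q) :
    0 ≤ wordError A pQ fx fw P hs S τ g := by
  refine Finset.sum_nonneg fun y _ => ?_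
  split_ifs
  exacts [Finset.prod_nonneg fun _ _ => ENNReal.toReal_nonneg, le_rfl]

/-- For fixed frozen values and time-sharing sequence the error probability is the mean over the
messages of the error probability of the corresponding words. -/
lemma errorProb_eq (f : Var n k → ZMod q) (τ : Idx n k → Fin m) :
    errorProb P fx fw τ A (hs.encoder A f) (s.scDecoder (inducedMAC pQ fx fw P) S A f) =
      ENNReal.ofReal ((Fintype.card ((j : Fin 2) → A j → ZMod q) : ℝ)⁻¹ *
        ∑ d, wordError A pQ fx fw P hs S τ (codeword A f d)) := by
  classical
  rw [errorProb, toOuterMeasure_eq_ofReal, Fintype.sum_prod_type, Finset.mul_sum]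
  congr 1
  refine Finset.sum_congr rfl fun d _ => ?_
  rw [wordError, Finset.mul_sum]
  refine Finset.sum_congr rfl fun y _ => ?_
  have hdec := s.scDecoder_congr (inducedMAC pQ fx fw P) S A
    (fun v hv => (codeword_frozen A f d hv).symm) (fun t => (y t, τ t))
  rw [toReal_bind_map, piPMF_apply, ENNReal.toReal_prod, PMF.uniformOfFintype_apply,
    ENNReal.toReal_inv, ENNReal.toReal_natCast, hs.encoder_eq, hs.encoder_eq]
  have hiff : ((d, y) ∈ {ω : ((j : Fin 2) → A j → ZMod q) × (Idx n k → Y) | ∃ (j : Fin 2) (i : A j),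
      s.scDecoder (inducedMAC pQ fx fw P) S A f (fun t => (ω.2 t, τ t)) (j, i) ≠ ω.1 j i}) ↔
      ∃ v : Var n k, v.2 ∈ A v.1 ∧ s.scDecoder (inducedMAC pQ fx fw P) S A (codeword A f d)
        (fun t => (y t, τ t)) v ≠ codeword A f d v := by
    rw [← hdec]
    constructor
    · rintro ⟨j, i, h⟩
      exact ⟨(j, i), i.2, by rwa [codeword_info]⟩
    · rintro ⟨⟨j, i⟩, hi, h⟩
      exact ⟨j, ⟨i, hi⟩, fun h' => h (h'.trans (codeword_info A f d j ⟨i, hi⟩).symm)⟩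
  by_cases h : ∃ v : Var n k, v.2 ∈ A v.1 ∧ s.scDecoder (inducedMAC pQ fx fw P) S A
      (codeword A f d) (fun t => (y t, τ t)) v ≠ codeword A f d v
  · rw [if_pos h, if_pos (hiff.2 h)]
  · rw [if_neg h, if_neg fun h' => h (hiff.1 h'), mul_zero]

/-- The mean over uniform frozen values and over time-sharing sequences with independent letters
is the error probability on the induced channel, which has the time-sharing letter as part of its
output. -/
lemma sum_wordError :
    ∑ τ : Idx n k → Fin m, ∑ g, (∏ t, (pQ (τ t)).toReal) *
      ((q : ℝ) ^ (2 * Fintype.card (Idx n k)))⁻¹ * wordError A pQ fx fw P hs S τ g ≤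
      ∑ v ∈ infoSymbols A, s.symbolEnt (inducedMAC pQ fx fw P) S v := by
  classical
  refine le_trans (le_of_eq ?_) (sum_scDecoder_error_le s (inducedMAC pQ fx fw P) S A)
  rw [Fintype.sum_prod_type, ← Equiv.sum_comp hs.symbolEquiv.symm, Finset.sum_comm]
  refine Finset.sum_congr rfl fun g _ => ?_
  rw [← Equiv.sum_comp (Equiv.arrowProdEquivProdArrow (Idx n k) (fun _ => Y) (fun _ => Fin m)).symm,
    Fintype.sum_prod_type, Finset.sum_comm]
  refine Finset.sum_congr rfl fun τ _ => ?_
  rw [wordError, Finset.mul_sum]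
  refine Finset.sum_congr rfl fun y _ => ?_
  simp only [hs.symbol_symbolEquiv_symm]
  rw [mul_ite, mul_zero]
  have hw : (∏ t, (pQ (τ t)).toReal) * ((q : ℝ) ^ (2 * Fintype.card (Idx n k)))⁻¹ *
      ∏ t, (P (fx (hs.symbolEquiv.symm g 0 t) (τ t)) (fw (hs.symbolEquiv.symm g 1 t) (τ t))
        (y t)).toReal = chanWt (inducedMAC pQ fx fw P) (Idx n k)
          (hs.symbolEquiv.symm g, fun t => (y t, τ t)) := by
    simp only [chanWt, toReal_inducedMAC, Finset.prod_mul_distrib]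
    ring
  rw [hw]
  rfl

variable {Z : Type*} [Fintype Z] (P' : X → W → PMF Z) (S' : Perm n k)

/-- If the information symbols have small conditional entropies at both receivers, some frozen
values and some time-sharing sequence are good for both. -/
lemma exists_frozen_errorProb_le {δ : ℝ}
    (h : ∑ v ∈ infoSymbols A, s.symbolEnt (inducedMAC pQ fx fw P) S v +
      ∑ v ∈ infoSymbols A, s.symbolEnt (inducedMAC pQ fx fw P') S' v ≤ δ) :
    ∃ (f : Var n k → ZMod q) (τ : Idx n k → Fin m),
      errorProb P fx fw τ A (hs.encoder A f) (s.scDecoder (inducedMAC pQ fx fw P) S A f) ≤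
        ENNReal.ofReal δ ∧
      errorProb P' fx fw τ A (hs.encoder A f) (s.scDecoder (inducedMAC pQ fx fw P') S' A f) ≤
        ENNReal.ofReal δ := by
  classical
  set c : ℝ := ((q : ℝ) ^ (2 * Fintype.card (Idx n k)))⁻¹ with hc
  set D : ℝ := (Fintype.card ((j : Fin 2) → A j → ZMod q) : ℝ)⁻¹ with hD
  have hcard : (Fintype.card (Var n k → ZMod q) : ℝ) = c⁻¹ := by
    rw [hc, inv_inv, Fintype.card_fun, ZMod.card, Fintype.card_prod, Fintype.card_fin, Nat.cast_pow]
  have hc0 : 0 < c := by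
    have : (0 : ℝ) < q := by exact_mod_cast NeZero.pos q
    positivity
  set w : (Idx n k → Fin m) × (Var n k → ZMod q) → ℝ := fun p => (∏ t, (pQ (p.1 t)).toReal) * c
  have hw0 : ∀ p, 0 ≤ w p := fun p =>
    mul_nonneg (Finset.prod_nonneg fun _ _ => ENNReal.toReal_nonneg) hc0.le
  have hw1 : ∑ p, w p = 1 := by
    rw [Fintype.sum_prod_type]
    simp only [w, Finset.sum_const, Finset.card_univ, nsmul_eq_mul, hcard]
    rw [← sum_prod_toReal fun _ : Idx n k => pQ]
    refine Finset.sum_congr rfl fun τ _ => ?_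
    field_simp
  set e : (Idx n k → Fin m) × (Var n k → ZMod q) → ℝ := fun p =>
    D * ∑ d, wordError A pQ fx fw P hs S p.1 (codeword A p.2 d)
  set e' : (Idx n k → Fin m) × (Var n k → ZMod q) → ℝ := fun p =>
    D * ∑ d, wordError A pQ fx fw P' hs S' p.1 (codeword A p.2 d)
  have hsum : ∑ p, w p * (e p + e' p) ≤ δ := by
    refine le_trans (le_of_eq ?_) ((add_le_add (sum_wordError A pQ fx fw P hs S)
      (sum_wordError A pQ fx fw P' hs S')).trans h)
    rw [Fintype.sum_prod_type, ← Finset.sum_add_distrib]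
    refine Finset.sum_congr rfl fun τ _ => ?_
    simp only [w, e, e', mul_add, Finset.sum_add_distrib, ← Finset.mul_sum]
    rw [Finset.mul_sum, Finset.mul_sum]
    rw [← sum_codeword A (wordError A pQ fx fw P hs S τ),
      ← sum_codeword A (wordError A pQ fx fw P' hs S' τ)]
    simp only [Finset.mul_sum]
    rfl
  obtain ⟨⟨τ, f⟩, hp⟩ := exists_le_of_sum_mul_le hw0 hw1 hsum
  have h0 : 0 ≤ e (τ, f) := mul_nonneg (by positivity)
    (Finset.sum_nonneg fun d _ => wordError_nonneg A pQ fx fw P hs S τ _)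
  have h0' : 0 ≤ e' (τ, f) := mul_nonneg (by positivity)
    (Finset.sum_nonneg fun d _ => wordError_nonneg A pQ fx fw P' hs S' τ _)
  refine ⟨f, τ, ?_, ?_⟩
  · rw [errorProb_eq]
    exact ENNReal.ofReal_le_ofReal (by linarith)
  · rw [errorProb_eq]
    exact ENNReal.ofReal_le_ofReal (by linarith)

end Averaging

/-! ### Achievability -/

section Achievability

/-- Information sets of prescribed rate exist in any set whose rate is large enough; the rate is a
multiple of `L / M`. -/
lemma exists_subset_rate {α : Type*} (G : Finset α) {M L R δ : ℝ} (hM : 0 < M) (hL : 0 < L)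
    (hR : 0 ≤ R) (hG : R - δ < G.card / M * L) (hδ : L / M < δ) :
    ∃ A ⊆ G, |(A.card : ℝ) / M * L - R| < δ := by
  have hRM : 0 ≤ R * M / L := by positivity
  obtain ⟨A, hA, hcard⟩ := Finset.exists_subset_card_eq
    (min_le_left G.card ⌊R * M / L⌋₊)
  refine ⟨A, hA, ?_⟩
  have hδ0 : 0 < δ := (div_pos hL hM).trans hδ
  have e : R * M / L / M * L = R := by field_simp
  have hup : (A.card : ℝ) / M * L ≤ R := by
    rw [← e, hcard]
    gcongr
    exact (Nat.cast_le.2 (min_le_right _ _)).trans (Nat.floor_le hRM)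
  have hlow : R - δ < (A.card : ℝ) / M * L := by
    rcases min_choice G.card ⌊R * M / L⌋₊ with h | h
    · rwa [hcard, h]
    · rw [hcard, h]
      have h1 : R * M / L - 1 < ⌊R * M / L⌋₊ := by linarith [Nat.lt_floor_add_one (R * M / L)]
      have h2 : (R * M / L - 1) / M * L = R - L / M := by field_simp
      have h3 : (R * M / L - 1) / M * L < ⌊R * M / L⌋₊ / M * L := by gcongr
      linarith
  rw [abs_lt]
  constructor <;> linarith

variable {X W Y Z : Type*} [Fintype X] [Fintype W] [Fintype Y] [Fintype Z]

lemma sum_symbolEnt_le {q n k : ℕ} [NeZero q] {s : Scheme q n k}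
    (P : ZMod q → ZMod q → PMF Y) (S : Perm n k) (A : Fin 2 → Finset (Idx n k)) {θ : ℝ}
    (hθ : 0 ≤ θ) (h : ∀ j, ∀ i ∈ A j, s.symbolEnt P S (j, i) ≤ θ) :
    ∑ v ∈ infoSymbols A, s.symbolEnt P S v ≤ 2 * (2 ^ k * 2 ^ n) * θ := by
  refine (Finset.sum_le_card_nsmul _ _ θ fun v hv => h v.1 v.2 ?_).trans ?_
  · simpa [infoSymbols] using hv
  · rw [nsmul_eq_mul]
    gcongr
    have : (infoSymbols A).card ≤ 2 * (2 ^ k * 2 ^ n) := by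
      refine (Finset.card_le_univ _).trans_eq ?_
      rw [Fintype.card_prod, Fintype.card_fin, card_idx]
    exact_mod_cast this

/-- The information symbols are good for both receivers, so the sum of their entropies is at most the
block length times the threshold and vanishes for long blocks. -/
theorem polarAchievable_of_mem_capacityRegion (PY : X → W → PMF Y) (PZ : X → W → PMF Z)
    {R : Fin 2 → ℝ} (hR : R ∈ capacityRegion PY PZ) {β : ℝ} (hβ : β < 1 / 2) :
    PolarAchievable PY PZ β R := by
  obtain ⟨m, pQ, pX, pW, hR⟩ := hR
  intro δ hδ n₀
  -- a larger `β` makes the condition of being good stronger, so `β` may be taken positive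
  have hβ' : max β (1 / 4) < 1 / 2 := max_lt hβ (by norm_num)
  have hβ0 : 0 < max β (1 / 4) := lt_of_lt_of_le (by norm_num) (le_max_right β (1 / 4))
  obtain ⟨q, hq, fx, fw, hY, hZ⟩ := exists_induced_approx PY PZ pQ pX pW
    (show 0 < δ / 24 by positivity)
  obtain ⟨k, n₁, h⟩ := exists_scheme_of_close (inducedMAC pQ fx fw PY) (inducedMAC pQ fx fw PZ)
    (rateBounds_two_le PY pQ pX pW) (rateBounds_two_le PZ pQ pX pW) (I := R) hR hY hZ
    (show 0 < δ / 4 by positivity) (by linarith) hβ0 hβ'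
  have hlog : 0 < Real.log q := Real.log_pos (by exact_mod_cast hq.out.one_lt)
  have hlogb : 0 < Real.logb 2 q := Real.logb_pos (by norm_num) (by exact_mod_cast hq.out.one_lt)
  -- the depth `k` is fixed, so for long blocks the number of symbols times the threshold is small
  have hev1 := (tendsto_pow_mul_threshold hβ0).eventually_lt_const
    (show 0 < δ / (4 * 2 ^ k * Real.log q) by positivity)
  have hev2 := ((tendsto_const_nhds (x := Real.logb 2 q)).div_atTop
    (tendsto_pow_atTop_atTop_of_one_lt (r := (2 : ℝ)) (by norm_num))).eventually_lt_const hδ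
  obtain ⟨n, hn1, hn2, hn⟩ := (hev1.and (hev2.and
    (Filter.eventually_ge_atTop (max n₀ n₁)))).exists
  obtain ⟨s, hs, -, -, hj⟩ := h n (le_trans (le_max_right _ _) hn)
  have hbij := hs.isBijective
  have hrate : ∀ j, ∃ A ⊆ s.commonGood (max β (1 / 4)) (inducedMAC pQ fx fw PY)
      (inducedMAC pQ fx fw PZ) j,
      |(A.card : ℝ) / (2 ^ k * 2 ^ n) * Real.logb 2 q - R j| < δ := by
    intro j
    obtain ⟨h1, -, h3⟩ := hj j
    refine exists_subset_rate _ (by positivity) hlogb ?_ (by linarith) (lt_of_le_of_lt ?_ hn2)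
    · have hR0 : 0 ≤ R 0 ∧ 0 ≤ R 1 := ⟨hR.1.1, hR.1.2.1⟩
      fin_cases j
      exacts [hR0.1, hR0.2]
    · refine div_le_div_of_nonneg_left hlogb.le (by positivity) ?_
      exact le_mul_of_one_le_left (by positivity) (one_le_pow₀ (by norm_num))
  choose A hA hAr using hrate
  set θ := threshold n (max β (1 / 4)) * Real.log q with hθ
  have hθ0 : 0 ≤ θ := mul_nonneg (threshold_pos _ _).le hlog.le
  have hgood : ∀ j, ∀ i ∈ A j, s.symbolEnt (inducedMAC pQ fx fw PY) s.S (j, i) ≤ θ ∧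
      s.symbolEnt (inducedMAC pQ fx fw PZ) s.T (j, i) ≤ θ := by
    intro j i hi
    have hmem := hA j hi
    simp only [Scheme.commonGood, Finset.mem_filter, Finset.mem_univ, true_and,
      Scheme.good_iff hbij] at hmem
    exact ⟨hmem.1.le, hmem.2.le⟩
  have hsum : ∑ v ∈ infoSymbols A, s.symbolEnt (inducedMAC pQ fx fw PY) s.S v +
      ∑ v ∈ infoSymbols A, s.symbolEnt (inducedMAC pQ fx fw PZ) s.T v ≤ δ := by
    have h1 := sum_symbolEnt_le (inducedMAC pQ fx fw PY) s.S A hθ0 fun j i hi => (hgood j i hi).1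
    have h2 := sum_symbolEnt_le (inducedMAC pQ fx fw PZ) s.T A hθ0 fun j i hi => (hgood j i hi).2
    rw [lt_div_iff₀ (by positivity)] at hn1
    have h3 : 2 ^ n * threshold n (max β (1 / 4)) * (4 * 2 ^ k * Real.log q) =
      2 * (2 ^ k * 2 ^ n) * θ + 2 * (2 ^ k * 2 ^ n) * θ := by rw [hθ]; ring
    linarith
  obtain ⟨f, τ, hfY, hfZ⟩ := exists_frozen_errorProb_le A pQ fx fw PY hbij s.S PZ s.T hsum
  exact ⟨m, pQ, q, hq, fx, fw, n, k, s, A, f, τ, hbij.encoder A f, _, _,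
    le_trans (le_max_left _ _) hn, hs.mono (le_max_left _ _),
    fun j => (hA j).trans (commonGood_anti hbij (le_max_left _ _) _ _ j), hbij.isEncoder A f,
    isSCDecoder_scDecoder s _ s.S A f, isSCDecoder_scDecoder s _ s.T A f, hAr, hfY, hfZ⟩

end Achievability

end

end CompoundMAC

theorem mainTheorem1 {𝒳 𝒲 𝒴 𝒵 : Type*} [Fintype 𝒳] [Fintype 𝒲] [Fintype 𝒴] [Fintype 𝒵] :
    (∀ (q : ℕ) [Fact q.Prime] (PY : ZMod q → ZMod q → PMF 𝒴) (PZ : ZMod q → ZMod q → PMF 𝒵)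
      (I : Fin 2 → ℝ), I ∈ uniformRegion PY ∩ uniformRegion PZ →
      ∀ (ε β : ℝ), 0 < ε → β < 1 / 2 → ∀ n₀ : ℕ,
        HasAlignedScheme PY PZ (uniformRegion PY ∩ uniformRegion PZ) I ε β n₀) ∧
    (∀ (PY : 𝒳 → 𝒲 → PMF 𝒴) (PZ : 𝒳 → 𝒲 → PMF 𝒵)
      (m : ℕ) (pQ : PMF (Fin m)) (pX : Fin m → PMF 𝒳) (pW : Fin m → PMF 𝒲)
      (I : Fin 2 → ℝ), I ∈ rateRegion pQ pX pW PY ∩ rateRegion pQ pX pW PZ →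
      ∀ (ε β : ℝ), 0 < ε → β < 1 / 2 → ∀ n₀ : ℕ,
        ∃ (q : ℕ) (_ : Fact q.Prime) (fx : ZMod q → Fin m → 𝒳) (fw : ZMod q → Fin m → 𝒲),
          HasAlignedScheme (inducedMAC pQ fx fw PY) (inducedMAC pQ fx fw PZ)
            (rateRegion pQ pX pW PY ∩ rateRegion pQ pX pW PZ) I ε β n₀) ∧
    (∀ (PY : 𝒳 → 𝒲 → PMF 𝒴) (PZ : 𝒳 → 𝒲 → PMF 𝒵) (R : Fin 2 → ℝ),
      R ∈ capacityRegion PY PZ → ∀ β : ℝ, β < 1 / 2 → PolarAchievable PY PZ β R) := by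
  refine ⟨?_, ?_, ?_⟩
  · intro q _ PY PZ I hI ε β hε hβ n₀
    rw [uniformRegion_eq_pentagon, uniformRegion_eq_pentagon] at hI ⊢
    exact hasAlignedScheme_of_close PY PZ (uniformBounds_two_le PY) (uniformBounds_two_le PZ) hI
      (η := 0) (fun i => by simp) (fun i => by simp) hε (by linarith) hβ n₀
  · intro PY PZ m pQ pX pW I hI ε β hε hβ n₀
    obtain ⟨q, hq, fx, fw, hY, hZ⟩ := exists_induced_approx PY PZ pQ pX pW
      (show 0 < ε / 6 by positivity)
    rw [rateRegion_eq_pentagon, rateRegion_eq_pentagon] at hI ⊢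
    exact ⟨q, hq, fx, fw, hasAlignedScheme_of_close _ _ (rateBounds_two_le PY pQ pX pW)
      (rateBounds_two_le PZ pQ pX pW) hI hY hZ hε (by linarith) hβ n₀⟩
  · intro PY PZ R hR β hβ
    exact polarAchievable_of_mem_capacityRegion PY PZ hR hβ
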